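/- Graphs are finite and may have loops and parallel edges; each edge consists of two half-edges. A \emph{plane near-cubic graph} is a triple $\tilde G=(G,v,\nu)$, where $G$ is a connected plane graph, $v$ is a vertex of $G$, all vertices of $G$ other than $v$ have degree three, and $\nu$ is a bijection from the half-edges incident with $v$ to $\{0,\ldots,\deg(v)-1\}$ such that the half-edges $\nu^{-1}(0),\ldots,\nu^{-1}(\deg(v)-1)$ are drawn around $v$ in this clockwise cyclic order; without the requirements on the drawing, $\tilde G$ is a \emph{near-cubic graph}. Put $d(\tilde G)=\deg(v)$. A \emph{$3$-edge-coloring} of $\tilde G$ assigns colors $1,2,3$ to the edges of $G$ so that each vertex other than $v$ is incident with edges of all three colors. A \emph{$d$-precoloring} is a function $\psi:\{0,\ldots,d-1\}\to\{1,2,3\}$ with $|\psi^{-1}(1)|\equiv|\psi^{-1}(2)|\equiv|\psi^{-1}(3)|\equiv d\pmod 2$. For a $d(\tilde G)$-precoloring $\psi$, let $n_{\tilde G}(\psi)$ be the number of $3$-edge-colorings of $\tilde G$ that give, for every half-edge $h$ incident with $v$, the color $\psi(\nu(h))$ to the edge containing $h$. Let $\mathrm{ray}(\tilde G)$ be the set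 of all non-negative real multiples of the vector $n_{\tilde G}$. Let $\tilde R_{5,12}$ be the near-cubic graph whose vertices are $v,x_0,\ldots,x_4$, where for each $i\in\{0,\ldots,4\}$ the vertex $x_i$ is joined to $v$ by an edge whose half-edge at $v$ has number $i$, and $x_i$ is joined to $x_{(i+2)\bmod 5}$ by an edge. The following claims are equivalent. (a) Every planar cubic $2$-edge-connected graph is $3$-edge-colorable. (b) For every plane near-cubic graph $\tilde G$ with $d(\tilde G)=5$, if $n_{\tilde G}\in\mathrm{ray}(\tilde R_{5,12})$, then $n_{\tilde G}$ is the zero function. -/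

import Mathlib

/-- A finite graph, with loops and parallel edges allowed, given by its half-edges. The half-edge
`x` is incident with the vertex `vert x`, and `opp x` is the other half of the same edge. So an
edge is a pair `{x, opp x}`, and a loop contributes two half-edges to its vertex. -/
structure HalfEdgeGraph where
  V : Type
  H : Type
  [finV : Finite V]
  [finH : Finite H]
  vert : H → V
  opp : H → H
  opp_invol : Function.Involutive opp
  opp_ne : ∀ x, opp x ≠ x

namespace HalfEdgeGraph

attribute [instance] HalfEdgeGraph.finV HalfEdgeGraph.finH

/-- The degree of a vertex: the number of half-edges incident with it. -/
noncomputable def degree (G : HalfEdgeGraph) (u : G.V) : ℕ :=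
  Nat.card {x : G.H // G.vert x = u}

/-- Every vertex has degree three. -/
def IsCubic (G : HalfEdgeGraph) : Prop :=
  ∀ u, G.degree u = 3

/-- There is a walk from `u` to `w` that uses no half-edge of `S`. -/
def ReachableWithout (G : HalfEdgeGraph) (S : Set G.H) (u w : G.V) : Prop :=
  Relation.ReflTransGen (fun a b => ∃ x, x ∉ S ∧ G.vert x = a ∧ G.vert (G.opp x) = b) u w

/-- The graph is nonempty and any two of its vertices are joined by a walk. -/
def Connected (G : HalfEdgeGraph) : Prop :=
  Nonempty G.V ∧ ∀ u w, G.ReachableWithout ∅ u w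

/-- The graph is connected and stays connected after the deletion of any one edge. -/
def TwoEdgeConnected (G : HalfEdgeGraph) : Prop :=
  G.Connected ∧ ∀ x u w, G.ReachableWithout {x, G.opp x} u w

/-- An assignment of three colors to the edges: both halves of an edge have the same color. -/
def EdgeColoring (G : HalfEdgeGraph) : Type :=
  {c : G.H → Fin 3 // ∀ x, c (G.opp x) = c x}

/-- The half-edges incident with `u` have pairwise different colors. (In particular no loop is
incident with `u`.) -/
def EdgeColoring.ProperAt {G : HalfEdgeGraph} (c : G.EdgeColoring) (u : G.V) : Prop :=
  ∀ x y, G.vert x = u → G.vert y = u → x ≠ y → c.1 x ≠ c.1 y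

/-- The edges can be colored by three colors so that edges with a common vertex differ in color. -/
def ThreeEdgeColorable (G : HalfEdgeGraph) : Prop :=
  ∃ c : G.EdgeColoring, ∀ u, c.ProperAt u

/-- A rotation system: a cyclic (say, clockwise) order of the half-edges around each vertex, given
by the permutation that sends each half-edge to the next one around the same vertex. -/
structure Rotation (G : HalfEdgeGraph) where
  next : Equiv.Perm G.H
  sameCycle_iff : ∀ x y, next.SameCycle x y ↔ G.vert x = G.vert y

/-- The permutation that traces the boundaries of the faces: cross to the other half of the edge,
then turn to the next half-edge around the vertex there. -/
def Rotation.facePerm {G : HalfEdgeGraph} (R : G.Rotation) : Equiv.Perm G.H :=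
  G.opp_invol.toPerm.trans R.next

/-- The faces: the orbits of the face-tracing permutation. -/
def Rotation.Face {G : HalfEdgeGraph} (R : G.Rotation) : Type :=
  Quotient (Equiv.Perm.SameCycle.setoid R.facePerm)

/-- For a connected graph with at least one edge: the rotation system is that of a drawing in the
plane, that is, its genus is zero, `|V| - |E| + |F| = 2`. The number of edges is half the number
of half-edges. -/
def Rotation.IsPlane {G : HalfEdgeGraph} (R : G.Rotation) : Prop :=
  Nat.card G.V + Nat.card R.Face = Nat.card G.H / 2 + 2

/-- A connected graph with at least one edge is planar if it has a plane rotation system. -/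
def IsPlanar (G : HalfEdgeGraph) : Prop :=
  ∃ R : G.Rotation, R.IsPlane

end HalfEdgeGraph

/-- A near-cubic graph `(G, v, ν)` with `deg v = d`: a connected graph `G`, a vertex `v` such that
all other vertices have degree three, and a numbering `ν` of the half-edges incident with `v` by
`0, …, d - 1`. -/
structure NearCubicGraph (d : ℕ) where
  G : HalfEdgeGraph
  v : G.V
  ν : {x : G.H // G.vert x = v} ≃ Fin d
  connected : G.Connected
  cubic : ∀ u, u ≠ v → G.degree u = 3

/-- A `d`-precoloring: a function from `{0, …, d - 1}` to the three colors for which the number of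
occurrences of each color has the parity of `d`. -/
def Precoloring (d : ℕ) : Type :=
  {ψ : Fin d → Fin 3 // ∀ c, Nat.card {i // ψ i = c} ≡ d [MOD 2]}

namespace NearCubicGraph

variable {d : ℕ}

/-- The graph has a drawing in the plane in which the half-edges numbered `0, …, d - 1` appear
around `v` in this cyclic order. -/
def IsPlane (N : NearCubicGraph d) : Prop :=
  ∃ R : N.G.Rotation, R.IsPlane ∧
    ∀ i, R.next (N.ν.symm i : N.G.H) = (N.ν.symm (finRotate d i) : N.G.H)

/-- A 3-edge-coloring of a near-cubic graph: edges with a common vertex other than `v` have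
different colors. -/
def IsThreeEdgeColoring (N : NearCubicGraph d) (c : N.G.EdgeColoring) : Prop :=
  ∀ u, u ≠ N.v → c.ProperAt u

/-- The coloring gives the half-edge numbered `i` at `v` the color `ψ i`. -/
def Extends (N : NearCubicGraph d) (c : N.G.EdgeColoring) (ψ : Precoloring d) : Prop :=
  ∀ x : {x : N.G.H // N.G.vert x = N.v}, c.1 x = ψ.1 (N.ν x)

/-- The number of 3-edge-colorings that extend the precoloring `ψ`, as a vector indexed by `ψ`. -/
noncomputable def extensionCount (N : NearCubicGraph d) : Precoloring d → ℝ :=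
  fun ψ => (Nat.card {c : N.G.EdgeColoring // N.IsThreeEdgeColoring c ∧ N.Extends c ψ} : ℝ)

/-- The set of all non-negative multiples of the vector of extension counts. -/
def ray (N : NearCubicGraph d) : Set (Precoloring d → ℝ) :=
  {x | ∃ t : ℝ, 0 ≤ t ∧ x = t • N.extensionCount}

end NearCubicGraph

namespace PetersenFragment

/-- The underlying graph of the Petersen fragment. The vertices are `none`, which is `v`, and
`some 0, …, some 4`. For each `i` there are two edges: one joins `v` (half-edge `(0, i)`) to
`some i` (half-edge `(1, i)`), the other joins `some i` (half-edge `(2, i)`) to `some (i + 2)`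
(half-edge `(3, i)`), indices modulo five. -/
def graph : HalfEdgeGraph where
  V := Option (Fin 5)
  H := Fin 4 × Fin 5
  vert x := (![none, some x.2, some x.2, some (x.2 + 2)] : Fin 4 → Option (Fin 5)) x.1
  opp x := ((![1, 0, 3, 2] : Fin 4 → Fin 4) x.1, x.2)
  opp_invol := by unfold Function.Involutive; decide
  opp_ne := by decide

/-- The half-edge `(0, i)` at `v` gets the number `i`. -/
def numbering : {x : graph.H // graph.vert x = none} ≃ Fin 5 where
  toFun x := x.1.2
  invFun i := ⟨((0 : Fin 4), i), rfl⟩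
  left_inv := by
    rintro ⟨⟨k, i⟩, h⟩
    fin_cases k
    · rfl
    all_goals cases h
  right_inv _ := rfl

theorem connected : graph.Connected := by
  have key : ∀ i : Fin 5, graph.ReachableWithout ∅ none (some i) ∧
      graph.ReachableWithout ∅ (some i) none := fun i =>
    ⟨Relation.ReflTransGen.single ⟨((0 : Fin 4), i), id, rfl, rfl⟩,
      Relation.ReflTransGen.single ⟨((1 : Fin 4), i), id, rfl, rfl⟩⟩
  have toV : ∀ u, graph.ReachableWithout ∅ u none := by
    rintro (_ | i)
    · exact Relation.ReflTransGen.refl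
    · exact (key i).2
  have fromV : ∀ w, graph.ReachableWithout ∅ none w := by
    rintro (_ | i)
    · exact Relation.ReflTransGen.refl
    · exact (key i).1
  exact ⟨⟨(none : Option (Fin 5))⟩, fun u w => (toV u).trans (fromV w)⟩

theorem cubic : ∀ u, u ≠ none → graph.degree u = 3 := by
  have h : ∀ i : Fin 5, Fintype.card {x : Fin 4 × Fin 5 //
      (![none, some x.2, some x.2, some (x.2 + 2)] : Fin 4 → Option (Fin 5)) x.1 = some i} = 3 := by
    decide
  rintro (_ | i) hu
  · exact absurd rfl hu
  · have := h i
    rw [← Nat.card_eq_fintype_card] at this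
    exact this

end PetersenFragment

/-- The Petersen graph with the five edges between an inner and an outer pentagon cut and the outer
pentagon contracted to the vertex `v`: five vertices joined to `v` in the cyclic order `0, …, 4`
and to each other by the pentagram `0, 2, 4, 1, 3`. -/
def petersenFragment : NearCubicGraph 5 where
  G := PetersenFragment.graph
  v := none
  ν := PetersenFragment.numbering
  connected := PetersenFragment.connected
  cubic := PetersenFragment.cubic

/-!
The Petersen fragment is what remains of the Petersen graph when one pentagon is contracted, and the
theorem rests on comparing a plane near-cubic graph with it. A coloring of five spokes never extends
both to a pentagon (`CycleExtends`) and to the pentagram of the fragment, since the Petersen graph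
is not 3-edge-colorable (`CycleExtends.not_isPentagramColoring`). If each color occurs an odd number
of times, the colorings that do not extend to the pentagon are those with two single colors at
distance two (`exists_twoSingles`), and these extend to the pentagram in exactly one way. So the
vector of the fragment is the indicator function of these patterns.

Suppose that planar cubic 2-edge-connected graphs are colorable, and let a plane near-cubic graph
have a coloring and a vector in the ray of the fragment. Expand its distinguished vertex to a
pentagon. The result is plane and cubic, and it is 2-edge-connected: a bridge would contradict the
parity lemma for the given coloring (`NearCubicGraph.cut_eq`). A coloring of it restricts to one of
the near-cubic graph whose spokes extend to the pentagon, and at this pattern the vector of the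
fragment vanishes while that of the graph does not (`NearCubicGraph.extensionCount_eq_zero`).

Conversely, suppose that there is a planar cubic 2-edge-connected graph that is not colorable. Allow
vertices of degree two, at which a coloring is constant, and take a counterexample that is as small
as possible. Vertices of degree two could be suppressed, so it is cubic, and by Euler's formula it
has a face of length at most five. Some edge of this face is the only one that separates its two
faces (`CombMap.Plane.exists_edge`): otherwise there would be two crossing two-edge cuts, whose
intersection would be a cut of two consecutive edges of the face, leaving a bridge at their common
vertex. Deleting this edge creates no bridge, so that minimality provides a coloring outside the
face. No such coloring extends to the boundary of the face. For faces of length at most four this is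
impossible, after a Kempe switch in one case. For length five, contract the face to the
distinguished vertex of a plane near-cubic graph. Kempe switches show that all patterns that do not
extend to the pentagon have the same number of colorings (`NearCubicGraph.colorCount_twoSingles`),
as every outcome of a switch but one would extend. Hence the vector is a multiple of that of the
fragment, and it is not zero.

Topology enters only through the genus. Plane graphs are treated as combinatorial maps (`CombMap`),
a cut is a function to `ZMod 2` that is constant on the vertices, and connectedness and bridges are
expressed by cuts. The span of the cuts and the functions on the edges lies in the orthogonal
complement of the space of face boundaries. Counting dimensions gives Euler's inequality
(`CombMap.Conn.euler_le`), so that a map is seen to be plane by exhibiting enough vertices and faces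
(`CombMap.Conn.plane_of_labels`). In genus zero the two spaces coincide, a combinatorial Jordan
curve theorem: every function orthogonal to the face boundaries is a cut up to a function on the
edges (`CombMap.Plane.exists_cut`).
-/

/-! ### Combinatorial maps and Euler's formula mod 2 -/

/-- A combinatorial map: a graph embedded in a surface, given by the permutation `σ` that turns
each half-edge to the next one around its vertex and the involution `α` that exchanges the two
halves of every edge. The vertices are the cycles of `σ`. -/
structure CombMap where
  H : Type
  [finH : Finite H]
  σ : Equiv.Perm H
  α : H → H
  invol : Function.Involutive α
  ne : ∀ x, α x ≠ x

/-- The number of cycles of a permutation, fixed points included. -/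
noncomputable def cycleCount {H : Type} (τ : Equiv.Perm H) : ℕ :=
  Nat.card (Quotient (Equiv.Perm.SameCycle.setoid τ))

/-- The functions mod 2 that are constant on the cycles of a permutation. -/
def invariants {H : Type} (τ : Equiv.Perm H) : Submodule (ZMod 2) (H → ZMod 2) where
  carrier := {f | ∀ h, f (τ h) = f h}
  add_mem' ha hb h := by simp [ha h, hb h]
  zero_mem' _ := rfl
  smul_mem' c f hf h := by simp [hf h]

theorem mem_invariants {H : Type} {τ : Equiv.Perm H} {f : H → ZMod 2} :
    f ∈ invariants τ ↔ ∀ h, f (τ h) = f h := Iff.rfl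

theorem zmod_two_add_self (a : ZMod 2) : a + a = 0 := CharTwo.add_self_eq_zero a

theorem zmod_two_eq_of_add {a b : ZMod 2} (h : a + b = 0) : a = b := CharTwo.add_eq_zero.1 h

/-- A function invariant under a permutation is constant on its cycles. -/
theorem eq_of_sameCycle {H : Type} [Finite H] {A : Type*} {τ : Equiv.Perm H} {f : H → A}
    (hf : ∀ h, f (τ h) = f h) {x y : H} (h : τ.SameCycle x y) : f x = f y := by
  obtain ⟨n, rfl⟩ := h.exists_nat_pow_eq
  induction n with
  | zero => rfl
  | succ n ih => rw [pow_succ', Equiv.Perm.mul_apply, hf]; exact ih ⟨n, by simp⟩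

theorem finrank_invariants {H : Type} [Finite H] (τ : Equiv.Perm H) :
    Module.finrank (ZMod 2) (invariants τ) = cycleCount τ := by
  let e : (Quotient (Equiv.Perm.SameCycle.setoid τ) → ZMod 2) ≃ₗ[ZMod 2] invariants τ :=
    { toFun := fun q => ⟨fun h => q (Quotient.mk _ h), fun h => congrArg q
        (Quotient.sound ((Equiv.Perm.sameCycle_apply_left).2 (Equiv.Perm.SameCycle.refl _ _)))⟩
      map_add' := fun _ _ => rfl
      map_smul' := fun _ _ => rfl
      invFun := fun f => Quotient.lift f.1 fun _ _ h => eq_of_sameCycle f.2 h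
      left_inv := fun q => by
        funext x
        induction x using Quotient.inductionOn with
        | h x => rfl
      right_inv := fun f => rfl }
  have := Fintype.ofFinite (Quotient (Equiv.Perm.SameCycle.setoid τ))
  rw [← e.finrank_eq, Module.finrank_fintype_fun_eq_card, cycleCount, Nat.card_eq_fintype_card]

/-- A surjective labelling that is constant on cycles bounds the number of cycles from below. -/
theorem card_le_cycleCount {H B : Type} [Finite H] {τ : Equiv.Perm H} (l : H → B)
    (hl : ∀ h, l (τ h) = l h) (hs : Function.Surjective l) : Nat.card B ≤ cycleCount τ := by
  refine Nat.card_le_card_of_surjective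
    (Quotient.lift (s := Equiv.Perm.SameCycle.setoid τ) l fun _ _ h => eq_of_sameCycle hl h) ?_
  intro b
  obtain ⟨h, rfl⟩ := hs b
  exact ⟨Quotient.mk _ h, rfl⟩

/-- The standard bilinear form mod 2. -/
noncomputable def dotForm (H : Type) [Fintype H] : LinearMap.BilinForm (ZMod 2) (H → ZMod 2) :=
  dotProductBilin (ZMod 2) (ZMod 2)

theorem dotForm_apply {H : Type} [Fintype H] (f g : H → ZMod 2) :
    dotForm H f g = ∑ h, f h * g h := rfl

theorem dotForm_isRefl (H : Type) [Fintype H] : (dotForm H).IsRefl := by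
  intro f g h
  rw [dotForm_apply] at h ⊢
  rw [← h]
  exact Finset.sum_congr rfl fun _ _ => mul_comm _ _

theorem dotForm_nondegenerate (H : Type) [Fintype H] : (dotForm H).Nondegenerate := by
  classical
  have key : ∀ f : H → ZMod 2, (∀ g, dotForm H f g = 0) → f = 0 := by
    intro f hf
    funext h
    have := hf (Pi.single h 1)
    simpa [dotForm_apply, Pi.single_apply] using this
  refine ⟨fun f hf => key f hf, fun f hf => key f fun g => ?_⟩
  exact dotForm_isRefl H _ _ (hf g)

theorem finrank_dot_orthogonal {H : Type} [Fintype H] (W : Submodule (ZMod 2) (H → ZMod 2)) :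
    Module.finrank (ZMod 2) ((dotForm H).orthogonal W) + Module.finrank (ZMod 2) W
      = Nat.card H := by
  rw [LinearMap.BilinForm.finrank_orthogonal (dotForm_nondegenerate H),
    Nat.sub_add_cancel (Submodule.finrank_le _), Module.finrank_fintype_fun_eq_card,
    Nat.card_eq_fintype_card]

/-- A sum over the half-edges may be restricted to any set of edges outside of which the two halves
of every edge contribute the same, mod 2. -/
theorem sum_eq_sum_of_involutive {H : Type} [Fintype H] {α : H → H} (hα : Function.Involutive α)
    (hne : ∀ x, α x ≠ x) (T : Finset H) (hT : ∀ x, α x ∈ T → x ∈ T) (F : H → ZMod 2)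
    (hF : ∀ x, x ∉ T → F (α x) = F x) : ∑ h, F h = ∑ h ∈ T, F h := by
  classical
  have h0 : ∑ h ∈ Tᶜ, F h = 0 := by
    refine Finset.sum_involution (fun x _ => α x) ?_ (fun x _ _ => hne x) ?_ (fun x _ => hα x)
    · intro x hx
      rw [hF x (Finset.mem_compl.1 hx), zmod_two_add_self]
    · intro x hx
      exact Finset.mem_compl.2 fun h => Finset.mem_compl.1 hx (hT x h)
  rw [← Finset.sum_add_sum_compl T, h0, add_zero]

namespace CombMap

attribute [instance] CombMap.finH

variable (M : CombMap)

/-- The involution `α` as a permutation. -/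
def flip : Equiv.Perm M.H := M.invol.toPerm

/-- The face permutation: cross to the other half of the edge, then turn around the vertex. -/
def φ : Equiv.Perm M.H := M.invol.toPerm.trans M.σ

theorem φ_apply (h : M.H) : M.φ h = M.σ (M.α h) := rfl

theorem flip_apply (h : M.H) : M.flip h = M.α h := rfl

@[simp] theorem α_α (h : M.H) : M.α (M.α h) = h := M.invol h

theorem φ_α (h : M.H) : M.φ (M.α h) = M.σ h := by rw [φ_apply, α_α]

/-- Only the constant functions mod 2 are constant on the vertices and on the edges. -/
def Conn : Prop :=
  ∀ g : M.H → ZMod 2, (∀ h, g (M.σ h) = g h) → (∀ h, g (M.α h) = g h) → ∀ a b, g a = g b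

/-- The Euler characteristic is that of the sphere. -/
def Plane : Prop :=
  cycleCount M.σ + cycleCount M.φ = Nat.card M.H / 2 + 2

/-- No edge has the same face on both sides. For a connected plane map this means that there is no
bridge. -/
def Bridgeless : Prop := ∀ h, ¬ M.φ.SameCycle h (M.α h)

/-- The operator that sends a function on the half-edges to the sums over the two halves of each
edge. -/
def edgeSum : (M.H → ZMod 2) →ₗ[ZMod 2] (M.H → ZMod 2) where
  toFun f h := f h + f (M.α h)
  map_add' f g := by funext h; simp only [Pi.add_apply]; ring
  map_smul' c f := by funext h; simp [mul_add]

theorem edgeSum_apply (f : M.H → ZMod 2) (h : M.H) : M.edgeSum f h = f h + f (M.α h) := rfl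

theorem ker_edgeSum : LinearMap.ker M.edgeSum = invariants M.flip := by
  ext f
  rw [LinearMap.mem_ker, mem_invariants, funext_iff]
  refine forall_congr' fun h => ?_
  rw [edgeSum_apply, flip_apply, Pi.zero_apply, CharTwo.add_eq_zero, eq_comm]

/-- Cuts and face boundaries are orthogonal. -/
theorem sum_mul_edgeSum_eq_zero [Fintype M.H] {g f : M.H → ZMod 2} (hg : ∀ h, g (M.σ h) = g h)
    (hf : ∀ h, f (M.φ h) = f h) : ∑ h, g h * (f h + f (M.α h)) = 0 := by
  have h1 : ∀ h, f (M.α h) = f (M.σ h) := fun h => by rw [← hf (M.α h), φ_α]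
  have h2 : ∑ h, g h * f (M.α h) = ∑ h, g h * f h := by
    rw [← Equiv.sum_comp M.σ (fun h => g h * f h)]
    exact Finset.sum_congr rfl fun h _ => by rw [h1, hg]
  simp only [mul_add, Finset.sum_add_distrib]
  rw [h2, zmod_two_add_self]

theorem sum_mul_edge_eq_zero [Fintype M.H] {c f : M.H → ZMod 2} (hc : ∀ h, c (M.α h) = c h)
    (hf : ∀ h, f (M.α h) = f h) : ∑ h, c h * f h = 0 := by
  rw [sum_eq_sum_of_involutive M.invol M.ne ∅ (by simp) _ (fun x _ => by rw [hc, hf])]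
  simp

theorem two_mul_finrank_edge :
    2 * Module.finrank (ZMod 2) (invariants M.flip) = Nat.card M.H := by
  classical
  have := Fintype.ofFinite M.H
  have h : (dotForm M.H).orthogonal (invariants M.flip) = invariants M.flip := by
    ext f
    rw [LinearMap.BilinForm.mem_orthogonal_iff]
    constructor
    · intro hf h
      have := hf (Pi.single h 1 + Pi.single (M.α h) 1) (by
        intro x
        simp only [flip_apply, Pi.add_apply, Pi.single_apply, M.invol.eq_iff, α_α]
        rw [add_comm])
      rw [map_add, LinearMap.add_apply, dotForm_apply,
        dotForm_apply] at this
      simp only [Pi.single_apply, ite_mul, one_mul, zero_mul, Finset.sum_ite_eq',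
        Finset.mem_univ, if_true] at this
      exact (zmod_two_eq_of_add this).symm
    · intro hf g hg
      exact M.sum_mul_edge_eq_zero hg hf
  have h2 := finrank_dot_orthogonal (invariants M.flip)
  rw [h] at h2
  omega

variable {M}

theorem finrank_inf_eq_one [Nonempty M.H] {τ : Equiv.Perm M.H}
    (h : ∀ g : M.H → ZMod 2, (∀ h, g (τ h) = g h) → (∀ h, g (M.α h) = g h) → ∀ a b, g a = g b) :
    Module.finrank (ZMod 2) (invariants τ ⊓ invariants M.flip : Submodule _ _) = 1 := by
  have : invariants τ ⊓ invariants M.flip = Submodule.span (ZMod 2) {fun _ => 1} := by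
    ext f
    rw [Submodule.mem_inf, Submodule.mem_span_singleton]
    constructor
    · rintro ⟨h1, h2⟩
      obtain ⟨x⟩ := ‹Nonempty M.H›
      exact ⟨f x, funext fun y => by simpa using h f h1 h2 x y⟩
    · rintro ⟨c, rfl⟩
      exact ⟨fun _ => rfl, fun _ => rfl⟩
  rw [this, finrank_span_singleton]
  intro h0
  obtain ⟨x⟩ := ‹Nonempty M.H›
  exact one_ne_zero (congrFun h0 x)

theorem Conn.face (hM : M.Conn) (g : M.H → ZMod 2) (h1 : ∀ h, g (M.φ h) = g h)
    (h2 : ∀ h, g (M.α h) = g h) : ∀ a b, g a = g b :=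
  hM g (fun h => by rw [← φ_α, h1, h2]) h2

/-- The dimension of the space of face boundaries. -/
theorem finrank_boundaries [Nonempty M.H] (hM : M.Conn) :
    Module.finrank (ZMod 2) ((invariants M.φ).map M.edgeSum) + 1 = cycleCount M.φ := by
  have h := LinearMap.finrank_range_add_finrank_ker (M.edgeSum.domRestrict (invariants M.φ))
  rw [LinearMap.range_domRestrict, finrank_invariants, LinearMap.ker_domRestrict,
    ker_edgeSum] at h
  rw [← h, ← finrank_inf_eq_one hM.face]
  congr 1
  rw [← Submodule.map_comap_subtype, Submodule.finrank_map_subtype_eq]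

/-- The dimension of the span of the vertex functions and the edge functions. -/
theorem finrank_sup [Nonempty M.H] (hM : M.Conn) :
    2 * Module.finrank (ZMod 2) (invariants M.σ ⊔ invariants M.flip : Submodule _ _) + 2
      = 2 * cycleCount M.σ + Nat.card M.H := by
  have h := Submodule.finrank_sup_add_finrank_inf_eq (invariants M.σ) (invariants M.flip)
  rw [finrank_inf_eq_one hM, finrank_invariants M.σ] at h
  have := M.two_mul_finrank_edge
  omega

theorem sup_le_orthogonal [Fintype M.H] :
    invariants M.σ ⊔ invariants M.flip
      ≤ (dotForm M.H).orthogonal ((invariants M.φ).map M.edgeSum) := by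
  refine sup_le ?_ ?_
  · rintro g hg _ ⟨f, hf, rfl⟩
    exact dotForm_isRefl _ _ _ (M.sum_mul_edgeSum_eq_zero hg hf)
  · rintro c hc _ ⟨f, hf, rfl⟩
    refine dotForm_isRefl _ _ _ (M.sum_mul_edge_eq_zero hc fun h => ?_)
    rw [edgeSum_apply, edgeSum_apply, α_α, add_comm]

/-- Euler's inequality. -/
theorem Conn.euler_le [Nonempty M.H] (hM : M.Conn) :
    cycleCount M.σ + cycleCount M.φ ≤ Nat.card M.H / 2 + 2 := by
  have := Fintype.ofFinite M.H
  have h1 := finrank_boundaries hM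
  have h2 := finrank_sup hM
  have h3 := finrank_dot_orthogonal ((invariants M.φ).map M.edgeSum)
  have h4 := Submodule.finrank_mono (M.sup_le_orthogonal)
  omega

/-- To recognize a plane map, it suffices to label its vertices and faces with enough labels. -/
theorem Conn.plane_of_labels [Nonempty M.H] (hM : M.Conn) {A B : Type} (lV : M.H → A)
    (hV : ∀ h, lV (M.σ h) = lV h) (hVs : Function.Surjective lV) (lF : M.H → B)
    (hF : ∀ h, lF (M.φ h) = lF h) (hFs : Function.Surjective lF)
    (h : Nat.card M.H / 2 + 2 ≤ Nat.card A + Nat.card B) : M.Plane := by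
  have h1 := card_le_cycleCount lV hV hVs
  have h2 := card_le_cycleCount lF hF hFs
  have h3 := hM.euler_le
  unfold Plane
  omega

theorem Plane.nonempty (hP : M.Plane) : Nonempty M.H := by
  by_contra h
  rw [not_nonempty_iff] at h
  have h1 : ∀ τ : Equiv.Perm M.H, cycleCount τ = 0 := fun τ => by
    rw [cycleCount, Nat.card_eq_zero]
    exact Or.inl ⟨fun q => Quotient.inductionOn q fun x => h.elim x⟩
  rw [Plane, h1, h1] at hP
  omega

/-- On the sphere, every function on the half-edges that is orthogonal to all face boundaries is a
cut, up to a function on the edges. -/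
theorem Plane.exists_cut [Fintype M.H] (hP : M.Plane) (hM : M.Conn) (w : M.H → ZMod 2)
    (hw : ∀ f : M.H → ZMod 2, (∀ h, f (M.φ h) = f h) → ∑ h, w h * (f h + f (M.α h)) = 0) :
    ∃ g : M.H → ZMod 2, (∀ h, g (M.σ h) = g h) ∧
      ∀ h, g h + g (M.α h) = w h + w (M.α h) := by
  have := hP.nonempty
  have h1 := finrank_boundaries hM
  have h2 := finrank_sup hM
  have h3 := finrank_dot_orthogonal ((invariants M.φ).map M.edgeSum)
  have h5 := M.two_mul_finrank_edge
  rw [Plane] at hP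
  have h4 := Submodule.eq_of_le_of_finrank_eq (M.sup_le_orthogonal) (by omega)
  have h6 : w ∈ invariants M.σ ⊔ invariants M.flip := by
    rw [h4]
    rintro _ ⟨f, hf, rfl⟩
    exact dotForm_isRefl _ _ _ (hw f hf)
  obtain ⟨g, hg, c, hc, rfl⟩ := Submodule.mem_sup.1 h6
  refine ⟨g, hg, fun h => ?_⟩
  have := hc h
  rw [flip_apply] at this
  simp only [Pi.add_apply]
  rw [this, add_add_add_comm, zmod_two_add_self, add_zero]

end CombMap

/-! ### Counterexamples and the suppression of vertices of degree two -/

/-- The cycle of a permutation that contains `x`. -/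
def orbitMk {H : Type} (τ : Equiv.Perm H) (x : H) : Quotient (Equiv.Perm.SameCycle.setoid τ) :=
  Quotient.mk _ x

theorem orbitMk_eq {H : Type} {τ : Equiv.Perm H} {x y : H} :
    orbitMk τ x = orbitMk τ y ↔ τ.SameCycle x y := Quotient.eq

theorem orbitMk_apply {H : Type} (τ : Equiv.Perm H) (x : H) :
    orbitMk τ (τ x) = orbitMk τ x :=
  orbitMk_eq.2 (Equiv.Perm.sameCycle_apply_left.2 (Equiv.Perm.SameCycle.refl _ _))

theorem orbitMk_surjective {H : Type} (τ : Equiv.Perm H) : Function.Surjective (orbitMk τ) :=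
  Quotient.mk_surjective

theorem card_ne {A : Type} [Finite A] (a : A) : Nat.card {x : A // x ≠ a} + 1 = Nat.card A := by
  classical
  have := Fintype.ofFinite A
  have hpos : 0 < Fintype.card A := Fintype.card_pos_iff.2 ⟨a⟩
  rw [Nat.card_eq_fintype_card, Nat.card_eq_fintype_card, Fintype.card_subtype_compl,
    Fintype.card_subtype_eq]
  omega

theorem card_ne_ne {A : Type} [Finite A] {a b : A} (h : a ≠ b) :
    Nat.card {x : A // x ≠ a ∧ x ≠ b} + 2 = Nat.card A := by
  have h1 := card_ne a
  have h2 := card_ne (A := {x : A // x ≠ a}) ⟨b, h.symm⟩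
  have e : {x : {x : A // x ≠ a} // x ≠ ⟨b, h.symm⟩} ≃ {x : A // x ≠ a ∧ x ≠ b} :=
    (Equiv.subtypeEquivRight fun x => by rw [Ne, Subtype.ext_iff]).trans
      (Equiv.subtypeSubtypeEquivSubtypeInter (fun x => x ≠ a) fun x => x ≠ b)
  rw [Nat.card_congr e] at h2
  omega

namespace CombMap

variable {M : CombMap}

/-- The face on the boundary of which a half-edge lies. -/
def face (M : CombMap) (h : M.H) : Quotient (Equiv.Perm.SameCycle.setoid M.φ) := orbitMk M.φ h

theorem face_φ (h : M.H) : M.face (M.φ h) = M.face h := orbitMk_apply _ _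

/-- The other side of the edge of `h` lies in the face of the half-edge that follows `h` around
their vertex. -/
theorem face_α (h : M.H) : M.face (M.α h) = M.face (M.σ h) := by rw [← φ_α, face_φ]

theorem Bridgeless.face_ne (hB : M.Bridgeless) (h : M.H) : M.face h ≠ M.face (M.α h) :=
  fun he => hB h (orbitMk_eq.1 he)

/-- All vertices have degree two or three. -/
def Subcubic (M : CombMap) : Prop :=
  ∀ h, M.σ h ≠ h ∧ (M.σ (M.σ h) = h ∨ M.σ (M.σ (M.σ h)) = h)

/-- A map with vertices of degrees two and three has a coloring of its edges by three colors that
is proper at the vertices of degree three and constant at those of degree two. -/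
def Colorable (M : CombMap) : Prop :=
  ∃ c : M.H → Fin 3, (∀ h, c (M.α h) = c h) ∧
    ∀ h, (M.σ (M.σ h) = h → c (M.σ h) = c h) ∧ (M.σ (M.σ h) ≠ h → c (M.σ h) ≠ c h)

/-- A connected bridgeless plane map with vertices of degrees two and three that is not
colorable. -/
structure IsCounterexample (M : CombMap) : Prop where
  conn : M.Conn
  plane : M.Plane
  bridgeless : M.Bridgeless
  subcubic : M.Subcubic
  not_colorable : ¬ M.Colorable

/-- The map `N` is carried by the half-edges of `M` with the property `P`, with rotation `s` and
edge involution `a`. -/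
structure IsRestriction (M N : CombMap) (ι : N.H → M.H) (P : M.H → Prop) (s a : M.H → M.H) :
    Prop where
  inj : Function.Injective ι
  mem : ∀ y, P (ι y)
  surj : ∀ x, P x → ∃ y, ι y = x
  σ_eq : ∀ y, ι (N.σ y) = s (ι y)
  α_eq : ∀ y, ι (N.α y) = a (ι y)

theorem exists_isRestriction (M : CombMap) (P : M.H → Prop) (s a : M.H → M.H)
    (hs : ∀ x, P x → P (s x)) (hsi : ∀ x y, P x → P y → s x = s y → x = y)
    (ha : ∀ x, P x → P (a x)) (hai : ∀ x, P x → a (a x) = x) (hane : ∀ x, P x → a x ≠ x) :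
    ∃ (N : CombMap) (ι : N.H → M.H), M.IsRestriction N ι P s a :=
  ⟨{ H := {x // P x}
     σ := Equiv.ofBijective (fun x => ⟨s x.1, hs x.1 x.2⟩) (Finite.injective_iff_bijective.1
       fun x y h => Subtype.ext (hsi _ _ x.2 y.2 (congrArg Subtype.val h)))
     α := fun x => ⟨a x.1, ha x.1 x.2⟩
     invol := fun x => Subtype.ext (hai x.1 x.2)
     ne := fun x h => hane x.1 x.2 (congrArg Subtype.val h) }, Subtype.val,
    ⟨Subtype.val_injective, fun y => y.2, fun x hx => ⟨⟨x, hx⟩, rfl⟩, fun _ => rfl, fun _ => rfl⟩⟩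

theorem IsRestriction.card_eq {N : CombMap} {ι : N.H → M.H} {P : M.H → Prop} {s a : M.H → M.H}
    (h : M.IsRestriction N ι P s a) : Nat.card N.H = Nat.card {x // P x} :=
  Nat.card_congr (Equiv.ofBijective (fun y => (⟨ι y, h.mem y⟩ : {x // P x}))
    ⟨fun _ _ hxy => h.inj (congrArg Subtype.val hxy), fun x => by
      obtain ⟨y, hy⟩ := h.surj x.1 x.2
      exact ⟨y, Subtype.ext hy⟩⟩)

section Suppress

open Classical in
/-- The edge involution after the suppression of the vertex `{h, σ h}` of degree two: its two edges
are joined to one. -/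
noncomputable def joinEdges (M : CombMap) (h x : M.H) : M.H :=
  if M.α x = h then M.α (M.σ h) else if M.α x = M.σ h then M.α h else M.α x

variable {h : M.H}

theorem σ_eq_iff_of_degree_two (h2 : M.σ (M.σ h) = h) (x : M.H) :
    (M.σ x = h ∨ M.σ x = M.σ h) ↔ (x = h ∨ x = M.σ h) := by
  have h3 : M.σ x = M.σ h ↔ x = h := M.σ.injective.eq_iff
  have h4 : M.σ x = h ↔ x = M.σ h := by rw [← M.σ.injective.eq_iff (a := x), h2]
  rw [h3, h4, or_comm]

theorem joinEdges_left : M.joinEdges h (M.α h) = M.α (M.σ h) := by simp [joinEdges]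

theorem joinEdges_right (hn : M.σ h ≠ h) : M.joinEdges h (M.α (M.σ h)) = M.α h := by
  simp [joinEdges, hn]

theorem joinEdges_of_ne {x : M.H} (h1 : M.α x ≠ h) (h2 : M.α x ≠ M.σ h) :
    M.joinEdges h x = M.α x := by simp [joinEdges, h1, h2]

theorem face_joinEdges (h2 : M.σ (M.σ h) = h) (hn : M.σ h ≠ h) (x : M.H) :
    M.face (M.joinEdges h x) = M.face (M.α x) := by
  by_cases h3 : M.α x = h
  · obtain rfl : x = M.α h := by rw [← h3, α_α]
    rw [joinEdges_left, face_α, h2, h3]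
  by_cases h4 : M.α x = M.σ h
  · obtain rfl : x = M.α (M.σ h) := by rw [← h4, α_α]
    rw [joinEdges_right hn, h4, face_α]
  rw [joinEdges_of_ne h3 h4]

theorem face_σ_joinEdges (h2 : M.σ (M.σ h) = h) (hn : M.σ h ≠ h) (x : M.H) :
    M.face (M.σ (M.joinEdges h x)) = M.face x := by
  rw [← face_α]
  by_cases h3 : M.α x = h
  · obtain rfl : x = M.α h := by rw [← h3, α_α]
    rw [joinEdges_left, α_α, face_α]
  by_cases h4 : M.α x = M.σ h
  · obtain rfl : x = M.α (M.σ h) := by rw [← h4, α_α]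
    rw [joinEdges_right hn, α_α, face_α, h2]
  rw [joinEdges_of_ne h3 h4, α_α]

theorem exists_suppress (h2 : M.σ (M.σ h) = h) (hl : M.α h ≠ M.σ h) (hn : M.σ h ≠ h) :
    ∃ (N : CombMap) (ι : N.H → M.H),
      M.IsRestriction N ι (fun x => ¬ (x = h ∨ x = M.σ h)) M.σ (M.joinEdges h) := by
  have hl' : M.α (M.σ h) ≠ h := fun h3 => hl (by rw [← h3, α_α, h3])
  have key : ∀ x, ¬ (x = h ∨ x = M.σ h) → (x = M.α h ∨ x = M.α (M.σ h) ∨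
      (M.α x ≠ h ∧ M.α x ≠ M.σ h)) := by
    intro x _
    by_cases h3 : M.α x = h
    · exact Or.inl (by rw [← h3, α_α])
    by_cases h4 : M.α x = M.σ h
    · exact Or.inr (Or.inl (by rw [← h4, α_α]))
    exact Or.inr (Or.inr ⟨h3, h4⟩)
  refine M.exists_isRestriction _ _ _ (fun x hx => ?_) (fun x y _ _ h3 => M.σ.injective h3)
    (fun x hx => ?_) (fun x hx => ?_) (fun x hx => ?_)
  · rwa [σ_eq_iff_of_degree_two h2]
  · rcases key x hx with rfl | rfl | ⟨h3, h4⟩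
    · rw [joinEdges_left]
      exact not_or.2 ⟨hl', M.ne _⟩
    · rw [joinEdges_right hn]
      exact not_or.2 ⟨M.ne _, hl⟩
    · rw [joinEdges_of_ne h3 h4]
      exact not_or.2 ⟨h3, h4⟩
  · rcases key x hx with rfl | rfl | ⟨h3, h4⟩
    · rw [joinEdges_left, joinEdges_right hn]
    · rw [joinEdges_right hn, joinEdges_left]
    · rw [joinEdges_of_ne h3 h4, joinEdges_of_ne (by rw [α_α]; exact fun h => hx (Or.inl h))
        (by rw [α_α]; exact fun h => hx (Or.inr h)), α_α]
  · rcases key x hx with rfl | rfl | ⟨h3, h4⟩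
    · rw [joinEdges_left]
      exact fun h => hn (M.invol.injective h)
    · rw [joinEdges_right hn]
      exact fun h => hn (M.invol.injective h).symm
    · rw [joinEdges_of_ne h3 h4]
      exact M.ne x

theorem IsCounterexample.suppress (hM : M.IsCounterexample) (h2 : M.σ (M.σ h) = h)
    (hl : M.α h ≠ M.σ h) (hn : M.σ h ≠ h) {N : CombMap} {ι : N.H → M.H}
    (hN : M.IsRestriction N ι (fun x => ¬ (x = h ∨ x = M.σ h)) M.σ (M.joinEdges h)) :
    N.IsCounterexample := by
  have hl' : M.α (M.σ h) ≠ h := fun h3 => hl (by rw [← h3, α_α, h3])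
  obtain ⟨a, ha⟩ := hN.surj (M.α h) (not_or.2 ⟨M.ne _, hl⟩)
  obtain ⟨b, hb⟩ := hN.surj (M.α (M.σ h)) (not_or.2 ⟨hl', M.ne _⟩)
  have hab : N.α a = b := hN.inj (by rw [hN.α_eq, ha, joinEdges_left, hb])
  have : Nonempty N.H := ⟨a⟩
  have hface : ∀ x : N.H, M.face (ι (N.φ x)) = M.face (ι x) := fun x => by
    rw [φ_apply, hN.σ_eq, hN.α_eq, face_σ_joinEdges h2 hn]
  -- a function on the half-edges of `N` extends to the two deleted half-edges
  have ext : ∀ {A : Type} (g : N.H → A), (∀ x, g (N.α x) = g x) → ∃ g' : M.H → A,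
      (∀ y, g' (ι y) = g y) ∧ g' (M.σ h) = g' h ∧ ∀ x, g' (M.α x) = g' x := by
    intro A g hg
    let g' := Function.extend ι g fun _ => g a
    have e0 : ∀ y, g' (ι y) = g y := fun y => hN.inj.extend_apply _ _ _
    have e1 : ∀ x, x = h ∨ x = M.σ h → g' x = g a := fun x hx =>
      Function.extend_apply' _ _ _ fun ⟨y, hy⟩ => hN.mem y (hy ▸ hx)
    have e2 : g' (M.α h) = g a := by rw [← ha, e0]
    have e3 : g' (M.α (M.σ h)) = g a := by rw [← hb, e0, ← hab, hg]
    have e4 : ∀ x, x = h ∨ x = M.σ h → g' (M.α x) = g' x := by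
      rintro x (rfl | rfl)
      · rw [e2, e1 _ (Or.inl rfl)]
      · rw [e3, e1 _ (Or.inr rfl)]
    refine ⟨g', e0, by rw [e1 _ (Or.inl rfl), e1 _ (Or.inr rfl)], fun x => ?_⟩
    by_cases hx : x = h ∨ x = M.σ h
    · exact e4 x hx
    by_cases hx' : M.α x = h ∨ M.α x = M.σ h
    · rw [← e4 _ hx', α_α]
    obtain ⟨y, rfl⟩ := hN.surj x hx
    rw [← joinEdges_of_ne (fun h => hx' (Or.inl h)) fun h => hx' (Or.inr h), ← hN.α_eq, e0, e0, hg]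
  have conn : N.Conn := by
    intro g hσ hα x y
    obtain ⟨g', e0, e1, e2⟩ := ext g hα
    rw [← e0, ← e0]
    refine hM.conn g' (fun z => ?_) e2 _ _
    by_cases hz : z = h ∨ z = M.σ h
    · rcases hz with rfl | rfl
      · exact e1
      · rw [h2, e1]
    obtain ⟨y, rfl⟩ := hN.surj z hz
    rw [← hN.σ_eq, e0, e0, hσ]
  refine ⟨conn, ?_, ?_, ?_, ?_⟩
  · have hσh : ∀ y : N.H, orbitMk M.σ (ι y) ≠ orbitMk M.σ h := by
      intro y hx
      have := eq_of_sameCycle (f := fun z => (z = h ∨ z = M.σ h))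
        (fun z => propext (σ_eq_iff_of_degree_two h2 z)) (orbitMk_eq.1 hx)
      refine hN.mem y ?_
      rw [this]
      exact Or.inl rfl
    refine conn.plane_of_labels
      (fun x => (⟨orbitMk M.σ (ι x), hσh x⟩ : {v // v ≠ orbitMk M.σ h}))
      (fun x => Subtype.ext (by dsimp only; rw [hN.σ_eq, orbitMk_apply])) ?_
      (fun x => M.face (ι x)) hface ?_ ?_
    · rintro ⟨v, hv⟩
      obtain ⟨x, rfl⟩ := orbitMk_surjective _ v
      obtain ⟨y, rfl⟩ := hN.surj x (by
        rintro (rfl | rfl)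
        · exact hv rfl
        · exact hv (orbitMk_apply _ _))
      exact ⟨y, rfl⟩
    · intro F
      obtain ⟨x, rfl⟩ := orbitMk_surjective _ F
      by_cases hx : x = h ∨ x = M.σ h
      · rcases hx with rfl | rfl
        · exact ⟨b, by beta_reduce; rw [hb, face_α, h2]; rfl⟩
        · exact ⟨a, by beta_reduce; rw [ha, face_α]; rfl⟩
      · obtain ⟨y, rfl⟩ := hN.surj x hx
        exact ⟨y, rfl⟩
    · have c1 := card_ne (orbitMk M.σ h)
      have c2 : Nat.card {x // ¬x = h ∧ ¬x = M.σ h} + 2 = _ := card_ne_ne hn.symm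
      have c3 := hM.plane
      have c4 := hN.card_eq
      simp only [not_or] at c4
      unfold Plane cycleCount at c3
      omega
  · intro x hx
    have := eq_of_sameCycle (f := fun x : N.H => M.face (ι x)) hface hx
    beta_reduce at this
    rw [hN.α_eq, face_joinEdges h2 hn] at this
    exact hM.bridgeless.face_ne _ this
  · intro x
    refine ⟨fun h3 => (hM.subcubic (ι x)).1 (by rw [← hN.σ_eq, h3]), ?_⟩
    exact (hM.subcubic (ι x)).2.imp (fun h3 => hN.inj (by rw [hN.σ_eq, hN.σ_eq, h3]))
      fun h3 => hN.inj (by rw [hN.σ_eq, hN.σ_eq, hN.σ_eq, h3])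
  · rintro ⟨c, hc, hv⟩
    obtain ⟨c', e0, e1, e2⟩ := ext c hc
    refine hM.not_colorable ⟨c', e2, fun z => ?_⟩
    by_cases hz : z = h ∨ z = M.σ h
    · rcases hz with rfl | rfl
      · exact ⟨fun _ => e1, fun h3 => absurd h2 h3⟩
      · rw [h2]
        exact ⟨fun _ => e1.symm, fun h3 => absurd rfl h3⟩
    obtain ⟨y, rfl⟩ := hN.surj z hz
    rw [← hN.σ_eq, ← hN.σ_eq, e0, e0, Ne, hN.inj.eq_iff]
    exact hv y

end Suppress

/-- A vertex of degree two of a counterexample can be suppressed. -/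
theorem IsCounterexample.exists_smaller (hM : M.IsCounterexample) {h : M.H}
    (h2 : M.σ (M.σ h) = h) : ∃ N : CombMap, N.IsCounterexample ∧ Nat.card N.H < Nat.card M.H := by
  have hn := (hM.subcubic h).1
  have hl : M.α h ≠ M.σ h := by
    -- otherwise the two half-edges at the vertex form a loop, and this loop is the whole graph
    intro hl
    classical
    have hall : ∀ x, x = h ∨ x = M.σ h := by
      intro x
      have := hM.conn (fun x => if x = h ∨ x = M.σ h then 1 else 0) (fun z => ?_) (fun z => ?_) x h
      · by_contra hx
        simp [hx] at this
      · simp only [σ_eq_iff_of_degree_two h2]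
      · simp only [M.invol.eq_iff, ← hl, α_α]
        simp only [or_comm]
    refine hM.not_colorable ⟨fun _ => 0, fun _ => rfl, fun z => ⟨fun _ => rfl, fun h3 => ?_⟩⟩
    rcases hall z with rfl | rfl
    · exact absurd h2 h3
    · exact absurd (by rw [h2]) h3
  obtain ⟨N, ι, hN⟩ := exists_suppress h2 hl hn
  refine ⟨N, hM.suppress h2 hl hn hN, ?_⟩
  have c2 : Nat.card {x // ¬x = h ∧ ¬x = M.σ h} + 2 = _ := card_ne_ne hn.symm
  have c4 := hN.card_eq
  simp only [not_or] at c4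
  omega

end CombMap

/-! ### Deletion of an edge -/

namespace CombMap

variable {M : CombMap}

/-- All vertices have degree three. -/
def Cubic (M : CombMap) : Prop := ∀ h, M.σ h ≠ h ∧ M.σ (M.σ (M.σ h)) = h

theorem Cubic.σ_σ_ne (hC : M.Cubic) (h : M.H) : M.σ (M.σ h) ≠ h := fun h2 =>
  (hC h).1 (by rw [← h2, (hC _).2, h2])

/-- In a bridgeless map, a cut cannot consist of a single edge. -/
theorem Bridgeless.cut_eq (hB : M.Bridgeless) {e : M.H} {g : M.H → ZMod 2}
    (hg : ∀ x, g (M.σ x) = g x) (hα : ∀ x, ¬ (x = e ∨ x = M.α e) → g (M.α x) = g x) :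
    g (M.α e) = g e := by
  classical
  have := Fintype.ofFinite M.H
  let f : M.H → ZMod 2 := fun x => if M.face x = M.face e then 1 else 0
  have h0 := M.sum_mul_edgeSum_eq_zero (f := f) hg fun x => by simp only [f, face_φ]
  rw [sum_eq_sum_of_involutive M.invol M.ne {e, M.α e}, Finset.sum_pair (M.ne e).symm] at h0
  · have h1 : f e = 1 := if_pos rfl
    have h2 : f (M.α e) = 0 := if_neg (hB.face_ne e).symm
    rw [α_α, h1, h2, add_zero, zero_add, mul_one, mul_one] at h0
    exact (zmod_two_eq_of_add h0).symm
  · intro x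
    simp only [Finset.mem_insert, Finset.mem_singleton, M.invol.eq_iff, α_α, or_comm]
    exact id
  · intro x hx
    rw [α_α, hα x (by simpa using hx), add_comm (f _)]

/-- A loop at a vertex of degree three would force a bridge at that vertex. -/
theorem Bridgeless.σ_ne_α (hB : M.Bridgeless) (hC : M.Cubic) (e : M.H) : M.σ e ≠ M.α e := by
  intro h
  have h1 : M.σ (M.σ (M.α e)) = e := by rw [← h, (hC e).2]
  refine hB.face_ne (M.σ (M.α e)) ?_
  rw [face_α, h1, ← φ_apply, face_φ]

section Delete

/-- The half-edge `x` belongs to the edge of `e`. -/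
def OnEdge (M : CombMap) (e x : M.H) : Prop := x = e ∨ x = M.α e

variable {e : M.H}

theorem onEdge_α (x : M.H) : M.OnEdge e (M.α x) ↔ M.OnEdge e x := by
  rw [OnEdge, OnEdge, M.invol.eq_iff, M.invol.injective.eq_iff, or_comm]

open Classical in
/-- The rotation after the deletion of the edge of `e`, in which a deleted half-edge is passed over.
This suffices when no two consecutive half-edges at a vertex are deleted. -/
noncomputable def skip (M : CombMap) (e x : M.H) : M.H :=
  if M.OnEdge e (M.σ x) then M.σ (M.σ x) else M.σ x

theorem skip_pos {x : M.H} (h : M.OnEdge e (M.σ x)) : M.skip e x = M.σ (M.σ x) := if_pos h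

theorem skip_neg {x : M.H} (h : ¬ M.OnEdge e (M.σ x)) : M.skip e x = M.σ x := if_neg h

theorem not_onEdge_σ (hB : M.Bridgeless) (hC : M.Cubic) {x : M.H} (h : M.OnEdge e x) :
    ¬ M.OnEdge e (M.σ x) := by
  rcases h with rfl | rfl
  · exact not_or.2 ⟨(hC _).1, hB.σ_ne_α hC _⟩
  · refine not_or.2 ⟨?_, (hC _).1⟩
    have := hB.σ_ne_α hC (M.α e)
    rwa [α_α] at this

theorem exists_delete (hB : M.Bridgeless) (hC : M.Cubic) (e : M.H) :
    ∃ (N : CombMap) (ι : N.H → M.H),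
      M.IsRestriction N ι (fun x => ¬ M.OnEdge e x) (M.skip e) M.α := by
  refine M.exists_isRestriction _ _ _ (fun x hx => ?_) (fun x y hx hy hxy => ?_)
    (fun x hx => by rwa [onEdge_α]) (fun x _ => M.α_α x) (fun x _ => M.ne x)
  · by_cases h : M.OnEdge e (M.σ x)
    · rw [skip_pos h]
      exact not_onEdge_σ hB hC h
    · rwa [skip_neg h]
  · by_cases h : M.OnEdge e (M.σ x) <;> by_cases h' : M.OnEdge e (M.σ y)
    · rw [skip_pos h, skip_pos h'] at hxy
      exact M.σ.injective (M.σ.injective hxy)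
    · rw [skip_pos h, skip_neg h'] at hxy
      exact absurd (M.σ.injective hxy ▸ h) hy
    · rw [skip_neg h, skip_pos h'] at hxy
      exact absurd (M.σ.injective hxy ▸ h') hx
    · rw [skip_neg h, skip_neg h'] at hxy
      exact M.σ.injective hxy

open Classical in
/-- The face that results from `F` when the edge of `e` is deleted, so that the faces on its two
sides become one. -/
noncomputable def mergeFaces (M : CombMap) (e : M.H)
    (F : Quotient (Equiv.Perm.SameCycle.setoid M.φ)) :
    Quotient (Equiv.Perm.SameCycle.setoid M.φ) :=
  if F = M.face (M.α e) then M.face e else F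

theorem mergeFaces_skip (hB : M.Bridgeless) (x : M.H) :
    M.mergeFaces e (M.face (M.skip e (M.α x))) = M.mergeFaces e (M.face x) := by
  have h0 := hB.face_ne e
  have h1 : M.face x = M.face (M.σ (M.α x)) := by rw [← φ_apply, face_φ]
  by_cases h : M.OnEdge e (M.σ (M.α x))
  · rw [skip_pos h, h1]
    rcases h with h | h
    · rw [h, ← face_α, mergeFaces, mergeFaces, if_pos rfl, if_neg h0]
    · rw [h, ← face_α, α_α, mergeFaces, mergeFaces, if_pos rfl, if_neg h0]
  · rw [skip_neg h, ← h1]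

variable {N : CombMap} {ι : N.H → M.H}

theorem delete_conn (hM : M.Conn) (hB : M.Bridgeless) (hC : M.Cubic)
    (hN : M.IsRestriction N ι (fun x => ¬ M.OnEdge e x) (M.skip e) M.α) : N.Conn := by
  intro g hσ hα a b
  let g0 := Function.extend ι g 0
  let g' : M.H → ZMod 2 := fun x => by
    classical
    exact if M.OnEdge e x then g0 (M.σ x) else g0 x
  have e0 : ∀ y, g0 (ι y) = g y := fun y => hN.inj.extend_apply _ _ _
  have e1 : ∀ y, g' (ι y) = g y := fun y => (if_neg (hN.mem y)).trans (e0 y)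
  have e2 : ∀ x, M.OnEdge e x → g' x = g0 (M.σ x) := fun x hx => if_pos hx
  have h1 : ∀ x, g' (M.σ x) = g' x := by
    intro x
    by_cases hx : M.OnEdge e x
    · rw [e2 x hx]
      exact if_neg (not_onEdge_σ hB hC hx)
    obtain ⟨y, rfl⟩ := hN.surj x hx
    by_cases hx' : M.OnEdge e (M.σ (ι y))
    · rw [e2 _ hx', ← skip_pos hx', ← hN.σ_eq, e0, e1, hσ]
    · rw [← skip_neg hx', ← hN.σ_eq, e1, e1, hσ]
  have h2 : ∀ x, ¬ M.OnEdge e x → g' (M.α x) = g' x := by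
    intro x hx
    obtain ⟨y, rfl⟩ := hN.surj x hx
    rw [← hN.α_eq, e1, e1, hα]
  have h3 := hB.cut_eq h1 h2
  rw [← e1, ← e1]
  refine hM g' h1 (fun x => ?_) _ _
  by_cases hx : M.OnEdge e x
  · rcases hx with rfl | rfl
    · exact h3
    · rw [α_α, h3]
  · exact h2 x hx

theorem delete_face (hB : M.Bridgeless)
    (hN : M.IsRestriction N ι (fun x => ¬ M.OnEdge e x) (M.skip e) M.α) (y : N.H) :
    M.mergeFaces e (M.face (ι (N.φ y))) = M.mergeFaces e (M.face (ι y)) := by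
  rw [φ_apply, hN.σ_eq, hN.α_eq, mergeFaces_skip hB]

theorem delete_plane (hM : M.Conn) (hP : M.Plane) (hB : M.Bridgeless) (hC : M.Cubic)
    (hN : M.IsRestriction N ι (fun x => ¬ M.OnEdge e x) (M.skip e) M.α) : N.Plane := by
  have h0 := hB.face_ne e
  have hσe : ¬ M.OnEdge e (M.σ e) := not_onEdge_σ hB hC (Or.inl rfl)
  have hσe' : ¬ M.OnEdge e (M.σ (M.α e)) := not_onEdge_σ hB hC (Or.inr rfl)
  have : Nonempty N.H := ⟨(hN.surj _ hσe).choose⟩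
  have hm : ∀ y, M.mergeFaces e (M.face (ι y)) ≠ M.face (M.α e) := by
    intro y
    unfold mergeFaces
    split_ifs with h
    · exact h0
    · exact h
  refine (delete_conn hM hB hC hN).plane_of_labels (fun y => orbitMk M.σ (ι y)) (fun y => ?_) ?_
    (fun y => (⟨_, hm y⟩ : {F // F ≠ M.face (M.α e)}))
    (fun y => Subtype.ext (delete_face hB hN y)) ?_ ?_
  · rw [hN.σ_eq]
    by_cases h : M.OnEdge e (M.σ (ι y))
    · rw [skip_pos h, orbitMk_apply, orbitMk_apply]
    · rw [skip_neg h, orbitMk_apply]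
  · intro v
    obtain ⟨x, rfl⟩ := orbitMk_surjective _ v
    by_cases hx : M.OnEdge e x
    · obtain ⟨y, hy⟩ := hN.surj _ (not_onEdge_σ hB hC hx)
      exact ⟨y, by beta_reduce; rw [hy, orbitMk_apply]⟩
    · obtain ⟨y, rfl⟩ := hN.surj _ hx
      exact ⟨y, rfl⟩
  · rintro ⟨F, hF⟩
    obtain ⟨x, rfl⟩ := orbitMk_surjective _ F
    have key : ∀ y, M.face (ι y) = M.face x → ∃ y, (⟨_, hm y⟩ : {F // F ≠ M.face (M.α e)}) =
        ⟨orbitMk M.φ x, hF⟩ := fun y hy => ⟨y, Subtype.ext (by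
      dsimp only
      rw [hy]
      exact if_neg hF)⟩
    by_cases hx : M.OnEdge e x
    · rcases hx with rfl | rfl
      · obtain ⟨y, hy⟩ := hN.surj _ hσe'
        exact key y (by rw [hy, ← φ_apply, face_φ])
      · exact absurd rfl hF
    · obtain ⟨y, rfl⟩ := hN.surj _ hx
      exact key y rfl
  · have c1 := card_ne (M.face (M.α e))
    have c2 : Nat.card {x // ¬ M.OnEdge e x} + 2 = Nat.card M.H := by
      have := card_ne_ne (M.ne e).symm
      simp only [OnEdge, not_or]
      exact this
    have c3 := hN.card_eq
    unfold Plane cycleCount at hP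
    omega

/-- The deletion of an edge creates no bridge if no other edge separates the same two faces. -/
theorem delete_bridgeless (hB : M.Bridgeless)
    (he : ∀ y, M.face y = M.face e → M.face (M.α y) = M.face (M.α e) → y = e)
    (hN : M.IsRestriction N ι (fun x => ¬ M.OnEdge e x) (M.skip e) M.α) : N.Bridgeless := by
  intro y hy
  have h1 := eq_of_sameCycle (f := fun y : N.H => M.mergeFaces e (M.face (ι y)))
    (delete_face hB hN) hy
  have h2 := hB.face_ne (ι y)
  beta_reduce at h1
  rw [hN.α_eq] at h1
  unfold mergeFaces at h1
  split_ifs at h1 with h3 h4 h5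
  · exact h2 (h3.trans h4.symm)
  · refine hN.mem y (Or.inr ?_)
    rw [← M.invol.eq_iff]
    exact he _ h1.symm (by rw [α_α, h3])
  · exact hN.mem y (Or.inl (he _ h1 h5))
  · exact h2 h1

/-- After the deletion of the edge of `e`, the vertex of `x` has degree two if one of the other two
half-edges there is deleted, and degree three otherwise. -/
theorem skip_cases (hC : M.Cubic) {x : M.H} (hx : ¬ M.OnEdge e x) :
    (M.OnEdge e (M.σ x) ∧ M.skip e x = M.σ (M.σ x) ∧ M.skip e (M.skip e x) = x) ∨
      (¬ M.OnEdge e (M.σ x) ∧ M.OnEdge e (M.σ (M.σ x)) ∧ M.skip e x = M.σ x ∧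
        M.skip e (M.skip e x) = x) ∨
      (¬ M.OnEdge e (M.σ x) ∧ ¬ M.OnEdge e (M.σ (M.σ x)) ∧ M.skip e x = M.σ x ∧
        M.skip e (M.skip e x) = M.σ (M.σ x) ∧ M.skip e (M.skip e (M.skip e x)) = x) := by
  have h3 := (hC x).2
  by_cases h : M.OnEdge e (M.σ x)
  · refine Or.inl ⟨h, skip_pos h, ?_⟩
    rw [skip_pos h, skip_neg (by rwa [h3]), h3]
  by_cases h' : M.OnEdge e (M.σ (M.σ x))
  · refine Or.inr (Or.inl ⟨h, h', skip_neg h, ?_⟩)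
    rw [skip_neg h, skip_pos h', h3]
  · refine Or.inr (Or.inr ⟨h, h', skip_neg h, ?_, ?_⟩)
    · rw [skip_neg h, skip_neg h']
    · rw [skip_neg h, skip_neg h', skip_neg (by rwa [h3]), h3]

theorem delete_subcubic (hC : M.Cubic)
    (hN : M.IsRestriction N ι (fun x => ¬ M.OnEdge e x) (M.skip e) M.α) : N.Subcubic := by
  intro y
  have h1 := (hC (ι y)).1
  have h2 := hC.σ_σ_ne (ι y)
  simp only [Ne, ← hN.inj.eq_iff, hN.σ_eq]
  rcases skip_cases hC (hN.mem y) with ⟨_, h3, h4⟩ | ⟨_, _, h3, h4⟩ | ⟨_, _, h3, _, h4⟩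
  · exact ⟨h3 ▸ h2, Or.inl h4⟩
  · exact ⟨h3 ▸ h1, Or.inl h4⟩
  · exact ⟨h3 ▸ h1, Or.inr h4⟩

/-- A coloring of the map with the edge of `e` deleted, read in the original cubic map. The color
given to the deleted edge is arbitrary. -/
theorem exists_coloring_of_delete (hC : M.Cubic)
    (hN : M.IsRestriction N ι (fun x => ¬ M.OnEdge e x) (M.skip e) M.α) (hcol : N.Colorable) :
    ∃ c : M.H → Fin 3, (∀ x, c (M.α x) = c x) ∧
      (∀ x, ¬ M.OnEdge e x → M.OnEdge e (M.σ x) → c (M.σ (M.σ x)) = c x) ∧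
      ∀ x, ¬ M.OnEdge e x → ¬ M.OnEdge e (M.σ x) → ¬ M.OnEdge e (M.σ (M.σ x)) →
        c (M.σ x) ≠ c x := by
  obtain ⟨c, hc, hv⟩ := hcol
  have e0 : ∀ y, Function.extend ι c 0 (ι y) = c y := fun y => hN.inj.extend_apply _ _ _
  have e1 : ∀ x, M.OnEdge e x → Function.extend ι c 0 x = 0 := fun x hx =>
    Function.extend_apply' _ _ _ fun ⟨y, hy⟩ => hN.mem y (hy ▸ hx)
  refine ⟨Function.extend ι c 0, fun x => ?_, fun x hx h1 => ?_, fun x hx h1 h2 => ?_⟩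
  · by_cases hx : M.OnEdge e x
    · rw [e1 _ hx, e1 _ ((onEdge_α x).2 hx)]
    · obtain ⟨y, rfl⟩ := hN.surj x hx
      rw [← hN.α_eq, e0, e0, hc]
  · obtain ⟨y, rfl⟩ := hN.surj x hx
    rcases skip_cases hC hx with ⟨_, h3, h4⟩ | ⟨h3, _⟩ | ⟨h3, _⟩
    · rw [← h3, ← hN.σ_eq, e0, e0]
      exact (hv y).1 (hN.inj (by rw [hN.σ_eq, hN.σ_eq, h4]))
    · exact absurd h1 h3
    · exact absurd h1 h3
  · obtain ⟨y, rfl⟩ := hN.surj x hx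
    rcases skip_cases hC hx with ⟨h3, _⟩ | ⟨_, h3, _⟩ | ⟨_, _, h3, h4, _⟩
    · exact absurd h3 h1
    · exact absurd h3 h2
    · rw [← h3, ← hN.σ_eq, e0, e0]
      refine (hv y).2 fun h5 => hC.σ_σ_ne (ι y) ?_
      rw [← h4, ← hN.σ_eq, ← hN.σ_eq, h5]

end Delete

end CombMap

/-! ### Short faces and two-edge cuts -/

theorem fin_const {k : ℕ} [NeZero k] {A : Type*} {f : Fin k → A} (h : ∀ i, f (i - 1) = f i)
    (i : Fin k) : f i = f 0 := by
  obtain ⟨n, hn⟩ := i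
  induction n with
  | zero => rfl
  | succ n ih =>
    have h1 : (⟨n + 1, hn⟩ : Fin k) - 1 = ⟨n, Nat.lt_of_succ_lt hn⟩ := by
      rw [sub_eq_iff_eq_add]
      exact Fin.ext (by rw [Fin.val_add, Fin.val_one', Nat.add_mod_mod, Nat.mod_eq_of_lt hn])
    rw [← h, h1, ih]

/-- If all cycles of a permutation have length at least `n`, there are at most `|H| / n` of them. -/
theorem cycleCount_mul_le {H : Type} [Finite H] {τ : Equiv.Perm H} {n : ℕ}
    (h : ∀ x, n ≤ Function.minimalPeriod τ x) : cycleCount τ * n ≤ Nat.card H := by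
  let f : Quotient (Equiv.Perm.SameCycle.setoid τ) × Fin n → H := fun p => τ^[p.2] p.1.out
  have hf : Function.Injective f := by
    rintro ⟨q, i⟩ ⟨q', i'⟩ hqi
    have h1 : ∀ (q : Quotient (Equiv.Perm.SameCycle.setoid τ)) (i : ℕ),
        orbitMk τ (τ^[i] q.out) = q := by
      intro q i
      induction i with
      | zero => exact Quotient.out_eq q
      | succ i ih => rw [Function.iterate_succ_apply', orbitMk_apply, ih]
    obtain rfl : q = q' := by
      rw [← h1 q i, ← h1 q' i']
      exact congrArg _ hqi
    refine Prod.ext rfl (Fin.ext ?_)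
    exact Function.iterate_injOn_Iio_minimalPeriod (lt_of_lt_of_le i.2 (h _))
      (lt_of_lt_of_le i'.2 (h _)) hqi
  have h2 := Nat.card_le_card_of_injective f hf
  rwa [Nat.card_prod, Nat.card_fin] at h2

namespace CombMap

variable {M : CombMap}

/-- By Euler's formula, a cubic plane map has a face of length at most five. -/
theorem Cubic.exists_short_face (hC : M.Cubic) (hP : M.Plane) :
    ∃ x, Function.minimalPeriod M.φ x ≤ 5 := by
  by_contra! h
  have h1 := cycleCount_mul_le (n := 6) h
  have h2 : cycleCount M.σ * 3 ≤ Nat.card M.H := by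
    refine cycleCount_mul_le fun x => ?_
    have h3 : 0 < Function.minimalPeriod M.σ x :=
      Function.minimalPeriod_pos_of_mem_periodicPts ⟨3, by norm_num, (hC x).2⟩
    have h4 := Function.isPeriodicPt_minimalPeriod M.σ x
    by_contra! h5
    interval_cases h6 : Function.minimalPeriod M.σ x
    · exact (hC x).1 h4
    · exact hC.σ_σ_ne x h4
  unfold Plane at hP
  omega

/-- The half-edges `x 0, …, x (k - 1)` bound a face of length `k`, in this order. -/
structure IsFaceCycle (M : CombMap) {k : ℕ} [NeZero k] (x : Fin k → M.H) : Prop where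
  inj : Function.Injective x
  step : ∀ i, M.σ (M.α (x i)) = x (i + 1)

theorem exists_isFaceCycle {x₀ : M.H} {k : ℕ} [NeZero k]
    (hk : Function.minimalPeriod M.φ x₀ = k) : ∃ x : Fin k → M.H, M.IsFaceCycle x := by
  refine ⟨fun i => M.φ^[i] x₀, fun i j hij => ?_, fun i => ?_⟩
  · exact Fin.ext (Function.iterate_injOn_Iio_minimalPeriod (i.2.trans_eq hk.symm)
      (j.2.trans_eq hk.symm) hij)
  · have h1 : ((i + 1 : Fin k) : ℕ) = (i + 1) % Function.minimalPeriod M.φ x₀ := by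
      rw [hk, Fin.val_add, Fin.val_one', Nat.add_mod_mod]
    change M.σ (M.α (M.φ^[i] x₀)) = M.φ^[((i + 1 : Fin k) : ℕ)] x₀
    rw [h1, Function.iterate_mod_minimalPeriod_eq, Function.iterate_succ_apply', φ_apply]

namespace IsFaceCycle

variable {k : ℕ} [NeZero k] {x : Fin k → M.H}

theorem shift (hx : M.IsFaceCycle x) (j : Fin k) : M.IsFaceCycle fun i => x (i + j) :=
  ⟨fun _ _ h => add_right_cancel (hx.inj h), fun i => by
    rw [hx.step, add_right_comm]⟩

theorem exists_eq (hx : M.IsFaceCycle x) {y : M.H} {i : Fin k} (hy : M.face y = M.face (x i)) :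
    ∃ j, y = x j := by
  have := eq_of_sameCycle (τ := M.φ) (f := fun y => ∃ j, y = x j) (fun y => propext ⟨?_, ?_⟩)
    (orbitMk_eq.1 hy)
  · rw [this]
    exact ⟨i, rfl⟩
  · rintro ⟨j, hj⟩
    refine ⟨j - 1, M.φ.injective ?_⟩
    rw [hj, φ_apply, hx.step, sub_add_cancel]
  · rintro ⟨j, rfl⟩
    exact ⟨j + 1, hx.step j⟩

theorem face_succ (hx : M.IsFaceCycle x) (i : Fin k) : M.face (x (i + 1)) = M.face (x i) := by
  rw [← hx.step, ← φ_apply, face_φ]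

theorem face_eq (hx : M.IsFaceCycle x) (i : Fin k) : M.face (x i) = M.face (x 0) := by
  refine fin_const (f := fun i => M.face (x i)) (fun i => ?_) i
  rw [← hx.face_succ, sub_add_cancel]

theorem α_ne (hx : M.IsFaceCycle x) (hB : M.Bridgeless) (i j : Fin k) : M.α (x i) ≠ x j := by
  intro h
  refine hB.face_ne (x i) ?_
  rw [h, hx.face_eq, ← hx.face_eq j]

theorem σ_σ_eq (hx : M.IsFaceCycle x) (hC : M.Cubic) (i : Fin k) :
    M.σ (M.σ (x (i + 1))) = M.α (x i) := by rw [← hx.step, (hC _).2]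

theorem σ_σ_eq' (hx : M.IsFaceCycle x) (hC : M.Cubic) (i : Fin k) :
    M.σ (M.σ (x i)) = M.α (x (i - 1)) := by rw [← hx.σ_σ_eq hC, sub_add_cancel]

theorem σ_ne (hx : M.IsFaceCycle x) (hB : M.Bridgeless) (i j : Fin k) : M.σ (x i) ≠ x j := by
  rw [← sub_add_cancel j 1, ← hx.step]
  exact fun h => hx.α_ne hB _ _ (M.σ.injective h).symm

theorem σ_ne_α (hx : M.IsFaceCycle x) (hB : M.Bridgeless) (hC : M.Cubic) (i j : Fin k) :
    M.σ (x i) ≠ M.α (x j) := by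
  rw [← hx.σ_σ_eq hC]
  exact fun h => hx.σ_ne hB _ _ (M.σ.injective h).symm

/-- Consecutive edges of a face have different faces on their other sides, since the third edge at
their common vertex is not a bridge. -/
theorem face_α_ne (hx : M.IsFaceCycle x) (hB : M.Bridgeless) (hC : M.Cubic) (i : Fin k) :
    M.face (M.α (x i)) ≠ M.face (M.α (x (i + 1))) := by
  have := hB.face_ne (M.σ (x (i + 1)))
  rwa [face_α, hx.σ_σ_eq hC, ← face_α, ne_comm] at this

end IsFaceCycle

/-- On the sphere, two edges with the same two faces on their sides form a cut. -/
theorem Plane.exists_two_edge_cut (hP : M.Plane) (hM : M.Conn) (hB : M.Bridgeless) {a c : M.H}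
    (hac : a ≠ c) (h1 : M.face a = M.face c) (h2 : M.face (M.α a) = M.face (M.α c)) :
    ∃ g : M.H → ZMod 2, (∀ x, g (M.σ x) = g x) ∧
      (∀ x, ¬ (M.OnEdge a x) → ¬ M.OnEdge c x → g (M.α x) = g x) ∧
      g (M.α a) = g a + 1 ∧ g (M.α c) = g c + 1 := by
  classical
  have := Fintype.ofFinite M.H
  have hca : M.α c ≠ a := fun h => hB.face_ne c (by rw [h, h1])
  have hca' : M.α a ≠ c := fun h => hB.face_ne a (by rw [h, h1])
  obtain ⟨g, hg, hw⟩ := hP.exists_cut hM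
    (fun x => (if x = a then 1 else 0) + if x = c then 1 else 0) (by
      intro f hf
      have h3 : f a = f c := eq_of_sameCycle hf (orbitMk_eq.1 h1)
      have h4 : f (M.α a) = f (M.α c) := eq_of_sameCycle hf (orbitMk_eq.1 h2)
      simp only [add_mul, ite_mul, one_mul, zero_mul, Finset.sum_add_distrib, Finset.sum_ite_eq',
        Finset.mem_univ, if_true]
      rw [h3, h4, zmod_two_add_self])
  refine ⟨g, hg, fun x hx hx' => ?_, ?_, ?_⟩
  · have h5 : M.α x ≠ a := fun h => hx (Or.inr (by rw [← h, α_α]))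
    have h6 : M.α x ≠ c := fun h => hx' (Or.inr (by rw [← h, α_α]))
    have h7 := hw x
    rw [if_neg fun h => hx (Or.inl h), if_neg fun h => hx' (Or.inl h), if_neg h5, if_neg h6,
      add_zero, add_zero] at h7
    exact (zmod_two_eq_of_add h7).symm
  · have h7 := hw a
    rw [if_pos rfl, if_neg hac, if_neg (M.ne a), if_neg hca', add_zero, add_zero, add_zero] at h7
    rw [← h7, ← add_assoc, zmod_two_add_self, zero_add]
  · have h7 := hw c
    rw [if_neg hac.symm, if_pos rfl, if_neg hca, if_neg (M.ne c), zero_add, add_zero,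
      add_zero] at h7
    rw [← h7, ← add_assoc, zmod_two_add_self, zero_add]

/-- Of four consecutive edges of a face, the first and the third cannot share their other face
while the second and the fourth share theirs. The product of the two cuts would be a cut that
consists of the second and the third edge only. -/
theorem Plane.not_crossing (hP : M.Plane) (hM : M.Conn) (hB : M.Bridgeless) {k : ℕ} [NeZero k]
    {x : Fin k → M.H} (hx : M.IsFaceCycle x) (hC : M.Cubic) (i : Fin k) (h02 : i ≠ i + 1 + 1)
    (h13 : i + 1 ≠ i + 1 + 1 + 1) (h1 : M.face (M.α (x i)) = M.face (M.α (x (i + 1 + 1)))) :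
    M.face (M.α (x (i + 1))) ≠ M.face (M.α (x (i + 1 + 1 + 1))) := by
  classical
  intro h2
  have := Fintype.ofFinite M.H
  have sb : M.σ (M.α (x i)) = x (i + 1) := hx.step _
  have sc : M.σ (M.α (x (i + 1))) = x (i + 1 + 1) := hx.step _
  have sd : M.σ (M.α (x (i + 1 + 1))) = x (i + 1 + 1 + 1) := hx.step _
  have a1 := hx.face_α_ne hB hC i
  have a2 := hx.face_α_ne hB hC (i + 1)
  have a3 := hx.face_α_ne hB hC (i + 1 + 1)
  have fc : ∀ i j, M.face (x i) = M.face (x j) := fun i j => by rw [hx.face_eq, hx.face_eq j]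
  have off : ∀ i j, M.face (M.α (x i)) ≠ M.face (M.α (x j)) → ¬ M.OnEdge (x i) (x j) := by
    rintro i j h (h3 | h3)
    · exact h (by rw [h3])
    · exact hx.α_ne hB _ _ h3.symm
  obtain ⟨g, g1, g2, g3, g4⟩ := hP.exists_two_edge_cut hM hB (hx.inj.ne h02) (fc _ _) h1
  obtain ⟨q, q1, q2, q3, q4⟩ := hP.exists_two_edge_cut hM hB (hx.inj.ne h13) (fc _ _) h2
  have gb : g (x (i + 1)) = g (x i) + 1 := by rw [← sb, g1, g3]
  have gαb := g2 (x (i + 1)) (off _ _ a1) (off _ _ a2.symm)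
  have gc : g (x (i + 1 + 1)) = g (x (i + 1)) := by rw [← sc, g1, gαb]
  have gd : g (x (i + 1 + 1 + 1)) = g (x (i + 1 + 1)) + 1 := by rw [← sd, g1, g4]
  have gαd := g2 (x (i + 1 + 1 + 1)) (off _ _ fun h => a1 (by rw [h, h2]))
    (off _ _ fun h => a2 (by rw [h, h2]))
  have qαa := q2 (x i) (off _ _ a1.symm) (off _ _ fun h => a3 (by rw [h, h1]))
  have qb : q (x (i + 1)) = q (x i) := by rw [← sb, q1, qαa]
  have qc : q (x (i + 1 + 1)) = q (x (i + 1)) + 1 := by rw [← sc, q1, q3]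
  have qαc := q2 (x (i + 1 + 1)) (off _ _ a2) (off _ _ fun h => a3 h.symm)
  have qd : q (x (i + 1 + 1 + 1)) = q (x (i + 1 + 1)) := by rw [← sd, q1, qαc]
  -- the two cuts, normalized to contain the common vertex of the second and the third edge
  let p : M.H → ZMod 2 := fun y => (g y + g (x i)) * (q y + q (x i))
  have p1 : ∀ y, p (M.σ y) = p y := fun y => by simp only [p, g1, q1]
  let f : M.H → ZMod 2 := fun y => if M.face y = M.face (M.α (x (i + 1))) then 1 else 0
  have h0 := M.sum_mul_edgeSum_eq_zero (f := f) p1 fun x => by simp only [f, face_φ]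
  have two : (1 : ZMod 2) + 1 = 0 := rfl
  have pα : ∀ y, ¬ M.OnEdge (x (i + 1)) y → ¬ M.OnEdge (x (i + 1 + 1)) y → p (M.α y) = p y := by
    have key : ∀ a y, M.OnEdge a y → p (M.α a) = p a → p (M.α y) = p y := by
      rintro a y (rfl | rfl) h
      · exact h
      · rw [α_α, h]
    intro y hy1 hy2
    by_cases hy0 : M.OnEdge (x i) y
    · refine key _ y hy0 ?_
      simp only [p, qαa, zmod_two_add_self, mul_zero]
    by_cases hy3 : M.OnEdge (x (i + 1 + 1 + 1)) y
    · refine key _ y hy3 ?_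
      simp only [p, gαd, gd, gc, gb, q4]
      rw [add_assoc (g (x i)), two, add_zero, zmod_two_add_self, zero_mul, zero_mul]
    · simp only [p, g2 y hy0 hy2, q2 y hy1 hy3]
  have fb : f (x (i + 1)) = 0 := if_neg (hB.face_ne _)
  have fαb : f (M.α (x (i + 1))) = 1 := if_pos rfl
  have fC : f (x (i + 1 + 1)) = 0 := if_neg (by rw [fc (i + 1 + 1) (i + 1)]; exact hB.face_ne _)
  have fαc : f (M.α (x (i + 1 + 1))) = 0 := if_neg a2.symm
  have hbc : x (i + 1) ≠ x (i + 1 + 1) := fun h => a2 (by rw [h])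
  rw [sum_eq_sum_of_involutive M.invol M.ne
    {x (i + 1), M.α (x (i + 1)), x (i + 1 + 1), M.α (x (i + 1 + 1))}] at h0
  · rw [Finset.sum_insert, Finset.sum_insert, Finset.sum_pair (M.ne _).symm] at h0
    · rw [α_α, α_α, fb, fαb, fC, fαc] at h0
      simp only [p, gαb, q3, gb, qb, add_zero, zero_add, mul_zero, mul_one] at h0
      revert h0
      generalize g (x i) = u
      generalize q (x i) = v
      revert u v
      decide
    · simp only [Finset.mem_insert, Finset.mem_singleton, not_or]
      exact ⟨hx.α_ne hB _ _, fun h => hbc (M.invol.injective h)⟩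
    · simp only [Finset.mem_insert, Finset.mem_singleton, not_or]
      exact ⟨(M.ne _).symm, hbc, (hx.α_ne hB _ _).symm⟩
  · intro y
    simp only [Finset.mem_insert, Finset.mem_singleton, M.invol.eq_iff, α_α]
    tauto
  · intro y hy
    simp only [Finset.mem_insert, Finset.mem_singleton] at hy
    rw [α_α, pα y (fun h => hy (by unfold OnEdge at h; tauto))
      (fun h => hy (by unfold OnEdge at h; tauto)), add_comm (f _)]

/-- Faces around a 4-cycle that agree neither for neighbors nor for both pairs of opposite edges
include one that occurs only once. -/
theorem exists_unlike_four {B : Type} (A : Fin 4 → B) (h1 : ∀ i, A i ≠ A (i + 1))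
    (h2 : ∀ i, A i = A (i + 1 + 1) → A (i + 1) ≠ A (i + 1 + 1 + 1)) :
    ∃ i, ∀ j, A j = A i → j = i := by
  have h5 : ∀ i j : Fin 4, j = i ∨ j = i + 1 ∨ j = i + 1 + 1 ∨ j = i + 1 + 1 + 1 := by decide
  obtain ⟨i, hi⟩ : ∃ i, A (i + 1) ≠ A (i + 1 + 1 + 1) := by
    by_cases h3 : A 0 = A 2
    · exact ⟨0, h2 0 h3⟩
    · exact ⟨3, h3⟩
  refine ⟨i + 1, fun j hj => ?_⟩
  rcases h5 i j with rfl | rfl | rfl | rfl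
  · exact absurd hj (h1 _)
  · rfl
  · exact absurd hj.symm (h1 _)
  · exact absurd hj.symm hi

/-- The analogue of `exists_unlike_four` for a 5-cycle. -/
theorem exists_unlike_five {B : Type} (A : Fin 5 → B) (h1 : ∀ i, A i ≠ A (i + 1))
    (h2 : ∀ i, A i = A (i + 1 + 1) → A (i + 1) ≠ A (i + 1 + 1 + 1)) :
    ∃ i, ∀ j, A j = A i → j = i := by
  have h5 : ∀ i j : Fin 5, j = i ∨ j = i + 1 ∨ j = i + 1 + 1 ∨ j = i + 1 + 1 + 1 ∨
    j = i + 1 + 1 + 1 + 1 := by decide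
  have h6 : ∀ i : Fin 5, i + 1 + 1 + 1 + 1 + 1 = i := by decide
  obtain ⟨i, hi, hi'⟩ : ∃ i, A (i + 1) ≠ A (i + 1 + 1 + 1) ∧ A (i + 1 + 1 + 1 + 1) ≠ A (i + 1) := by
    by_cases h3 : ∃ i, A i = A (i + 1 + 1)
    · obtain ⟨i, hi⟩ := h3
      refine ⟨i, h2 i hi, fun h => ?_⟩
      have := h2 (i + 1 + 1 + 1 + 1)
      rw [h6 i] at this
      exact this h hi
    · push Not at h3
      exact ⟨0, h3 1, h3 4⟩
  refine ⟨i + 1, fun j hj => ?_⟩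
  rcases h5 i j with rfl | rfl | rfl | rfl | rfl
  · exact absurd hj (h1 _)
  · rfl
  · exact absurd hj.symm (h1 _)
  · exact absurd hj.symm hi
  · exact absurd hj hi'

/-- A face of length at most five has an edge that is the only one it shares with the face on its
other side. -/
theorem Plane.exists_edge (hP : M.Plane) (hM : M.Conn) (hB : M.Bridgeless) {k : ℕ} [NeZero k]
    {x : Fin k → M.H} (hx : M.IsFaceCycle x) (hC : M.Cubic) (hk : k ≤ 5) :
    ∃ i, ∀ j, M.face (M.α (x j)) = M.face (M.α (x i)) → j = i := by
  have h1 := hx.face_α_ne hB hC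
  have hk0 : k ≠ 0 := NeZero.ne k
  have four : ∀ i : Fin 4, i ≠ i + 1 + 1 := by decide
  have five : ∀ i : Fin 5, i ≠ i + 1 + 1 := by decide
  have hk0 : 0 < k := Nat.pos_of_ne_zero hk0
  have h2' : 4 ≤ k → ∀ i, M.face (M.α (x i)) = M.face (M.α (x (i + 1 + 1))) →
      M.face (M.α (x (i + 1))) ≠ M.face (M.α (x (i + 1 + 1 + 1))) := by
    intro h4 i
    have h3 : ∀ i : Fin k, i ≠ i + 1 + 1 := by
      interval_cases k
      · exact four
      · exact five
    exact hP.not_crossing hM hB hx hC i (h3 i) (h3 (i + 1))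
  interval_cases k
  · exact ⟨0, fun j _ => Subsingleton.elim _ _⟩
  · refine ⟨0, fun j hj => ?_⟩
    by_contra h
    obtain rfl : j = 1 := by lia
    exact h1 0 hj.symm
  · refine ⟨0, fun j hj => ?_⟩
    by_contra h
    obtain rfl | rfl : j = 1 ∨ j = 2 := by lia
    · exact h1 0 hj.symm
    · exact h1 2 hj
  · exact exists_unlike_four _ h1 (h2' (by norm_num))
  · exact exists_unlike_five _ h1 (h2' (by norm_num))

end CombMap

/-! ### Minimal counterexamples, and the contraction of a face -/

/-- A coloring of the spokes of a cycle of length `k` extends to a coloring of the cycle: the edge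
from the vertex `i` to the vertex `i + 1` gets the color `r i`. -/
def CycleExtends {k : ℕ} [NeZero k] (ψ : Fin k → Fin 3) : Prop :=
  ∃ r : Fin k → Fin 3, ∀ i, r i ≠ ψ i ∧ r i ≠ ψ (i + 1) ∧ r i ≠ r (i + 1)

namespace CombMap

variable {M : CombMap} {k : ℕ} [NeZero k] {x : Fin k → M.H}

/-- A coloring of the edges by three colors that is proper at the vertices off the face cycle
`x`. -/
def IsOutsideColoring (M : CombMap) (x : Fin k → M.H) (c : M.H → Fin 3) : Prop :=
  (∀ y, c (M.α y) = c y) ∧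
    ∀ y, (∀ i, y ≠ x i ∧ M.σ y ≠ x i ∧ M.σ (M.σ y) ≠ x i) → c (M.σ y) ≠ c y

/-- The half-edge `y` belongs to an edge of the cycle `x`. -/
def OnCycle (M : CombMap) (x : Fin k → M.H) (y : M.H) : Prop := ∃ i, M.OnEdge (x i) y

namespace IsFaceCycle

theorem σ_not_onCycle (hx : M.IsFaceCycle x) (hB : M.Bridgeless) (hC : M.Cubic) (i : Fin k) :
    ¬ M.OnCycle x (M.σ (x i)) := by
  rintro ⟨j, h | h⟩
  · exact hx.σ_ne hB _ _ h
  · exact hx.σ_ne_α hB hC _ _ h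

/-- A coloring outside the face that extends to the boundary of the face gives a coloring of the
whole map. -/
theorem colorable (hx : M.IsFaceCycle x) (hB : M.Bridgeless) (hC : M.Cubic) {c : M.H → Fin 3}
    (hc : M.IsOutsideColoring x c) (he : CycleExtends fun i => c (M.σ (x i))) : M.Colorable := by
  classical
  obtain ⟨r, hr⟩ := he
  let c' : M.H → Fin 3 := fun y => if h : M.OnCycle x y then r h.choose else c y
  have e0 : ∀ i y, M.OnEdge (x i) y → c' y = r i := by
    intro i y hy
    have h : M.OnCycle x y := ⟨i, hy⟩
    have h1 : h.choose = i := by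
      rcases h.choose_spec with h2 | h2 <;> rcases hy with h3 | h3
      · exact hx.inj (h2.symm.trans h3)
      · exact absurd (h3.symm.trans h2) (hx.α_ne hB _ _)
      · exact absurd (h2.symm.trans h3) (hx.α_ne hB _ _)
      · exact hx.inj (M.invol.injective (h2.symm.trans h3))
    exact (dif_pos h).trans (congrArg r h1)
  have e1 : ∀ i, c' (x i) = r i := fun i => e0 i _ (Or.inl rfl)
  have e2 : ∀ i, c' (M.α (x i)) = r i := fun i => e0 i _ (Or.inr rfl)
  have e3 : ∀ y, ¬ M.OnCycle x y → c' y = c y := fun y hy => dif_neg hy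
  have e4 : ∀ i, c' (M.σ (x i)) = c (M.σ (x i)) := fun i => e3 _ (hx.σ_not_onCycle hB hC i)
  refine ⟨c', fun y => ?_, fun y => ⟨fun h => absurd h (hC.σ_σ_ne y), fun _ => ?_⟩⟩
  · by_cases hy : M.OnCycle x y
    · obtain ⟨i, hi⟩ := hy
      rw [e0 i y hi, e0 i _ ((onEdge_α y).2 hi)]
    · rw [e3 y hy, e3 _ (fun ⟨i, hi⟩ => hy ⟨i, (onEdge_α y).1 hi⟩), hc.1]
  · by_cases h : ∀ i, y ≠ x i ∧ M.σ y ≠ x i ∧ M.σ (M.σ y) ≠ x i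
    · rw [e3 y, e3 (M.σ y)]
      · exact hc.2 y h
      · rintro ⟨i, hi | hi⟩
        · exact (h i).2.1 hi
        · exact (h (i + 1)).2.2 (by rw [hi, hx.step])
      · rintro ⟨i, hi | hi⟩
        · exact (h i).1 hi
        · exact (h (i + 1)).2.1 (by rw [hi, hx.step])
    · push Not at h
      obtain ⟨i, hi⟩ := h
      by_cases h1 : y = x i
      · rw [h1, e4, e1]
        exact (hr i).1.symm
      by_cases h2 : M.σ y = x i
      · obtain rfl : y = M.α (x (i - 1)) := by
          rw [← M.σ.injective.eq_iff, h2, hx.step, sub_add_cancel]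
        have := (hr (i - 1)).2.2
        rw [sub_add_cancel] at this
        rw [h2, e1, e2]
        exact this.symm
      · have h3 := hi h1 h2
        obtain rfl : y = M.σ (x i) := by rw [← h3, (hC y).2]
        have := (hr (i - 1)).2.1
        rw [sub_add_cancel] at this
        rw [hx.σ_σ_eq' hC, e2, e4]
        exact this

end IsFaceCycle

/-- A counterexample with the least number of half-edges. -/
structure IsMinimalCounterexample (M : CombMap) : Prop extends M.IsCounterexample where
  minimal : ∀ N : CombMap, N.IsCounterexample → Nat.card M.H ≤ Nat.card N.H

theorem IsCounterexample.exists_minimal (hM : M.IsCounterexample) :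
    ∃ N : CombMap, N.IsMinimalCounterexample := by
  obtain ⟨N, hN, hmin⟩ := WellFounded.has_min (measure fun M : CombMap => Nat.card M.H).wf
    {M | M.IsCounterexample} ⟨M, hM⟩
  exact ⟨N, hN, fun N' hN' => not_lt.1 (hmin N' hN')⟩

namespace IsMinimalCounterexample

theorem cubic (hM : M.IsMinimalCounterexample) : M.Cubic := by
  intro h
  refine ⟨(hM.subcubic h).1, (hM.subcubic h).2.resolve_left fun h2 => ?_⟩
  obtain ⟨N, hN, hlt⟩ := hM.exists_smaller h2
  exact absurd (hM.minimal N hN) (not_le.2 hlt)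

/-- Deleting a suitable edge of a short face of a minimal counterexample gives a coloring outside
this face. Together with the colors of the remaining edges of the face it is proper at all vertices
of the face but the two ends of the deleted edge, where the two remaining edges agree in color. -/
theorem exists_outside_coloring (hM : M.IsMinimalCounterexample) (hx : M.IsFaceCycle x)
    (hk : k ≤ 5) : ∃ (y : Fin k → M.H) (c : M.H → Fin 3), M.IsFaceCycle y ∧
      M.IsOutsideColoring y c ∧ c (M.σ (y 0)) = c (y (-1)) ∧ c (M.σ (y 1)) = c (y 1) ∧
      ∀ i, i ≠ 0 → i ≠ 1 → c (M.σ (y i)) ≠ c (y i) ∧ c (y (i - 1)) ≠ c (M.σ (y i)) ∧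
        c (y i) ≠ c (y (i - 1)) := by
  have hC := hM.cubic
  have hB := hM.bridgeless
  obtain ⟨i₀, hi₀⟩ := hM.plane.exists_edge hM.conn hB hx hC hk
  have hy := hx.shift i₀
  set y : Fin k → M.H := fun i => x (i + i₀) with hy0
  have he : ∀ z, M.face z = M.face (y 0) → M.face (M.α z) = M.face (M.α (y 0)) → z = y 0 := by
    intro z h1 h2
    obtain ⟨j, rfl⟩ := hy.exists_eq h1
    have := hi₀ (j + i₀) (by simpa only [hy0, zero_add] using h2)
    rw [add_eq_right] at this
    rw [this]
  obtain ⟨N, ι, hN⟩ := exists_delete hB hC (y 0)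
  have hcol : N.Colorable := by
    by_contra hcol
    have h1 := hM.minimal N ⟨delete_conn hM.conn hB hC hN, delete_plane hM.conn hM.plane hB hC hN,
      delete_bridgeless hB he hN, delete_subcubic hC hN, hcol⟩
    have h2 : Nat.card {x // ¬ M.OnEdge (y 0) x} + 2 = Nat.card M.H := by
      have := card_ne_ne (M.ne (y 0)).symm
      simp only [OnEdge, not_or]
      exact this
    have h3 := hN.card_eq
    omega
  obtain ⟨c, c1, c2, c3⟩ := exists_coloring_of_delete hC hN hcol
  have hα : M.OnEdge (y 0) (M.α (y 0)) := Or.inr rfl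
  have ne : ∀ i, i ≠ 0 → ¬ M.OnEdge (y 0) (y i) := by
    rintro i hi (h | h)
    · exact hi (hy.inj h)
    · exact hy.α_ne hB _ _ h.symm
  have ne' : ∀ i, ¬ M.OnEdge (y 0) (M.σ (y i)) := fun i h =>
    hy.σ_not_onCycle hB hC i ⟨0, h⟩
  refine ⟨y, c, hy, ⟨c1, fun z hz => c3 z ?_ ?_ ?_⟩, ?_, ?_, fun i h0 h1 => ?_⟩
  · rintro (h | h)
    · exact (hz 0).1 h
    · exact (hz (0 + 1)).2.1 (by rw [h, hy.step])
  · rintro (h | h)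
    · exact (hz 0).2.1 h
    · exact (hz (0 + 1)).2.2 (by rw [h, hy.step])
  · rintro (h | h)
    · exact (hz 0).2.2 h
    · exact (hz (0 + 1)).1 (by rw [← hy.step, ← h, (hC z).2])
  · have h1 : M.σ (M.α (y (-1))) = y 0 := by rw [hy.step, neg_add_cancel]
    have h2 := c2 (M.α (y (-1))) ?_ (by rw [h1]; exact Or.inl rfl)
    · rwa [h1, c1] at h2
    · rw [onEdge_α]
      refine fun h => hB.σ_ne_α hC (y 0) ?_
      rcases h with h | h
      · rw [h] at h1
        exact absurd (by rw [h1]; exact Or.inl rfl) (not_onEdge_σ hB hC hα)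
      · exact absurd h (hy.α_ne hB _ _).symm
  · have h1 : M.σ (M.σ (y 1)) = M.α (y 0) := by rw [← hy.σ_σ_eq hC, zero_add]
    have h2 := c2 (M.σ (y 1)) (ne' 1) (by rw [h1]; exact hα)
    rw [h1, hy.step, zero_add] at h2
    exact h2.symm
  · have h2 : M.σ (M.σ (y i)) = M.α (y (i - 1)) := hy.σ_σ_eq' hC i
    have h3 : ¬ M.OnEdge (y 0) (M.α (y (i - 1))) := by
      rw [onEdge_α]
      exact ne _ fun h => h1 (by rw [← sub_add_cancel i 1, h, zero_add])
    have e1 := c3 (y i) (ne i h0) (ne' i) (by rwa [h2])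
    have e2 := c3 (M.σ (y i)) (ne' i) (by rwa [h2]) (by rw [(hC _).2]; exact ne i h0)
    have e3 := c3 (M.σ (M.σ (y i))) (by rwa [h2]) (by rw [(hC _).2]; exact ne i h0)
      (by rw [(hC _).2]; exact ne' i)
    rw [(hC _).2] at e3
    rw [h2, c1] at e2 e3
    exact ⟨e1, e2, e3⟩

end IsMinimalCounterexample

section Contract

open Classical in
/-- The rotation after the contraction of the face cycle `x` to a vertex. -/
noncomputable def contractσ (M : CombMap) (x : Fin k → M.H) (y : M.H) : M.H :=
  if M.OnCycle x (M.σ y) then M.σ (M.α (M.σ y)) else M.σ y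

theorem contractσ_spoke (hx : M.IsFaceCycle x) (hC : M.Cubic) (i : Fin k) :
    M.contractσ x (M.σ (x i)) = M.σ (x (i - 1)) := by
  rw [contractσ, hx.σ_σ_eq' hC, if_pos ⟨i - 1, Or.inr rfl⟩, α_α]

theorem not_onCycle_σ (hx : M.IsFaceCycle x) (hC : M.Cubic) {y : M.H} (h : ¬ M.OnCycle x y)
    (hy : ∀ i, y ≠ M.σ (x i)) : ¬ M.OnCycle x (M.σ y) := by
  rintro ⟨i, hi | hi⟩
  · refine h ⟨i - 1, Or.inr ?_⟩
    rw [← M.σ.injective.eq_iff, hx.step, hi, sub_add_cancel]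
  · refine hy (i + 1) ?_
    rw [← M.σ.injective.eq_iff, hi, hx.σ_σ_eq hC]

theorem contractσ_of_ne (hx : M.IsFaceCycle x) (hC : M.Cubic) {y : M.H} (h : ¬ M.OnCycle x y)
    (hy : ∀ i, y ≠ M.σ (x i)) : M.contractσ x y = M.σ y := if_neg (not_onCycle_σ hx hC h hy)

theorem onCycle_α {k : ℕ} {x : Fin k → M.H} (y : M.H) : M.OnCycle x (M.α y) ↔ M.OnCycle x y :=
  exists_congr fun _ => onEdge_α y

theorem exists_contract (hx : M.IsFaceCycle x) (hB : M.Bridgeless) (hC : M.Cubic) :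
    ∃ (N : CombMap) (ι : N.H → M.H),
      M.IsRestriction N ι (fun y => ¬ M.OnCycle x y) (M.contractσ x) M.α := by
  have key : ∀ y, ¬ M.OnCycle x y → (∃ i, y = M.σ (x i)) ∨
      (¬ M.OnCycle x (M.σ y) ∧ M.contractσ x y = M.σ y) := by
    intro y h
    by_cases hy : ∃ i, y = M.σ (x i)
    · exact Or.inl hy
    · push Not at hy
      exact Or.inr ⟨not_onCycle_σ hx hC h hy, contractσ_of_ne hx hC h hy⟩
  refine M.exists_isRestriction _ _ _ (fun y hy => ?_) (fun y z hy hz hyz => ?_)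
    (fun y hy => by rwa [onCycle_α]) (fun y _ => M.α_α y) (fun y _ => M.ne y)
  · rcases key y hy with ⟨i, rfl⟩ | ⟨h1, h2⟩
    · rw [contractσ_spoke hx hC]
      exact hx.σ_not_onCycle hB hC _
    · rwa [h2]
  · rcases key y hy with ⟨i, rfl⟩ | ⟨h1, h2⟩ <;> rcases key z hz with ⟨j, rfl⟩ | ⟨h3, h4⟩
    · rw [contractσ_spoke hx hC, contractσ_spoke hx hC] at hyz
      rw [sub_left_inj.1 (hx.inj (M.σ.injective hyz))]
    · rw [contractσ_spoke hx hC, h4] at hyz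
      exact absurd ⟨i - 1, Or.inl (M.σ.injective hyz).symm⟩ hz
    · rw [contractσ_spoke hx hC, h2] at hyz
      exact absurd ⟨j - 1, Or.inl (M.σ.injective hyz)⟩ hy
    · rw [h2, h4] at hyz
      exact M.σ.injective hyz

variable {N : CombMap} {ι : N.H → M.H}

theorem exists_spokes (hx : M.IsFaceCycle x) (hB : M.Bridgeless) (hC : M.Cubic)
    (hN : M.IsRestriction N ι (fun y => ¬ M.OnCycle x y) (M.contractσ x) M.α) :
    ∃ t : Fin k → N.H, (∀ i, ι (t i) = M.σ (x i)) ∧ ∀ i, N.σ (t i) = t (i - 1) := by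
  choose t ht using fun i => hN.surj _ (hx.σ_not_onCycle hB hC i)
  exact ⟨t, ht, fun i => hN.inj (by rw [hN.σ_eq, ht, ht, contractσ_spoke hx hC])⟩

theorem contract_conn (hM : M.Conn) (hx : M.IsFaceCycle x) (hC : M.Cubic)
    (hN : M.IsRestriction N ι (fun y => ¬ M.OnCycle x y) (M.contractσ x) M.α) {t : Fin k → N.H}
    (ht : ∀ i, ι (t i) = M.σ (x i)) (hσt : ∀ i, N.σ (t i) = t (i - 1)) : N.Conn := by
  intro g hσ hα a b
  have ht0 : ∀ i, g (t i) = g (t 0) :=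
    fin_const (f := fun i => g (t i)) fun i => by rw [← hσt, hσ]
  let g' := Function.extend ι g fun _ => g (t 0)
  have e0 : ∀ y, g' (ι y) = g y := fun y => hN.inj.extend_apply _ _ _
  have e1 : ∀ y, M.OnCycle x y → g' y = g (t 0) := fun y hy =>
    Function.extend_apply' _ _ _ fun ⟨z, hz⟩ => hN.mem z (hz ▸ hy)
  rw [← e0, ← e0]
  refine hM g' (fun y => ?_) (fun y => ?_) _ _
  · by_cases hy : M.OnCycle x y
    · rw [e1 y hy]
      obtain ⟨i, rfl | rfl⟩ := hy
      · rw [← ht, e0, ht0]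
      · exact e1 _ ⟨i + 1, Or.inl (hx.step i)⟩
    by_cases hy' : ∃ i, y = M.σ (x i)
    · obtain ⟨i, rfl⟩ := hy'
      rw [e1 _ ⟨i - 1, Or.inr (hx.σ_σ_eq' hC i)⟩, ← ht, e0, ht0 i]
    · push Not at hy'
      obtain ⟨z, rfl⟩ := hN.surj y hy
      rw [← contractσ_of_ne hx hC hy hy', ← hN.σ_eq, e0, e0, hσ]
  · by_cases hy : M.OnCycle x y
    · rw [e1 y hy, e1 _ ((onCycle_α y).2 hy)]
    · obtain ⟨z, rfl⟩ := hN.surj y hy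
      rw [← hN.α_eq, e0, e0, hα]

theorem contract_face (hx : M.IsFaceCycle x) (hC : M.Cubic)
    (hN : M.IsRestriction N ι (fun y => ¬ M.OnCycle x y) (M.contractσ x) M.α) (y : N.H) :
    M.face (ι (N.φ y)) = M.face (ι y) := by
  rw [φ_apply, hN.σ_eq, hN.α_eq, ← face_φ (ι y), φ_apply]
  by_cases h : ∃ i, M.α (ι y) = M.σ (x i)
  · obtain ⟨i, hi⟩ := h
    rw [hi, contractσ_spoke hx hC, hx.σ_σ_eq' hC, face_α]
  · push Not at h
    rw [contractσ_of_ne hx hC (by rw [onCycle_α]; exact hN.mem y) h]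

theorem contract_plane (hM : M.Conn) (hP : M.Plane) (hB : M.Bridgeless) (hC : M.Cubic)
    (hx : M.IsFaceCycle x)
    (hN : M.IsRestriction N ι (fun y => ¬ M.OnCycle x y) (M.contractσ x) M.α) {t : Fin k → N.H}
    (ht : ∀ i, ι (t i) = M.σ (x i)) (hσt : ∀ i, N.σ (t i) = t (i - 1)) : N.Plane := by
  classical
  have : Nonempty N.H := ⟨t 0⟩
  let p : Quotient (Equiv.Perm.SameCycle.setoid M.σ) → Prop := fun v => ∃ i, v = orbitMk M.σ (x i)
  let lV : N.H → Option {v // ¬ p v} := fun y =>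
    if h : p (orbitMk M.σ (ι y)) then none else some ⟨_, h⟩
  have hnone : ∀ i, lV (t i) = none := fun i => dif_pos ⟨i, by rw [ht, orbitMk_apply]⟩
  have hF : ∀ y, M.face (ι y) ≠ M.face (x 0) := by
    intro y h
    obtain ⟨j, hj⟩ := hx.exists_eq h
    exact hN.mem y ⟨j, Or.inl hj⟩
  refine (contract_conn hM hx hC hN ht hσt).plane_of_labels lV (fun y => ?_) ?_
    (fun y => (⟨_, hF y⟩ : {F // F ≠ M.face (x 0)}))
    (fun y => Subtype.ext (contract_face hx hC hN y)) ?_ ?_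
  · by_cases h : ∃ i, ι y = M.σ (x i)
    · obtain ⟨i, hi⟩ := h
      obtain rfl : y = t i := hN.inj (by rw [hi, ht])
      rw [hσt, hnone, hnone]
    · push Not at h
      have h1 : orbitMk M.σ (ι (N.σ y)) = orbitMk M.σ (ι y) := by
        rw [hN.σ_eq, contractσ_of_ne hx hC (hN.mem y) h, orbitMk_apply]
      simp only [lV, h1]
  · rintro (_ | ⟨v, hv⟩)
    · exact ⟨t 0, hnone 0⟩
    · obtain ⟨z, rfl⟩ := orbitMk_surjective _ v
      obtain ⟨y, rfl⟩ := hN.surj z (by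
        rintro ⟨i, rfl | rfl⟩
        · exact hv ⟨i, rfl⟩
        · exact hv ⟨i + 1, by rw [← hx.step, orbitMk_apply]⟩)
      exact ⟨y, dif_neg hv⟩
  · rintro ⟨F, hF'⟩
    obtain ⟨z, rfl⟩ := orbitMk_surjective _ F
    by_cases hz : M.OnCycle x z
    · obtain ⟨i, rfl | rfl⟩ := hz
      · exact absurd (hx.face_eq i) hF'
      · exact ⟨t i, Subtype.ext (by dsimp only; rw [ht, ← face_α]; rfl)⟩
    · obtain ⟨y, rfl⟩ := hN.surj z hz
      exact ⟨y, rfl⟩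
  -- `k` edges and one face disappear, and at most `k` vertices are replaced by a single one
  · have c1 := card_ne (M.face (x 0))
    have c2 : Nat.card {y // M.OnCycle x y} + Nat.card {y // ¬ M.OnCycle x y} = Nat.card M.H := by
      rw [← Nat.card_sum, Nat.card_congr (Equiv.sumCompl _)]
    have c3 := hN.card_eq
    have c4 : Nat.card {v // p v} + Nat.card {v // ¬ p v} = cycleCount M.σ := by
      rw [← Nat.card_sum, Nat.card_congr (Equiv.sumCompl _)]
      rfl
    have c5 : Nat.card {v // p v} ≤ k := by
      have := Nat.card_le_card_of_surjective (fun i : Fin k => (⟨_, i, rfl⟩ : {v // p v}))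
        (by rintro ⟨v, i, rfl⟩; exact ⟨i, rfl⟩)
      rwa [Nat.card_fin] at this
    have c6 : 2 * k ≤ Nat.card {y // M.OnCycle x y} := by
      have := Nat.card_le_card_of_injective (fun i : Fin k ⊕ Fin k => (i.elim
        (fun i => ⟨x i, i, Or.inl rfl⟩) fun i => ⟨M.α (x i), i, Or.inr rfl⟩ :
          {y // M.OnCycle x y})) (by
        rintro (i | i) (j | j) h <;> replace h := congrArg Subtype.val h
        · exact congrArg _ (hx.inj h)
        · exact absurd h.symm (hx.α_ne hB _ _)
        · exact absurd h (hx.α_ne hB _ _)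
        · exact congrArg _ (hx.inj (M.invol.injective h)))
      rw [Nat.card_sum, Nat.card_fin] at this
      omega
    have c7 : Nat.card (Option {v // ¬ p v}) = Nat.card {v // ¬ p v} + 1 := Finite.card_option
    unfold Plane cycleCount at *
    omega

end Contract

end CombMap

/-! ### Kempe chains -/

section Chain

variable {H : Type}

/-- The orbit of `s` under two maps `α` and `β`. -/
def chain (α β : H → H) (s : H) : Set H :=
  {h | Relation.ReflTransGen (fun x y => y = α x ∨ y = β x) s h}

variable {α β : H → H} {s : H}

theorem self_mem_chain : s ∈ chain α β s := Relation.ReflTransGen.refl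

theorem chain_left {h : H} (hh : h ∈ chain α β s) : α h ∈ chain α β s :=
  Relation.ReflTransGen.tail hh (Or.inl rfl)

theorem chain_right {h : H} (hh : h ∈ chain α β s) : β h ∈ chain α β s :=
  Relation.ReflTransGen.tail hh (Or.inr rfl)

theorem chain_induction {P : H → Prop} (h0 : P s) (hα : ∀ h, P h → P (α h))
    (hβ : ∀ h, P h → P (β h)) {h : H} (hh : h ∈ chain α β s) : P h := by
  induction hh with
  | refl => exact h0
  | tail _ h2 ih =>
    rcases h2 with rfl | rfl
    · exact hα _ ih
    · exact hβ _ ih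

/-- The orbit of a fixed point of `β` under two involutions `α` and `β`, the first of which has no
fixed points, is a path: it contains exactly one other fixed point of `β`. -/
theorem exists_other_end [Finite H] (hα : Function.Involutive α) (hne : ∀ x, α x ≠ x)
    (hβ : Function.Involutive β) (hs : β s = s) :
    ∃ t ∈ chain α β s, t ≠ s ∧ β t = t ∧ ∀ u ∈ chain α β s, β u = u → u = s ∨ u = t := by
  -- The permutation `π = β α` is inverted by conjugation with `β`, so that the orbit of `s`
  -- consists of the points `π ^ n s`, and `β` and `α` act on the exponents as `n ↦ -n` and
  -- `n ↦ -n - 1`. The period `m` of `s` is even as `α` has no fixed point, and the other end is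
  -- `π ^ (m / 2) s`.
  let A : Equiv.Perm H := hα.toPerm
  let B : Equiv.Perm H := hβ.toPerm
  let π := B * A
  have hA : A⁻¹ = A := inv_eq_of_mul_eq_one_left (Equiv.ext hα)
  have hB : B⁻¹ = B := inv_eq_of_mul_eq_one_left (Equiv.ext hβ)
  have hBB : B * B = 1 := Equiv.ext hβ
  have hπ : B * π * B⁻¹ = π⁻¹ := by
    rw [mul_inv_rev, hA, ← mul_assoc, hBB, one_mul]
  have hBs : ∀ n : ℤ, β ((π ^ n) s) = (π ^ (-n)) s := by
    intro n
    have h1 : B * π ^ n = π ^ (-n) * B := by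
      rw [zpow_neg, ← inv_zpow, ← hπ, conj_zpow, inv_mul_cancel_right]
    have h2 := congrArg (fun f : Equiv.Perm H => f s) h1
    have h3 : B s = s := hs
    simp only [Equiv.Perm.mul_apply, h3] at h2
    exact h2
  have hAs : ∀ n : ℤ, α ((π ^ n) s) = (π ^ (-n - 1)) s := by
    intro n
    have h1 : A = B * π := by rw [← mul_assoc, hBB, one_mul]
    have h2 : α ((π ^ n) s) = β (π ((π ^ n) s)) := congrArg (fun f : Equiv.Perm H => f _) h1
    rw [h2, ← Equiv.Perm.mul_apply, ← zpow_one_add, hBs]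
    congr 2
    ring
  obtain ⟨m, hmpos, hm⟩ : ∃ m : ℕ, 0 < m ∧
      ∀ i j : ℤ, (π ^ i) s = (π ^ j) s ↔ (m : ℤ) ∣ i - j := by
    refine ⟨MulAction.period π s, MulAction.period_pos_of_orderOf_pos (orderOf_pos π) s,
      fun i j => ?_⟩
    have h1 : (π ^ i) s = (π ^ j) ((π ^ (i - j)) s) := by
      rw [← Equiv.Perm.mul_apply, ← zpow_add, add_sub_cancel]
    rw [h1, (π ^ j).injective.eq_iff, ← MulAction.zpow_smul_eq_iff_period_dvd,
      Equiv.Perm.smul_def]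
  have hev : ∃ q, m = 2 * q := by
    obtain ⟨q, hq | hq⟩ := Nat.even_or_odd' m
    · exact ⟨q, hq⟩
    have := hne ((π ^ (q : ℤ)) s)
    rw [hAs, Ne, hm, hq] at this
    exact absurd ⟨-1, by push_cast; ring⟩ this
  obtain ⟨q, hq⟩ := hev
  have hmem : ∀ u ∈ chain α β s, ∃ n : ℤ, u = (π ^ n) s := by
    intro u hu
    refine chain_induction (P := fun u => ∃ n : ℤ, u = (π ^ n) s) ⟨0, rfl⟩ ?_ ?_ hu
    · rintro _ ⟨n, rfl⟩
      exact ⟨_, hAs n⟩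
    · rintro _ ⟨n, rfl⟩
      exact ⟨_, hBs n⟩
  refine ⟨(π ^ (q : ℤ)) s, ?_, ?_, ?_, ?_⟩
  · have : ∀ n : ℕ, (π ^ n) s ∈ chain α β s := by
      intro n
      induction n with
      | zero => exact self_mem_chain
      | succ n ih =>
        rw [pow_succ', Equiv.Perm.mul_apply]
        exact chain_right (chain_left ih)
    exact this q
  · intro h
    have h1 := (hm q 0).1 h
    rw [hq, sub_zero] at h1
    have := Int.le_of_dvd (by omega) h1
    push_cast at this
    omega
  · rw [hBs, hm, hq]
    exact ⟨-1, by push_cast; ring⟩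
  · intro u hu hfix
    obtain ⟨n, rfl⟩ := hmem u hu
    rw [hBs, hm, hq] at hfix
    obtain ⟨l, hl⟩ := hfix
    have hn : n = q * (-l) := by push_cast at hl; linarith
    rcases Int.even_or_odd' (-l) with ⟨r, hr | hr⟩
    · refine Or.inl ((hm n 0).2 ⟨r, ?_⟩)
      rw [hn, hr, hq]
      push_cast
      ring
    · refine Or.inr ((hm n q).2 ⟨r, ?_⟩)
      rw [hn, hr, hq]
      push_cast
      ring

end Chain

namespace NearCubicGraph

variable {d : ℕ} {N : NearCubicGraph d}

/-- The half-edge with number `i` at the distinguished vertex. -/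
def spoke (N : NearCubicGraph d) (i : Fin d) : N.G.H := (N.ν.symm i).1

theorem vert_spoke (i : Fin d) : N.G.vert (N.spoke i) = N.v := (N.ν.symm i).2

theorem spoke_injective : Function.Injective N.spoke := fun _ _ h =>
  N.ν.symm.injective (Subtype.ext h)

theorem exists_spoke {h : N.G.H} (hh : N.G.vert h = N.v) : ∃ i, h = N.spoke i :=
  ⟨N.ν ⟨h, hh⟩, by rw [spoke, Equiv.symm_apply_apply]⟩

/-- At a vertex of degree three, a proper coloring uses all three colors. -/
theorem exists_color {c : N.G.EdgeColoring} (hc : N.IsThreeEdgeColoring c) {u : N.G.V}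
    (hu : u ≠ N.v) (k : Fin 3) : ∃ y, N.G.vert y = u ∧ c.1 y = k := by
  have hinj : Function.Injective fun y : {y : N.G.H // N.G.vert y = u} => c.1 y.1 := by
    intro y z h
    by_contra hne
    exact hc u hu y.1 z.1 y.2 z.2 (fun h => hne (Subtype.ext h)) h
  have hcard : Nat.card {y : N.G.H // N.G.vert y = u} = 3 := N.cubic u hu
  have := (hinj.bijective_of_nat_card_le (by rw [hcard, Nat.card_fin])).2
  obtain ⟨⟨y, hy⟩, hk⟩ := this k
  exact ⟨y, hy, hk⟩

open Classical in
/-- The partner of a half-edge in the two-colored subgraph of the colors `a` and `b`: the half-edge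
at the same vertex with the other of the two colors. A half-edge at the distinguished vertex is its
own partner. -/
noncomputable def partner (N : NearCubicGraph d) (a b : Fin 3) (c : N.G.EdgeColoring)
    (h : N.G.H) : N.G.H :=
  if hy : N.G.vert h ≠ N.v ∧ ∃ y, N.G.vert y = N.G.vert h ∧ c.1 y = Equiv.swap a b (c.1 h) then
    hy.2.choose else h

variable {a b : Fin 3} {c : N.G.EdgeColoring}

theorem partner_of_eq {h : N.G.H} (hh : N.G.vert h = N.v) : N.partner a b c h = h :=
  dif_neg fun hy => hy.1 hh

theorem partner_spec (hc : N.IsThreeEdgeColoring c) {h : N.G.H} (hh : N.G.vert h ≠ N.v) :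
    N.G.vert (N.partner a b c h) = N.G.vert h ∧
      c.1 (N.partner a b c h) = Equiv.swap a b (c.1 h) := by
  have hy := exists_color hc hh (Equiv.swap a b (c.1 h))
  rw [partner, dif_pos ⟨hh, hy⟩]
  exact hy.choose_spec

theorem eq_partner (hc : N.IsThreeEdgeColoring c) {h y : N.G.H} (hh : N.G.vert h ≠ N.v)
    (h1 : N.G.vert y = N.G.vert h) (h2 : c.1 y = Equiv.swap a b (c.1 h)) :
    N.partner a b c h = y := by
  by_contra hne
  have h3 := partner_spec (a := a) (b := b) hc hh
  exact hc _ hh _ _ h3.1 h1 hne (h3.2.trans h2.symm)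

theorem partner_involutive (hc : N.IsThreeEdgeColoring c) :
    Function.Involutive (N.partner a b c) := by
  intro h
  by_cases hh : N.G.vert h = N.v
  · rw [partner_of_eq hh, partner_of_eq hh]
  · have h1 := partner_spec (a := a) (b := b) hc hh
    exact eq_partner hc (by rwa [h1.1]) h1.1.symm (by rw [h1.2, Equiv.swap_apply_self])

/-- The Kempe chain of the colors `a` and `b` that starts with the half-edge `s`. -/
def kempeChain (N : NearCubicGraph d) (a b : Fin 3) (s : N.G.H) (c : N.G.EdgeColoring) :
    Set N.G.H :=
  chain N.G.opp (N.partner a b c) s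

open Classical in
/-- The coloring in which the colors `a` and `b` are exchanged along the Kempe chain of `s`. -/
noncomputable def kempeSwitch (N : NearCubicGraph d) (a b : Fin 3) (s : N.G.H)
    (c : N.G.EdgeColoring) : N.G.EdgeColoring :=
  ⟨fun h => if h ∈ N.kempeChain a b s c then Equiv.swap a b (c.1 h) else c.1 h, fun h => by
    have h1 : N.G.opp h ∈ N.kempeChain a b s c ↔ h ∈ N.kempeChain a b s c :=
      ⟨fun hh => by
        have := chain_left hh
        rwa [N.G.opp_invol h] at this, chain_left⟩
    simp only [h1, c.2]⟩

variable {s : N.G.H}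

theorem kempeSwitch_of_mem {h : N.G.H} (hh : h ∈ N.kempeChain a b s c) :
    (N.kempeSwitch a b s c).1 h = Equiv.swap a b (c.1 h) := if_pos hh

theorem kempeSwitch_of_notMem {h : N.G.H} (hh : h ∉ N.kempeChain a b s c) :
    (N.kempeSwitch a b s c).1 h = c.1 h := if_neg hh

theorem partner_mem_kempeChain (hc : N.IsThreeEdgeColoring c) {h : N.G.H} :
    N.partner a b c h ∈ N.kempeChain a b s c ↔ h ∈ N.kempeChain a b s c :=
  ⟨fun hh => by
    have := chain_right hh
    rwa [partner_involutive hc h] at this, chain_right⟩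

theorem isThreeEdgeColoring_kempeSwitch (hc : N.IsThreeEdgeColoring c) :
    N.IsThreeEdgeColoring (N.kempeSwitch a b s c) := by
  -- two half-edges at a vertex of degree three of which only one is in the chain are not partners
  have key : ∀ x y, N.G.vert x ≠ N.v → N.G.vert y = N.G.vert x → x ∈ N.kempeChain a b s c →
      y ∉ N.kempeChain a b s c → c.1 y ≠ Equiv.swap a b (c.1 x) := by
    intro x y hx hxy h1 h2 h3
    exact h2 (eq_partner hc hx hxy h3 ▸ (partner_mem_kempeChain hc).2 h1)
  intro u hu x y hx hy hxy
  have hne := hc u hu x y hx hy hxy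
  have hx' : N.G.vert x ≠ N.v := by rwa [hx]
  have hy' : N.G.vert y ≠ N.v := by rwa [hy]
  by_cases h1 : x ∈ N.kempeChain a b s c <;> by_cases h2 : y ∈ N.kempeChain a b s c
  · rw [kempeSwitch_of_mem h1, kempeSwitch_of_mem h2]
    exact (Equiv.swap a b).injective.ne hne
  · rw [kempeSwitch_of_mem h1, kempeSwitch_of_notMem h2]
    exact (key x y hx' (by rw [hx, hy]) h1 h2).symm
  · rw [kempeSwitch_of_notMem h1, kempeSwitch_of_mem h2]
    exact key y x hy' (by rw [hx, hy]) h2 h1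
  · rwa [kempeSwitch_of_notMem h1, kempeSwitch_of_notMem h2]

theorem partner_kempeSwitch (hc : N.IsThreeEdgeColoring c) :
    N.partner a b (N.kempeSwitch a b s c) = N.partner a b c := by
  funext h
  by_cases hh : N.G.vert h = N.v
  · rw [partner_of_eq hh, partner_of_eq hh]
  have h1 := partner_spec (a := a) (b := b) hc hh
  refine eq_partner (isThreeEdgeColoring_kempeSwitch hc) hh h1.1 ?_
  by_cases h2 : h ∈ N.kempeChain a b s c
  · rw [kempeSwitch_of_mem h2, kempeSwitch_of_mem ((partner_mem_kempeChain hc).2 h2), h1.2]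
  · rw [kempeSwitch_of_notMem h2,
      kempeSwitch_of_notMem (fun h3 => h2 ((partner_mem_kempeChain hc).1 h3)), h1.2]

theorem kempeSwitch_kempeSwitch (hc : N.IsThreeEdgeColoring c) :
    N.kempeSwitch a b s (N.kempeSwitch a b s c) = c := by
  have h1 : N.kempeChain a b s (N.kempeSwitch a b s c) = N.kempeChain a b s c := by
    unfold kempeChain
    rw [partner_kempeSwitch hc]
  refine Subtype.ext (funext fun h => ?_)
  by_cases h2 : h ∈ N.kempeChain a b s c
  · rw [kempeSwitch_of_mem (by rwa [h1]), kempeSwitch_of_mem h2, Equiv.swap_apply_self]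
  · rw [kempeSwitch_of_notMem (by rwa [h1]), kempeSwitch_of_notMem h2]

/-- A Kempe chain that starts at the distinguished vertex ends there with exactly one other
half-edge. -/
theorem exists_kempeSwitch_spoke (hc : N.IsThreeEdgeColoring c) (hab : a ≠ b) {i : Fin d}
    (hi : c.1 (N.spoke i) = a ∨ c.1 (N.spoke i) = b) :
    ∃ j, j ≠ i ∧ (c.1 (N.spoke j) = a ∨ c.1 (N.spoke j) = b) ∧
      ∀ m, (N.kempeSwitch a b (N.spoke i) c).1 (N.spoke m) =
        if m = i ∨ m = j then Equiv.swap a b (c.1 (N.spoke m)) else c.1 (N.spoke m) := by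
  have hcol : ∀ h ∈ N.kempeChain a b (N.spoke i) c, c.1 h = a ∨ c.1 h = b := by
    intro h hh
    refine chain_induction (P := fun h => c.1 h = a ∨ c.1 h = b) hi (fun h hP => ?_)
      (fun h hP => ?_) hh
    · rwa [c.2]
    · by_cases hv : N.G.vert h = N.v
      · rwa [partner_of_eq hv]
      · rw [(partner_spec hc hv).2]
        rcases hP with h1 | h1
        · rw [h1, Equiv.swap_apply_left]
          exact Or.inr rfl
        · rw [h1, Equiv.swap_apply_right]
          exact Or.inl rfl
  obtain ⟨t, ht, hts, htt, hu⟩ := exists_other_end N.G.opp_invol N.G.opp_ne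
    (partner_involutive hc (a := a) (b := b)) (partner_of_eq (vert_spoke i))
  have hv : N.G.vert t = N.v := by
    by_contra hv
    have h1 := (partner_spec (a := a) (b := b) hc hv).2
    rw [htt] at h1
    rcases hcol t ht with h2 | h2
    · rw [h2, Equiv.swap_apply_left] at h1
      exact hab h1
    · rw [h2, Equiv.swap_apply_right] at h1
      exact hab h1.symm
  obtain ⟨j, rfl⟩ := exists_spoke hv
  refine ⟨j, fun h => hts (by rw [h]), hcol _ ht, fun m => ?_⟩
  by_cases hm : m = i ∨ m = j
  · rw [if_pos hm, kempeSwitch_of_mem]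
    rcases hm with rfl | rfl
    · exact self_mem_chain
    · exact ht
  · rw [if_neg hm, kempeSwitch_of_notMem]
    intro h
    rcases hu _ h (partner_of_eq (vert_spoke m)) with h1 | h1
    · exact hm (Or.inl (spoke_injective h1))
    · exact hm (Or.inr (spoke_injective h1))

end NearCubicGraph

/-! ### The pentagon and the pentagram -/

/-- The coloring of `0, …, 4` that gives `p` the color `a`, `q` the color `b` and all others the
color `c`. -/
def twoSingles (p q : Fin 5) (a b c : Fin 3) (i : Fin 5) : Fin 3 :=
  if i = p then a else if i = q then b else c

theorem twoSingles_comm {p q : Fin 5} (h : p ≠ q) (a b c : Fin 3) :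
    twoSingles p q a b c = twoSingles q p b a c := by
  funext i
  unfold twoSingles
  split_ifs with h1 h2
  · exact absurd (h1.symm.trans h2) h
  all_goals rfl

theorem cycleExtends_twoSingles {p : Fin 5} {a b c : Fin 3} (hab : a ≠ b) (hac : a ≠ c)
    (hbc : b ≠ c) : CycleExtends (twoSingles p (p + 1) a b c) := by
  refine ⟨fun i => if i = p then c else if i = p + 1 ∨ i = p + 3 then a else b, ?_⟩
  revert p a b c
  unfold twoSingles
  decide

/-- Each color is used an odd number of times. -/
def OddColors (ψ : Fin 5 → Fin 3) : Prop :=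
  ∀ c, (∑ i, if ψ i = c then 1 else 0) % 2 = 1

theorem oddColors_iff (ψ : Fin 5 → Fin 3) :
    OddColors ψ ↔ ∀ c, Nat.card {i // ψ i = c} ≡ 5 [MOD 2] := by
  refine forall_congr' fun c => ?_
  rw [Nat.card_eq_fintype_card, Fintype.card_subtype, Finset.card_filter]
  rfl

/-- The pattern of five colors each of which occurs an odd number of times: the numbers of
occurrences are three, one and one. -/
theorem exists_twoSingles_vec : ∀ x₀ x₁ x₂ x₃ x₄ : Fin 3,
    (∀ c, ((if x₀ = c then 1 else 0) + (if x₁ = c then 1 else 0) + (if x₂ = c then 1 else 0) +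
      (if x₃ = c then 1 else 0) + (if x₄ = c then 1 else 0)) % 2 = 1) →
    ∃ p q : Fin 5, p ≠ q ∧ ![x₀, x₁, x₂, x₃, x₄] p ≠ ![x₀, x₁, x₂, x₃, x₄] q ∧
      ∀ i, ![x₀, x₁, x₂, x₃, x₄] i = twoSingles p q (![x₀, x₁, x₂, x₃, x₄] p)
        (![x₀, x₁, x₂, x₃, x₄] q) (-(![x₀, x₁, x₂, x₃, x₄] p + ![x₀, x₁, x₂, x₃, x₄] q)) i := by
  decide

/-- The three colors sum to zero, so that the third color besides `a` and `b` is `-(a + b)`. -/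
theorem fin_three_ne_third : ∀ a b : Fin 3, a ≠ b → a ≠ -(a + b) ∧ b ≠ -(a + b) := by decide

theorem fin_three_eq {a b c x : Fin 3} : a ≠ b → a ≠ c → b ≠ c → x ≠ a → x ≠ b → x = c := by
  intros
  lia

theorem vec_five {A : Type*} (ψ : Fin 5 → A) : ![ψ 0, ψ 1, ψ 2, ψ 3, ψ 4] = ψ := by
  funext i
  fin_cases i <;> rfl

/-- A coloring of five spokes in which each color occurs an odd number of times, and which does not
extend to the 5-cycle, has one color three times and the other two once each, at distance two. -/
theorem exists_twoSingles {ψ : Fin 5 → Fin 3} (h : OddColors ψ) (hψ : ¬ CycleExtends ψ) :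
    ∃ p a b c, a ≠ b ∧ a ≠ c ∧ b ≠ c ∧ ψ = twoSingles p (p + 2) a b c := by
  obtain ⟨p, q, hpq, hab, hi⟩ := exists_twoSingles_vec (ψ 0) (ψ 1) (ψ 2) (ψ 3) (ψ 4) fun c => by
    have := h c
    rwa [Fin.sum_univ_five] at this
  rw [vec_five] at hab hi
  generalize ψ p = a at hab hi
  generalize ψ q = b at hab hi
  obtain ⟨hac, hbc⟩ := fin_three_ne_third a b hab
  generalize -(a + b) = c at *
  obtain rfl : ψ = twoSingles p q a b c := funext hi
  have h4 : ∀ p q : Fin 5, p ≠ q → q = p + 1 ∨ p = q + 1 ∨ q = p + 2 ∨ p = q + 2 := by decide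
  rcases h4 p q hpq with rfl | rfl | rfl | rfl
  · exact absurd (cycleExtends_twoSingles hab hac hbc) hψ
  · rw [twoSingles_comm hpq] at hψ
    exact absurd (cycleExtends_twoSingles hab.symm hbc hac) hψ
  · exact ⟨p, a, b, c, hab, hac, hbc, rfl⟩
  · exact ⟨q, b, a, c, hab.symm, hbc, hac, twoSingles_comm hpq _ _ _⟩

/-- The coloring `f` of the spokes and the coloring `r` of the pentagram form a coloring of the
Petersen fragment. -/
def IsPentagramColoring (f r : Fin 5 → Fin 3) : Prop :=
  ∀ i, r i ≠ f i ∧ r (i + 3) ≠ f i ∧ r i ≠ r (i + 3)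

set_option synthInstance.maxSize 1000 in
/-- The colors `x i` of the pentagon force the color `-(x i + x (i + 1))` of the spoke between two
consecutive edges. Tracing the pentagram in the order `0, 2, 4, 1, 3` from a color `y₀` that is
compatible with the spokes, one cannot return with a different color. -/
theorem petersen_not_colorable : ∀ x₀ x₁ : Fin 3, x₀ ≠ x₁ → ∀ x₂, x₁ ≠ x₂ → ∀ x₃, x₂ ≠ x₃ →
    ∀ x₄, x₃ ≠ x₄ ∧ x₄ ≠ x₀ →
    ∀ y₀ y₂ : Fin 3, (y₀ ≠ -(x₄ + x₀) ∧ y₀ ≠ -(x₁ + x₂) ∧ y₂ ≠ -(x₁ + x₂) ∧ y₂ ≠ y₀) →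
    ∀ y₄, (y₂ ≠ -(x₃ + x₄) ∧ y₄ ≠ -(x₃ + x₄) ∧ y₄ ≠ y₂) →
    ∀ y₁, (y₄ ≠ -(x₀ + x₁) ∧ y₁ ≠ -(x₀ + x₁) ∧ y₁ ≠ y₄) →
    ∀ y₃, (y₁ ≠ -(x₂ + x₃) ∧ y₃ ≠ -(x₂ + x₃) ∧ y₃ ≠ y₁) → y₃ ≠ -(x₄ + x₀) → y₃ = y₀ := by
  decide

theorem fin_three_eq_third {a b x : Fin 3} : a ≠ b → a ≠ x → b ≠ x → x = -(a + b) := by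
  revert a b x
  decide

/-- The Petersen graph is not 3-edge-colorable: no coloring of the five spokes extends both to the
pentagon and to the pentagram. -/
theorem CycleExtends.not_isPentagramColoring {f : Fin 5 → Fin 3} (hf : CycleExtends f)
    (r : Fin 5 → Fin 3) : ¬ IsPentagramColoring f r := by
  obtain ⟨x, hx⟩ := hf
  intro hr
  have hx3 : ∀ i, x i ≠ x (i + 1) := fun i => (hx i).2.2
  have hfx : ∀ i, f (i + 1) = -(x i + x (i + 1)) := fun i =>
    fin_three_eq_third (hx i).2.2 (hx i).2.1 (hx (i + 1)).1
  have f0 := hfx 4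
  have f1 := hfx 0
  have f2 := hfx 1
  have f3 := hfx 2
  have f4 := hfx 3
  have h0 := hr 0
  have h1 := hr 1
  have h2 := hr 2
  have h3 := hr 3
  have h4 := hr 4
  change f 0 = -(x 4 + x 0) at f0
  change f 1 = -(x 0 + x 1) at f1
  change f 2 = -(x 1 + x 2) at f2
  change f 3 = -(x 2 + x 3) at f3
  change f 4 = -(x 3 + x 4) at f4
  change _ ∧ r 3 ≠ _ ∧ _ ≠ r 3 at h0
  change _ ∧ r 4 ≠ _ ∧ _ ≠ r 4 at h1
  change _ ∧ r 0 ≠ _ ∧ _ ≠ r 0 at h2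
  change _ ∧ r 1 ≠ _ ∧ _ ≠ r 1 at h3
  change _ ∧ r 2 ≠ _ ∧ _ ≠ r 2 at h4
  rw [f0] at h0
  rw [f1] at h1
  rw [f2] at h2
  rw [f3] at h3
  rw [f4] at h4
  exact h0.2.2 (petersen_not_colorable _ _ (hx3 0) _ (hx3 1) _ (hx3 2) _ ⟨hx3 3, hx3 4⟩ _ _
    ⟨h0.1, h2.2.1, h2.1, h2.2.2⟩ _ ⟨h4.2.1, h4.1, h4.2.2⟩ _ ⟨h1.2.1, h1.1, h1.2.2⟩ _
    ⟨h3.2.1, h3.1, h3.2.2⟩ h0.2.1).symm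

theorem twoSingles_values (p : Fin 5) (a b c : Fin 3) :
    twoSingles p (p + 2) a b c p = a ∧ twoSingles p (p + 2) a b c (p + 1) = c ∧
      twoSingles p (p + 2) a b c (p + 2) = b ∧ twoSingles p (p + 2) a b c (p + 3) = c ∧
      twoSingles p (p + 2) a b c (p + 4) = c := by
  revert p a b c
  unfold twoSingles
  decide

/-- Two single colors at distance two in the pentagon are consecutive in the pentagram, and force
all colors there. -/
theorem existsUnique_isPentagramColoring (p : Fin 5) {a b c : Fin 3} (hab : a ≠ b) (hac : a ≠ c)
    (hbc : b ≠ c) : ∃! r, IsPentagramColoring (twoSingles p (p + 2) a b c) r := by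
  refine ⟨fun i => if i = p then c else if i = p + 2 ∨ i = p + 1 then a else b, ?_, ?_⟩
  · revert p a b c
    unfold twoSingles IsPentagramColoring
    decide
  · intro r hr
    obtain ⟨f0, f1, f2, f3, f4⟩ := twoSingles_values p a b c
    have e : ∀ p : Fin 5, p + 1 + 3 = p + 4 ∧ p + 2 + 3 = p ∧ p + 3 + 3 = p + 1 ∧
        p + 4 + 3 = p + 2 := by decide
    obtain ⟨e1, e2, e3, e4⟩ := e p
    have h0 := hr p
    have h1 := hr (p + 1)
    have h2 := hr (p + 2)
    have h3 := hr (p + 3)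
    have h4 := hr (p + 4)
    rw [f0] at h0
    rw [f1, e1] at h1
    rw [f2, e2] at h2
    rw [f3, e3] at h3
    rw [f4, e4] at h4
    have r0 : r p = c := fin_three_eq hab hac hbc h0.1 h2.2.1
    have r2 : r (p + 2) = a := fin_three_eq hbc hab.symm hac.symm h2.1 (by rw [← r0]; exact h2.2.2)
    have r4 : r (p + 4) = b :=
      fin_three_eq hac.symm hbc.symm hab h4.1 (by rw [← r2]; exact h4.2.2)
    have r1 : r (p + 1) = a :=
      fin_three_eq hbc.symm hac.symm hab.symm h1.1 (by rw [← r4]; exact h1.2.2)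
    have r3 : r (p + 3) = b :=
      fin_three_eq hac.symm hbc.symm hab h3.1 (by rw [← r1]; exact h3.2.2)
    have hi : ∀ i p : Fin 5, (i = p) ∨ (i = p + 1) ∨ (i = p + 2) ∨ (i = p + 3) ∨ (i = p + 4) := by
      decide
    have hne : ∀ p : Fin 5, p + 1 ≠ p ∧ p + 2 ≠ p ∧ p + 3 ≠ p ∧ p + 4 ≠ p ∧ p + 3 ≠ p + 2 ∧
      p + 4 ≠ p + 2 ∧ p + 3 ≠ p + 1 ∧ p + 4 ≠ p + 1 := by decide
    obtain ⟨n1, n2, n3, n4, n5, n6, n7, n8⟩ := hne p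
    funext i
    rcases hi i p with rfl | rfl | rfl | rfl | rfl
    · rw [r0, if_pos rfl]
    · rw [r1, if_neg n1, if_pos (Or.inr rfl)]
    · rw [r2, if_neg n2, if_pos (Or.inl rfl)]
    · rw [r3, if_neg n3, if_neg (not_or.2 ⟨n5, n7⟩)]
    · rw [r4, if_neg n4, if_neg (not_or.2 ⟨n6, n8⟩)]

namespace NearCubicGraph

variable {d : ℕ}

/-- The number of 3-edge-colorings that give the spoke `i` the color `f i`. -/
noncomputable def colorCount (N : NearCubicGraph d) (f : Fin d → Fin 3) : ℕ :=
  Nat.card {c : N.G.EdgeColoring // N.IsThreeEdgeColoring c ∧ ∀ i, c.1 (N.spoke i) = f i}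

/-- Through `colorCount`, the extension counts make sense for colorings of the spokes without the
parity condition of a precoloring. -/
theorem extensionCount_eq (N : NearCubicGraph d) (ψ : Precoloring d) :
    N.extensionCount ψ = N.colorCount ψ.1 := by
  have h : ∀ c : N.G.EdgeColoring, N.Extends c ψ ↔ ∀ i, c.1 (N.spoke i) = ψ.1 i := by
    intro c
    refine ⟨fun h i => ?_, fun h x => ?_⟩
    · have := h (N.ν.symm i)
      rwa [Equiv.apply_symm_apply] at this
    · have := h (N.ν x)
      rwa [spoke, Equiv.symm_apply_apply] at this
  simp only [extensionCount, colorCount, h]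

end NearCubicGraph

namespace PetersenFragment

theorem half_edges_at (x : Fin 4 × Fin 5) (j : Fin 5)
    (h : (![none, some x.2, some x.2, some (x.2 + 2)] : Fin 4 → Option (Fin 5)) x.1 = some j) :
    x = (1, j) ∨ x = (2, j) ∨ x = (3, j + 3) := by
  revert x j
  decide

theorem vert_eq (j : Fin 5) : graph.vert ((1 : Fin 4), j) = some j ∧
    graph.vert ((2 : Fin 4), j) = some j ∧ graph.vert ((3 : Fin 4), j + 3) = some j := by
  have h : j + 3 + 2 = j := by revert j; decide
  exact ⟨rfl, rfl, congrArg some h⟩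

/-- The colors of the half-edges `(k, i)` in terms of those of the spokes and the pentagram. -/
def coloring (f r : Fin 5 → Fin 3) : graph.EdgeColoring :=
  ⟨fun x => (![f x.2, f x.2, r x.2, r x.2] : Fin 4 → Fin 3) x.1, by
    rintro ⟨k, i⟩
    fin_cases k <;> rfl⟩

theorem isThreeEdgeColoring_coloring {f r : Fin 5 → Fin 3} (h : IsPentagramColoring f r) :
    petersenFragment.IsThreeEdgeColoring (coloring f r) := by
  rintro (_ | j) hu
  · exact absurd rfl hu
  intro x y hx hy hxy
  obtain ⟨h1, h2, h3⟩ := h j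
  rcases half_edges_at x j hx with rfl | rfl | rfl <;>
    rcases half_edges_at y j hy with rfl | rfl | rfl
  · exact absurd rfl hxy
  · exact h1.symm
  · exact h2.symm
  · exact h1
  · exact absurd rfl hxy
  · exact h3
  · exact h2
  · exact h3.symm
  · exact absurd rfl hxy

theorem eq_coloring (c : graph.EdgeColoring) :
    c = coloring (fun i => c.1 ((0 : Fin 4), i)) fun i => c.1 ((2 : Fin 4), i) := by
  refine Subtype.ext (funext ?_)
  rintro ⟨k, i⟩
  fin_cases k
  · rfl
  · exact (c.2 ((1 : Fin 4), i)).symm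
  · rfl
  · exact (c.2 ((3 : Fin 4), i)).symm

theorem isPentagramColoring {c : graph.EdgeColoring}
    (hc : petersenFragment.IsThreeEdgeColoring c) :
    IsPentagramColoring (fun i => c.1 ((0 : Fin 4), i)) fun i => c.1 ((2 : Fin 4), i) := by
  intro i
  obtain ⟨v1, v2, v3⟩ := vert_eq i
  have h := hc (some i) (by rintro ⟨⟩)
  have e0 : c.1 ((0 : Fin 4), i) = c.1 ((1 : Fin 4), i) := c.2 ((1 : Fin 4), i)
  have e2 : c.1 ((2 : Fin 4), i + 3) = c.1 ((3 : Fin 4), i + 3) := c.2 ((3 : Fin 4), i + 3)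
  have n12 : ((1 : Fin 4), i) ≠ (2, i) := fun h =>
    (show (1 : Fin 4) ≠ 2 by decide) (congrArg Prod.fst h)
  have n13 : ((1 : Fin 4), i) ≠ (3, i + 3) := fun h =>
    (show (1 : Fin 4) ≠ 3 by decide) (congrArg Prod.fst h)
  have n23 : ((2 : Fin 4), i) ≠ (3, i + 3) := fun h =>
    (show (2 : Fin 4) ≠ 3 by decide) (congrArg Prod.fst h)
  beta_reduce
  rw [e0, e2]
  exact ⟨(h _ _ v1 v2 n12).symm, (h _ _ v1 v3 n13).symm, h _ _ v2 v3 n23⟩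

theorem colorCount_eq_zero {f : Fin 5 → Fin 3} (hf : CycleExtends f) :
    petersenFragment.colorCount f = 0 := by
  refine Nat.card_eq_zero.2 (Or.inl ⟨?_⟩)
  rintro ⟨c, hc, hcf⟩
  have h := isPentagramColoring hc
  rw [show (fun i => c.1 ((0 : Fin 4), i)) = f from funext hcf] at h
  exact hf.not_isPentagramColoring _ h

theorem colorCount_eq_one {f : Fin 5 → Fin 3} (hf : ∃! r, IsPentagramColoring f r) :
    petersenFragment.colorCount f = 1 := by
  obtain ⟨r, hr, hu⟩ := hf
  refine Nat.card_eq_one_iff_unique.2 ⟨⟨?_⟩, ⟨⟨coloring f r, isThreeEdgeColoring_coloring hr,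
    fun _ => rfl⟩⟩⟩
  have key : ∀ c : graph.EdgeColoring, petersenFragment.IsThreeEdgeColoring c →
      (∀ i, c.1 (petersenFragment.spoke i) = f i) → c = coloring f r := by
    intro c hc hcf
    have h := isPentagramColoring hc
    have e := eq_coloring c
    rw [show (fun i => c.1 ((0 : Fin 4), i)) = f from funext hcf] at h e
    rw [e, hu _ h]
  rintro ⟨c, hc⟩ ⟨c', hc'⟩
  exact Subtype.ext ((key c hc.1 hc.2).trans (key c' hc'.1 hc'.2).symm)

end PetersenFragment

/-! ### Graphs and maps -/

theorem eq_of_sameCycle_three {H : Type} [Finite H] {τ : Equiv.Perm H} {x y : H}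
    (h : τ (τ (τ x)) = x) (hxy : τ.SameCycle x y) : y = x ∨ y = τ x ∨ y = τ (τ x) := by
  obtain ⟨n, rfl⟩ := hxy.exists_nat_pow_eq
  clear hxy
  induction n with
  | zero => exact Or.inl rfl
  | succ n ih =>
    rw [pow_succ', Equiv.Perm.mul_apply]
    rcases ih with h1 | h1 | h1 <;> rw [h1]
    · exact Or.inr (Or.inl rfl)
    · exact Or.inr (Or.inr rfl)
    · exact Or.inl h

theorem card_orbit_three {H : Type} [Finite H] {τ : Equiv.Perm H} {x : H} (h1 : τ x ≠ x)
    (h : τ (τ (τ x)) = x) : Nat.card {y // orbitMk τ y = orbitMk τ x} = 3 := by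
  have h2 : τ (τ x) ≠ x := fun h2 => h1 (by rw [← h2, h, h2])
  have h3 : {y | orbitMk τ y = orbitMk τ x} = {x, τ x, τ (τ x)} := by
    ext y
    simp only [Set.mem_ofPred_eq, Set.mem_insert_iff, Set.mem_singleton_iff]
    constructor
    · exact fun hy => eq_of_sameCycle_three h (orbitMk_eq.1 hy.symm)
    · rintro (rfl | rfl | rfl)
      · rfl
      · exact orbitMk_apply _ _
      · rw [orbitMk_apply, orbitMk_apply]
  change Nat.card {y | orbitMk τ y = orbitMk τ x} = 3
  rw [h3, Nat.card_coe_set_eq, Set.ncard_eq_three]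
  exact ⟨_, _, _, h1.symm, h2.symm, fun h4 => h1 (τ.injective h4.symm), rfl⟩

/-- On the sphere, an edge with the same face on both sides is a cut. -/
theorem CombMap.Plane.exists_bridge_cut {M : CombMap} (hP : M.Plane) (hM : M.Conn) {e : M.H}
    (he : M.φ.SameCycle e (M.α e)) : ∃ g : M.H → ZMod 2, (∀ x, g (M.σ x) = g x) ∧
      (∀ x, ¬ (x = e ∨ x = M.α e) → g (M.α x) = g x) ∧ g (M.α e) ≠ g e := by
  classical
  have := Fintype.ofFinite M.H
  obtain ⟨g, hg, hw⟩ := hP.exists_cut hM (fun x => if x = e then 1 else 0) (by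
    intro f hf
    simp only [ite_mul, one_mul, zero_mul, Finset.sum_ite_eq', Finset.mem_univ, if_true]
    rw [eq_of_sameCycle hf he, zmod_two_add_self])
  refine ⟨g, hg, fun z hz => ?_, fun h => ?_⟩
  · have h2 := hw z
    have h4 : M.α z ≠ e := fun h4 => hz (Or.inr (by rw [← h4, CombMap.α_α]))
    rw [if_neg fun h3 => hz (Or.inl h3), if_neg h4, add_zero] at h2
    exact (zmod_two_eq_of_add h2).symm
  · have h2 := hw e
    rw [if_pos rfl, if_neg (M.ne e), add_zero, h, zmod_two_add_self] at h2
    exact zero_ne_one h2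

namespace HalfEdgeGraph

variable {G : HalfEdgeGraph}

/-- The combinatorial map of a graph with a rotation system. -/
def Rotation.toMap (R : G.Rotation) : CombMap where
  H := G.H
  σ := R.next
  α := G.opp
  invol := G.opp_invol
  ne := G.opp_ne

theorem vert_next (R : G.Rotation) (x : G.H) : G.vert (R.next x) = G.vert x :=
  ((R.sameCycle_iff _ _).1 (Equiv.Perm.sameCycle_apply_left.2 (Equiv.Perm.SameCycle.refl _ _)))

/-- A function on the half-edges that is constant on the vertices and on the edges off `S` is
constant along walks that avoid `S`. -/
theorem ReachableWithout.eq {S : Set G.H} {A : Type*} {g : G.H → A}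
    (hg : ∀ x y, G.vert x = G.vert y → g x = g y) (hS : ∀ x, x ∉ S → g (G.opp x) = g x)
    {u w : G.V} (h : G.ReachableWithout S u w) :
    ∀ x y, G.vert x = u → G.vert y = w → g x = g y := by
  induction h with
  | refl => exact fun x y hx hy => hg x y (hx.trans hy.symm)
  | tail _ h2 ih =>
    obtain ⟨z, hz, hz1, hz2⟩ := h2
    intro x y hx hy
    rw [ih x z hx hz1, ← hS z hz, hg _ y (hz2.trans hy.symm)]

theorem vert_surjective_of_degree_pos (h : ∀ u, G.degree u ≠ 0) : Function.Surjective G.vert := by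
  intro u
  by_contra hu
  push Not at hu
  exact h u (Nat.card_eq_zero.2 (Or.inl ⟨fun x => hu x.1 x.2⟩))

namespace Rotation

variable {R : G.Rotation}

theorem toMap_eq_of_vert {A : Type*} {g : G.H → A} (hg : ∀ x, g (R.next x) = g x) (x y : G.H)
    (h : G.vert x = G.vert y) : g x = g y :=
  eq_of_sameCycle hg ((R.sameCycle_iff x y).2 h)

theorem cycleCount_next (hv : Function.Surjective G.vert) (R : G.Rotation) :
    cycleCount R.next = Nat.card G.V := by
  refine Nat.card_congr (Equiv.ofBijective (Quotient.lift (s := Equiv.Perm.SameCycle.setoid R.next)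
    G.vert fun x y h => (R.sameCycle_iff x y).1 h) ⟨?_, ?_⟩)
  · intro p q h
    induction p using Quotient.inductionOn with | h x => ?_
    induction q using Quotient.inductionOn with | h y => ?_
    exact Quotient.sound ((R.sameCycle_iff x y).2 h)
  · intro u
    obtain ⟨x, rfl⟩ := hv u
    exact ⟨Quotient.mk _ x, rfl⟩

theorem toMap_plane (hv : Function.Surjective G.vert) (hR : R.IsPlane) : R.toMap.Plane := by
  unfold CombMap.Plane
  have h1 : cycleCount R.toMap.σ = Nat.card G.V := cycleCount_next hv R
  rw [h1]
  exact hR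

theorem toMap_conn (hG : G.Connected) : R.toMap.Conn :=
  fun _ hσ hα x y => (hG.2 (G.vert x) (G.vert y)).eq (toMap_eq_of_vert hσ) (fun z _ => hα z)
    x y rfl rfl

/-- A plane map that is 2-edge-connected has different faces on the two sides of every edge: an
edge with the same face on both sides would be a cut. -/
theorem toMap_bridgeless (hv : Function.Surjective G.vert) (hR : R.IsPlane)
    (hG : G.TwoEdgeConnected) : R.toMap.Bridgeless := by
  intro (h : G.H) hh
  obtain ⟨g, hg, hα, hne⟩ := (toMap_plane hv hR).exists_bridge_cut (toMap_conn hG.1) hh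
  have h1 := (hG.2 h (G.vert h) (G.vert (G.opp h))).eq (toMap_eq_of_vert hg) (fun z hz => hα z hz)
    h (G.opp h) rfl rfl
  exact hne h1.symm

theorem next_cubic (R : G.Rotation) {x : G.H} (hx : G.degree (G.vert x) = 3) :
    R.next x ≠ x ∧ R.next (R.next (R.next x)) = x := by
  have hset : {y | G.vert y = G.vert x} = {y | R.next.SameCycle x y} := by
    ext y
    rw [Set.mem_ofPred_eq, Set.mem_ofPred_eq, R.sameCycle_iff, eq_comm]
  have hcard : {y | R.next.SameCycle x y}.ncard = 3 := by rw [← hset]; exact hx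
  have key : ∀ S : Set G.H, x ∈ S → (∀ y ∈ S, R.next y ∈ S) → 3 ≤ S.ncard := by
    intro S hS h
    rw [← hcard]
    refine Set.ncard_le_ncard ?_
    intro y hy
    obtain ⟨n, rfl⟩ := Equiv.Perm.SameCycle.exists_nat_pow_eq hy
    clear hy
    induction n with
    | zero => exact hS
    | succ n ih =>
      rw [pow_succ', Equiv.Perm.mul_apply]
      exact h _ ih
  have h1 : R.next x ≠ x := by
    intro h
    have := key {x} rfl (by rintro _ rfl; exact h)
    rw [Set.ncard_singleton] at this
    omega
  have h2 : R.next (R.next x) ≠ x := by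
    intro h
    have := key {x, R.next x} (Or.inl rfl) (by
      rintro _ (rfl | rfl)
      · exact Or.inr rfl
      · exact Or.inl h)
    rw [Set.ncard_pair h1.symm] at this
    omega
  refine ⟨h1, ?_⟩
  have h3 : ({x, R.next x, R.next (R.next x)} : Set G.H).ncard = 3 :=
    Set.ncard_eq_three.2 ⟨_, _, _, h1.symm, h2.symm, fun h => h1 (R.next.injective h.symm), rfl⟩
  have h4 : ({x, R.next x, R.next (R.next x)} : Set G.H) = {y | R.next.SameCycle x y} := by
    refine Set.eq_of_subset_of_ncard_le ?_ (by rw [hcard, h3])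
    rintro _ (rfl | rfl | rfl)
    · exact Equiv.Perm.SameCycle.refl _ _
    · exact Equiv.Perm.sameCycle_apply_right.2 (Equiv.Perm.SameCycle.refl _ _)
    · exact Equiv.Perm.sameCycle_apply_right.2
        (Equiv.Perm.sameCycle_apply_right.2 (Equiv.Perm.SameCycle.refl _ _))
  have h5 : R.next (R.next (R.next x)) ∈ ({x, R.next x, R.next (R.next x)} : Set G.H) := by
    rw [h4]
    exact Equiv.Perm.sameCycle_apply_right.2 (Equiv.Perm.sameCycle_apply_right.2
        (Equiv.Perm.sameCycle_apply_right.2 (Equiv.Perm.SameCycle.refl _ _)))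
  rcases h5 with h5 | h5 | h5
  · exact h5
  · exact absurd (R.next.injective h5) h2
  · exact absurd (R.next.injective (R.next.injective h5)) h1

end Rotation

/-- A graph that satisfies the hypotheses but not the conclusion of the four color theorem in Tait's
form gives a counterexample among maps. -/
theorem exists_isCounterexample (hP : G.IsPlanar) (hC : G.IsCubic) (hG : G.TwoEdgeConnected)
    (hcol : ¬ G.ThreeEdgeColorable) : ∃ M : CombMap, M.IsCounterexample := by
  obtain ⟨R, hR⟩ := hP
  have hv : Function.Surjective G.vert := vert_surjective_of_degree_pos fun u => by
    rw [hC u]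
    norm_num
  have hcub : ∀ x, R.next x ≠ x ∧ R.next (R.next (R.next x)) = x := fun x => R.next_cubic (hC _)
  refine ⟨R.toMap, Rotation.toMap_conn hG.1, Rotation.toMap_plane hv hR,
    Rotation.toMap_bridgeless hv hR hG, fun x => ⟨(hcub x).1, Or.inr (hcub x).2⟩, ?_⟩
  rintro ⟨c, hc, hp⟩
  have hne : ∀ x, c (R.next x) ≠ c x := fun x => (hp x).2 fun h => (hcub x).1 (by
    have := (hcub x).2
    rw [show R.next (R.next x) = x from h] at this
    exact this)
  refine hcol ⟨⟨c, hc⟩, ?_⟩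
  rintro u x y rfl hy hxy
  rcases eq_of_sameCycle_three (hcub x).2 ((R.sameCycle_iff x y).2 hy.symm) with rfl | rfl | rfl
  · exact absurd rfl hxy
  · exact (hne x).symm
  · have := hne (R.next (R.next x))
    rwa [(hcub x).2] at this

end HalfEdgeGraph

namespace CombMap

variable {M : CombMap}

/-- The graph of a map. -/
def toGraph (M : CombMap) : HalfEdgeGraph where
  V := Quotient (Equiv.Perm.SameCycle.setoid M.σ)
  H := M.H
  vert := orbitMk M.σ
  opp := M.α
  opp_invol := M.invol
  opp_ne := M.ne

/-- The rotation system of a map. -/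
def rotation (M : CombMap) : M.toGraph.Rotation where
  next := M.σ
  sameCycle_iff _ _ := orbitMk_eq.symm

theorem Plane.rotation_isPlane (h : M.Plane) : M.rotation.IsPlane := h

/-- A graph in which every cut contains an edge off `S` is connected off `S`. -/
theorem reachableWithout_of_cuts {S : Set M.H} (hS : ∀ x, x ∈ S → M.α x ∈ S)
    (h : ∀ g : M.H → ZMod 2, (∀ x, g (M.σ x) = g x) → (∀ x, x ∉ S → g (M.α x) = g x) →
      ∀ a b, g a = g b) (u w : M.toGraph.V) : M.toGraph.ReachableWithout S u w := by
  classical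
  obtain ⟨a, rfl⟩ := orbitMk_surjective _ u
  obtain ⟨b, rfl⟩ := orbitMk_surjective _ w
  have h1 := h (fun x => if M.toGraph.ReachableWithout S (orbitMk M.σ a) (orbitMk M.σ x) then 1
    else 0) (fun x => by simp only [orbitMk_apply]) (fun x hx => ?_) a b
  · have h0 : M.toGraph.ReachableWithout S (orbitMk M.σ a) (orbitMk M.σ a) :=
      Relation.ReflTransGen.refl
    rw [if_pos h0] at h1
    by_contra h2
    rw [if_neg h2] at h1
    exact one_ne_zero h1
  · have h2 : ∀ y, y ∉ S → M.toGraph.ReachableWithout S (orbitMk M.σ a) (orbitMk M.σ y) →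
        M.toGraph.ReachableWithout S (orbitMk M.σ a) (orbitMk M.σ (M.α y)) :=
      fun y hy hr => hr.tail ⟨y, hy, rfl, rfl⟩
    have h3 := h2 (M.α x) (fun h3 => hx (by simpa using hS _ h3))
    rw [α_α] at h3
    have h4 := h2 x hx
    simp only [show _ ↔ _ from ⟨h3, h4⟩]

theorem Conn.toGraph_connected [hne : Nonempty M.H] (h : M.Conn) : M.toGraph.Connected :=
  ⟨⟨orbitMk M.σ hne.some⟩, reachableWithout_of_cuts (S := ∅) (fun _ hx => hx.elim)
    fun g h1 h2 => h g h1 fun x => h2 x id⟩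

variable {k : ℕ} [NeZero k] {x : Fin k → M.H}

/-- The contraction of a face cycle to the distinguished vertex of a near-cubic graph. Its colorings
are the colorings of the map outside the face. The face is traced in the direction opposite to
the rotation at the new vertex, so that the numbering is reversed. -/
theorem exists_nearCubicGraph (hM : M.Conn) (hP : M.Plane) (hB : M.Bridgeless) (hC : M.Cubic)
    (hx : M.IsFaceCycle x) : ∃ N : NearCubicGraph k, N.IsPlane ∧
      (∀ c, N.IsThreeEdgeColoring c →
        ∃ c', M.IsOutsideColoring x c' ∧ ∀ i, c' (M.σ (x i)) = c.1 (N.spoke (-i))) ∧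
      ∀ c', M.IsOutsideColoring x c' →
        ∃ c, N.IsThreeEdgeColoring c ∧ ∀ i, c.1 (N.spoke (-i)) = c' (M.σ (x i)) := by
  obtain ⟨N, ι, hN⟩ := exists_contract hx hB hC
  obtain ⟨t, ht, hσt⟩ := exists_spokes hx hB hC hN
  have htinj : Function.Injective t := fun i j h => hx.inj (M.σ.injective (by rw [← ht, h, ht]))
  have : Nonempty N.H := ⟨t 0⟩
  have horb : ∀ i, orbitMk N.σ (t i) = orbitMk N.σ (t 0) :=
    fin_const fun i => by rw [← hσt, orbitMk_apply]
  have horb' : ∀ y, orbitMk N.σ y = orbitMk N.σ (t 0) → ∃ i, t i = y := by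
    intro y hy
    have := eq_of_sameCycle (τ := N.σ) (f := fun y => ∃ i, t i = y) (fun y => propext ⟨?_, ?_⟩)
      (orbitMk_eq.1 hy)
    · rw [this]
      exact ⟨0, rfl⟩
    · rintro ⟨i, hi⟩
      exact ⟨i + 1, N.σ.injective (by rw [hσt, add_sub_cancel_right, hi])⟩
    · rintro ⟨i, rfl⟩
      exact ⟨i - 1, (hσt i).symm⟩
  -- away from the new vertex the rotation is that of the original map
  have hσ : ∀ y, orbitMk N.σ y ≠ orbitMk N.σ (t 0) → ι (N.σ y) = M.σ (ι y) := by
    intro y hy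
    rw [hN.σ_eq, contractσ_of_ne hx hC (hN.mem y)]
    intro i hi
    refine hy ?_
    rw [← ht] at hi
    rw [hN.inj hi, horb]
  have hcub : ∀ y, orbitMk N.σ y ≠ orbitMk N.σ (t 0) → N.σ y ≠ y ∧ N.σ (N.σ (N.σ y)) = y := by
    intro y hy
    refine ⟨fun h => (hC (ι y)).1 (by rw [← hσ y hy, h]), hN.inj ?_⟩
    rw [hσ _ (by rwa [orbitMk_apply, orbitMk_apply]), hσ _ (by rwa [orbitMk_apply]), hσ y hy,
      (hC _).2]
  let e : Fin k ≃ {y : N.H // orbitMk N.σ y = orbitMk N.σ (t 0)} :=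
    Equiv.ofBijective (fun i => ⟨t (-i), horb _⟩)
      ⟨fun i j h => neg_injective (htinj (congrArg Subtype.val h)), fun y => by
        obtain ⟨i, hi⟩ := horb' y.1 y.2
        exact ⟨-i, Subtype.ext (by dsimp only; rw [neg_neg, hi])⟩⟩
  let G : NearCubicGraph k :=
    { G := N.toGraph
      v := orbitMk N.σ (t 0)
      ν := e.symm
      connected := (contract_conn hM hx hC hN ht hσt).toGraph_connected
      cubic := by
        intro u hu
        obtain ⟨y, rfl⟩ := orbitMk_surjective _ u
        exact card_orbit_three (hcub y hu).1 (hcub y hu).2 }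
  have hspoke : ∀ i, G.spoke (-i) = t i := fun i => by
    change t (-(-i)) = t i
    rw [neg_neg]
  refine ⟨G, ⟨N.rotation, contract_plane hM hP hB hC hx hN ht hσt, fun i => ?_⟩, fun c hc => ?_,
    fun c' hc' => ?_⟩
  · change N.σ (t (-i)) = t (-(finRotate k i))
    rw [hσt, finRotate_apply, neg_add']
  · have e0 : ∀ y, Function.extend ι c.1 0 (ι y) = c.1 y := fun y => hN.inj.extend_apply _ _ _
    have e1 : ∀ y, M.OnCycle x y → Function.extend ι c.1 0 y = 0 := fun y hy =>
      Function.extend_apply' _ _ _ fun ⟨z, hz⟩ => hN.mem z (hz ▸ hy)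
    refine ⟨Function.extend ι c.1 0, ⟨fun y => ?_, fun y hy => ?_⟩, fun i => ?_⟩
    · by_cases hy : M.OnCycle x y
      · rw [e1 y hy, e1 _ ((onCycle_α y).2 hy)]
      · obtain ⟨z, rfl⟩ := hN.surj y hy
        rw [← hN.α_eq, e0, e0]
        exact c.2 z
    · obtain ⟨z, rfl⟩ := hN.surj y (by
        rintro ⟨i, hi | hi⟩
        · exact (hy i).1 hi
        · exact (hy (i + 1)).2.1 (by rw [hi, hx.step]))
      have hz : orbitMk N.σ z ≠ orbitMk N.σ (t 0) := by
        intro hz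
        obtain ⟨i, rfl⟩ := horb' z hz
        exact (hy i).2.2 (by rw [ht, (hC _).2])
      rw [← hσ z hz, e0, e0]
      exact hc _ hz _ _ (orbitMk_apply _ _) rfl (hcub z hz).1
    · rw [hspoke, ← ht, e0]
  · refine ⟨⟨fun y => c' (ι y), fun y => ?_⟩, fun u hu y z hy hz hyz => ?_, fun i => ?_⟩
    · exact (congrArg c' (hN.α_eq y)).trans (hc'.1 (ι y))
    · have key : ∀ y, orbitMk N.σ y = u → c' (ι (N.σ y)) ≠ c' (ι y) := by
        rintro y rfl
        have off : ∀ z i, ι z ≠ x i := fun z i h => hN.mem z ⟨i, Or.inl h⟩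
        rw [hσ y hu]
        refine hc'.2 _ fun i => ⟨off y i, ?_, ?_⟩
        · rw [← hσ y hu]
          exact off _ i
        · rw [← hσ y hu, ← hσ _ (by rwa [orbitMk_apply])]
          exact off _ i
      have hy' : orbitMk N.σ y = u := hy
      have hz' : orbitMk N.σ z = u := hz
      have h3 := (hcub y (by rwa [hy'])).2
      rcases eq_of_sameCycle_three h3 (orbitMk_eq.1 (hy'.trans hz'.symm)) with rfl | rfl | rfl
      · exact absurd rfl hyz
      · exact (key y hy').symm
      · have := key _ hz'
        rwa [h3] at this
    · rw [hspoke]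
      exact congrArg c' (ht i)

end CombMap

/-! ### Short faces of a minimal counterexample -/

theorem CycleExtends.neg {k : ℕ} [NeZero k] {ψ : Fin k → Fin 3} (h : CycleExtends ψ) :
    CycleExtends fun i => ψ (-i) := by
  obtain ⟨r, hr⟩ := h
  refine ⟨fun i => r (-(i + 1)), fun i => ?_⟩
  have h1 := hr (-(i + 1))
  have h2 := (hr (-(i + 1 + 1))).2.2
  have e : ∀ i : Fin k, -(i + 1) + 1 = -i := fun i => by rw [neg_add, neg_add_cancel_right]
  rw [e] at h1 h2
  exact ⟨h1.2.1, h1.1, h2.symm⟩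

theorem OddColors.neg {ψ : Fin 5 → Fin 3} (h : OddColors ψ) : OddColors fun i => ψ (-i) := by
  intro c
  have h1 := Equiv.sum_comp (Equiv.neg (Fin 5)) fun i => if ψ i = c then 1 else 0
  exact (congrArg (· % 2) h1).trans (h c)

/-- The spokes of a pentagon whose edge `0` is deleted: the coloring `r` of the remaining path
determines the colors of the spokes, and each of the three occurs an odd number of times. -/
theorem oddColors_five {ψ r : Fin 5 → Fin 3} (h0 : ψ 0 = r (-1)) (h1 : ψ 1 = r 1)
    (h : ∀ i, i ≠ 0 → i ≠ 1 → ψ i ≠ r i ∧ r (i - 1) ≠ ψ i ∧ r i ≠ r (i - 1)) :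
    OddColors ψ := by
  have h2 := h 2 (by decide) (by decide)
  have h3 := h 3 (by decide) (by decide)
  have h4 := h 4 (by decide) (by decide)
  have key : ∀ x₁ x₂ x₃ x₄ : Fin 3, x₂ ≠ x₁ → x₃ ≠ x₂ → x₄ ≠ x₃ →
      OddColors ![x₄, x₁, -(x₁ + x₂), -(x₂ + x₃), -(x₃ + x₄)] := by
    unfold OddColors
    decide
  have e : ψ = ![r 4, r 1, -(r 1 + r 2), -(r 2 + r 3), -(r 3 + r 4)] := by
    rw [← vec_five ψ, h0, h1, fin_three_eq_third h2.2.2.symm h2.2.1 h2.1.symm,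
      fin_three_eq_third h3.2.2.symm h3.2.1 h3.1.symm,
      fin_three_eq_third h4.2.2.symm h4.2.1 h4.1.symm]
    rfl
  rw [e]
  exact key _ _ _ _ h2.2.2 h3.2.2 h4.2.2

/-- The colors of the spokes of a 4-cycle whose edge `0` is deleted, in terms of the coloring `r` of
the remaining path. -/
theorem fin_four_path {ψ r : Fin 4 → Fin 3} (h0 : ψ 0 = r (-1)) (h1 : ψ 1 = r 1)
    (h : ∀ i, i ≠ 0 → i ≠ 1 → ψ i ≠ r i ∧ r (i - 1) ≠ ψ i ∧ r i ≠ r (i - 1)) :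
    r 1 ≠ r 2 ∧ r 2 ≠ r 3 ∧ ψ = ![r 3, r 1, -(r 1 + r 2), -(r 2 + r 3)] := by
  have h2 := h 2 (by decide) (by decide)
  have h3 := h 3 (by decide) (by decide)
  refine ⟨h2.2.2.symm, h3.2.2.symm, ?_⟩
  funext i
  fin_cases i
  · exact h0
  · exact h1
  · exact fin_three_eq_third h2.2.2.symm h2.2.1 h2.1.symm
  · exact fin_three_eq_third h3.2.2.symm h3.2.1 h3.1.symm

theorem cycleExtends_two {ψ r : Fin 2 → Fin 3} (h0 : ψ 0 = r (-1)) (h1 : ψ 1 = r 1) :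
    CycleExtends ψ := by
  have h2 : ψ = ![r 1, r 1] := by
    funext i
    fin_cases i
    · exact h0
    · exact h1
  rw [h2]
  generalize r 1 = a
  exact ⟨![a + 1, a + 2], by revert a; decide⟩

theorem cycleExtends_three {ψ r : Fin 3 → Fin 3} (h0 : ψ 0 = r (-1)) (h1 : ψ 1 = r 1)
    (h : ∀ i, i ≠ 0 → i ≠ 1 → ψ i ≠ r i ∧ r (i - 1) ≠ ψ i ∧ r i ≠ r (i - 1)) :
    CycleExtends ψ := by
  have h2 := h 2 (by decide) (by decide)
  have h01 : ψ 0 ≠ ψ 1 := by rw [h0, h1]; exact h2.2.2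
  have h02 : ψ 0 ≠ ψ 2 := by rw [h0]; exact h2.1.symm
  have h12 : ψ 1 ≠ ψ 2 := by rw [h1]; exact h2.2.1
  refine ⟨![ψ 2, ψ 0, ψ 1], fun i => ?_⟩
  fin_cases i
  · exact ⟨h02.symm, h12.symm, h02.symm⟩
  · exact ⟨h01, h02, h01⟩
  · exact ⟨h12, h01.symm, h12⟩

theorem cycleExtends_four {x y : Fin 3} (hxy : x ≠ y) :
    CycleExtends ![x, x, -(x + y), -(x + y)] :=
  ⟨![-(x + y), y, x, y], by revert x y; decide⟩

/-- If the colors of the spokes of a 4-cycle alternate, exchanging the two colors at one spoke and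
any other one makes the coloring extend to the cycle. -/
theorem cycleExtends_four_switch {x z : Fin 3} (hxz : x ≠ z) {j : Fin 4} (hj : j ≠ 0) :
    CycleExtends fun i : Fin 4 =>
      if -i = 0 ∨ -i = j then Equiv.swap x z (![z, x, z, x] i) else ![z, x, z, x] i := by
  unfold CycleExtends
  revert x z j
  decide

namespace NearCubicGraph

section Five

variable {N : NearCubicGraph 5}

theorem colorCount_le_perm (N : NearCubicGraph 5) (π : Equiv.Perm (Fin 3)) (f : Fin 5 → Fin 3) :
    N.colorCount f ≤ N.colorCount (π ∘ f) := by
  have : Finite N.G.EdgeColoring := inferInstanceAs (Finite {c : N.G.H → Fin 3 // _})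
  refine Nat.card_le_card_of_injective (fun c => ⟨⟨fun h => π (c.1.1 h), fun h =>
    congrArg π (c.1.2 h)⟩, fun u hu x y hx hy hxy => π.injective.ne (c.2.1 u hu x y hx hy hxy),
    fun i => congrArg π (c.2.2 i)⟩) ?_
  intro c c' h
  refine Subtype.ext (Subtype.ext (funext fun x => π.injective ?_))
  exact congrFun (congrArg (fun c => c.1.1) h) x

theorem colorCount_perm (N : NearCubicGraph 5) (π : Equiv.Perm (Fin 3)) (f : Fin 5 → Fin 3) :
    N.colorCount (π ∘ f) = N.colorCount f := by
  refine le_antisymm ?_ (N.colorCount_le_perm π f)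
  have := N.colorCount_le_perm π⁻¹ (π ∘ f)
  rwa [← Function.comp_assoc, ← Equiv.Perm.coe_mul, inv_mul_cancel, Equiv.Perm.coe_one,
    Function.id_comp] at this

/-- Exchanging the single color `a` at `p` with the color `c` at `j` moves the single color to
`j`. -/
theorem switch_twoSingles : ∀ (p j : Fin 5) (a b c : Fin 3), a ≠ b → a ≠ c → b ≠ c → j ≠ p →
    j ≠ p + 2 → ∀ m, (if m = p ∨ m = j then Equiv.swap a c (twoSingles p (p + 2) a b c m)
      else twoSingles p (p + 2) a b c m) = twoSingles j (p + 2) a b c m := by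
  unfold twoSingles
  decide

/-- If no coloring extends to the pentagon, then Kempe chains move a single color to the position
at distance two on the other side of the other single color, since every other outcome of the
switch would extend to the pentagon. -/
theorem colorCount_le_shift (hN : ∀ c, N.IsThreeEdgeColoring c →
    ¬ CycleExtends fun i => c.1 (N.spoke i)) (p : Fin 5) {a b c : Fin 3} (hab : a ≠ b)
    (hac : a ≠ c) (hbc : b ≠ c) :
    N.colorCount (twoSingles p (p + 2) a b c) ≤
      N.colorCount (twoSingles (p + 4) (p + 2) a b c) := by
  have : Finite N.G.EdgeColoring := inferInstanceAs (Finite {c : N.G.H → Fin 3 // _})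
  have key : ∀ e : N.G.EdgeColoring, N.IsThreeEdgeColoring e →
      (∀ i, e.1 (N.spoke i) = twoSingles p (p + 2) a b c i) →
      ∀ i, (N.kempeSwitch a c (N.spoke p) e).1 (N.spoke i) =
        twoSingles (p + 4) (p + 2) a b c i := by
    intro e he hf
    obtain ⟨f0, -, f2, -, -⟩ := twoSingles_values p a b c
    obtain ⟨j, hjp, hj, hm⟩ := exists_kempeSwitch_spoke he hac (i := p)
      (Or.inl (by rw [hf, f0]))
    have hj2 : j ≠ p + 2 := by
      rintro rfl
      rw [hf, f2] at hj
      exact hj.elim hab.symm hbc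
    have h1 : ∀ i, (N.kempeSwitch a c (N.spoke p) e).1 (N.spoke i) =
        twoSingles j (p + 2) a b c i := by
      intro i
      rw [hm, hf]
      exact switch_twoSingles p j a b c hab hac hbc hjp hj2 i
    have h2 := hN _ (isThreeEdgeColoring_kempeSwitch (a := a) (b := c) (s := N.spoke p) he)
    simp only [h1] at h2
    have h3 : ∀ p j : Fin 5, j ≠ p → j ≠ p + 2 → j = p + 4 ∨ j = p + 2 + 1 ∨ p + 2 = j + 1 := by
      decide
    rcases h3 p j hjp hj2 with rfl | rfl | h4
    · exact h1
    · refine absurd ?_ h2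
      change CycleExtends (twoSingles _ _ _ _ _)
      rw [twoSingles_comm hj2]
      exact cycleExtends_twoSingles hab.symm hbc hac
    · refine absurd ?_ h2
      change CycleExtends (twoSingles _ _ _ _ _)
      rw [h4]
      exact cycleExtends_twoSingles hab hac hbc
  refine Nat.card_le_card_of_injective (fun e => ⟨N.kempeSwitch a c (N.spoke p) e.1,
    isThreeEdgeColoring_kempeSwitch e.2.1, key e.1 e.2.1 e.2.2⟩) ?_
  intro e e' h
  have h1 := congrArg (fun e => N.kempeSwitch a c (N.spoke p) e.1) h
  simp only [kempeSwitch_kempeSwitch e.2.1, kempeSwitch_kempeSwitch e'.2.1] at h1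
  exact Subtype.ext h1

/-- Repeated shifts move the pair of single colors around the pentagon, and permutations of the
colors do not change the count, so that all patterns that do not extend have the same count. -/
theorem colorCount_twoSingles (hN : ∀ c, N.IsThreeEdgeColoring c →
    ¬ CycleExtends fun i => c.1 (N.spoke i)) (p : Fin 5) {a b c : Fin 3} (hab : a ≠ b)
    (hac : a ≠ c) (hbc : b ≠ c) :
    N.colorCount (twoSingles p (p + 2) a b c) = N.colorCount (twoSingles 0 2 0 1 2) := by
  have hperm : ∀ (π : Equiv.Perm (Fin 3)) (p q : Fin 5) (a b c : Fin 3),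
      N.colorCount (twoSingles p q (π a) (π b) (π c)) = N.colorCount (twoSingles p q a b c) := by
    intro π p q a b c
    rw [← N.colorCount_perm π (twoSingles p q a b c)]
    congr 1
    funext i
    simp only [twoSingles, Function.comp_apply, apply_ite π]
  have step : ∀ p : Fin 5, N.colorCount (twoSingles p (p + 2) 0 1 2) ≤
      N.colorCount (twoSingles (p + 2) (p + 2 + 2) 0 1 2) := by
    intro p
    refine (colorCount_le_shift hN p (by decide) (by decide) (by decide)).trans_eq ?_
    rw [twoSingles_comm (by revert p; decide), ← hperm (Equiv.swap 0 1), show p + 4 = p + 2 + 2 by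
      revert p; decide]
    rfl
  have hconst : ∀ p : Fin 5, N.colorCount (twoSingles p (p + 2) 0 1 2) =
      N.colorCount (twoSingles 0 2 0 1 2) := by
    -- the five inequalities form a cycle `0, 2, 4, 1, 3, 0`, so that they are equalities
    have h0 := step 0
    have h1 := step 1
    have h2 := step 2
    have h3 := step 3
    have h4 := step 4
    change _ ≤ N.colorCount (twoSingles 2 4 0 1 2) at h0
    change _ ≤ N.colorCount (twoSingles 3 0 0 1 2) at h1
    change _ ≤ N.colorCount (twoSingles 4 1 0 1 2) at h2
    change _ ≤ N.colorCount (twoSingles 0 2 0 1 2) at h3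
    change _ ≤ N.colorCount (twoSingles 1 3 0 1 2) at h4
    change N.colorCount (twoSingles 0 2 0 1 2) ≤ _ at h0
    change N.colorCount (twoSingles 1 3 0 1 2) ≤ _ at h1
    change N.colorCount (twoSingles 2 4 0 1 2) ≤ _ at h2
    change N.colorCount (twoSingles 3 0 0 1 2) ≤ _ at h3
    change N.colorCount (twoSingles 4 1 0 1 2) ≤ _ at h4
    intro p
    fin_cases p
    · rfl
    · change N.colorCount (twoSingles 1 3 0 1 2) = _
      omega
    · change N.colorCount (twoSingles 2 4 0 1 2) = _
      omega
    · change N.colorCount (twoSingles 3 0 0 1 2) = _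
      omega
    · change N.colorCount (twoSingles 4 1 0 1 2) = _
      omega
  have hinj : Function.Injective ![a, b, c] := by
    intro i j
    fin_cases i <;> fin_cases j <;> simp [hab, hac, hbc, hab.symm, hac.symm, hbc.symm]
  have := hperm (Equiv.ofBijective _ (Finite.injective_iff_bijective.1 hinj)) p (p + 2) 0 1 2
  rw [hconst] at this
  exact this

/-- If no coloring extends to the pentagon, then the numbers of extensions are proportional to those
of the Petersen fragment. -/
theorem extensionCount_mem_ray (hN : ∀ c, N.IsThreeEdgeColoring c →
    ¬ CycleExtends fun i => c.1 (N.spoke i)) : N.extensionCount ∈ petersenFragment.ray := by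
  refine ⟨N.colorCount (twoSingles 0 2 0 1 2), Nat.cast_nonneg _, funext fun ψ => ?_⟩
  rw [Pi.smul_apply, extensionCount_eq, extensionCount_eq, smul_eq_mul]
  by_cases h : CycleExtends ψ.1
  · have h1 : N.colorCount ψ.1 = 0 := by
      refine Nat.card_eq_zero.2 (Or.inl ⟨fun c => hN c.1 c.2.1 ?_⟩)
      simpa only [c.2.2] using h
    rw [h1, PetersenFragment.colorCount_eq_zero h, Nat.cast_zero, mul_zero]
  · obtain ⟨p, a, b, c, hab, hac, hbc, hψ⟩ := exists_twoSingles ((oddColors_iff _).2 ψ.2) h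
    rw [hψ, colorCount_twoSingles hN p hab hac hbc, PetersenFragment.colorCount_eq_one
      (existsUnique_isPentagramColoring p hab hac hbc), Nat.cast_one, mul_one]

theorem extensionCount_ne_zero {c : N.G.EdgeColoring} (hc : N.IsThreeEdgeColoring c)
    (h : OddColors fun i => c.1 (N.spoke i)) : N.extensionCount ≠ 0 := by
  have : Finite N.G.EdgeColoring := inferInstanceAs (Finite {c : N.G.H → Fin 3 // _})
  intro h0
  have h1 : (N.colorCount (fun i => c.1 (N.spoke i)) : ℝ) = 0 :=
    (N.extensionCount_eq ⟨_, (oddColors_iff _).1 h⟩).symm.trans (congrFun h0 _)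
  rw [Nat.cast_eq_zero, colorCount, Nat.card_eq_zero] at h1
  rcases h1 with h1 | h1
  · exact h1.elim ⟨c, hc, fun _ => rfl⟩
  · exact h1.not_finite inferInstance

end Five

end NearCubicGraph

namespace CombMap.IsMinimalCounterexample

variable {M : CombMap}

/-- The contraction of a short face of a minimal counterexample violates the criterion. A coloring
outside the face never extends to its boundary. As there is such a coloring, this is impossible for
faces of length at most four, so that the length is five. -/
theorem exists_nearCubicGraph (hM : M.IsMinimalCounterexample) : ∃ N : NearCubicGraph 5,
    N.IsPlane ∧ N.extensionCount ∈ petersenFragment.ray ∧ N.extensionCount ≠ 0 := by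
  have hC := hM.cubic
  have hB := hM.bridgeless
  obtain ⟨x₀, hx₀⟩ := hC.exists_short_face hM.plane
  obtain ⟨k, hk⟩ : ∃ k, Function.minimalPeriod M.φ x₀ = k := ⟨_, rfl⟩
  have hk0 : NeZero k := ⟨by
    rw [← hk]
    refine (Function.minimalPeriod_pos_of_mem_periodicPts ?_).ne'
    exact ⟨orderOf M.φ, orderOf_pos _, by
      rw [Function.IsPeriodicPt, Function.IsFixedPt, ← Equiv.Perm.coe_pow, pow_orderOf_eq_one]
      rfl⟩⟩
  obtain ⟨x, hx⟩ := exists_isFaceCycle hk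
  rw [hk] at hx₀
  obtain ⟨y, c, hy, hc, hψ0, hψ1, hψ⟩ := hM.exists_outside_coloring hx hx₀
  have hno : ∀ c, M.IsOutsideColoring y c → ¬ CycleExtends fun i => c (M.σ (y i)) :=
    fun c hc h => hM.not_colorable (hy.colorable hB hC hc h)
  obtain ⟨N, hNP, hN1, hN2⟩ := CombMap.exists_nearCubicGraph hM.conn hM.plane hB hC hy
  have hadj := hy.face_α_ne hB hC
  clear hx x hk
  have hk1 := NeZero.pos k
  interval_cases k
  -- the only edge of a face of length one would be a loop
  · exact absurd rfl (hadj 0)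
  · exact absurd (cycleExtends_two (r := fun i => c (y i)) hψ0 hψ1) (hno c hc)
  · exact absurd (cycleExtends_three (r := fun i => c (y i)) hψ0 hψ1 hψ) (hno c hc)
  · obtain ⟨h12, h23, e⟩ := fin_four_path (ψ := fun i => c (M.σ (y i))) (r := fun i => c (y i))
      hψ0 hψ1 hψ
    generalize c (y 1) = x at *
    generalize c (y 2) = w at *
    generalize c (y 3) = z at *
    have hc' := hno c hc
    rw [e] at hc'
    -- if `x ≠ z`, the colors of the spokes alternate, and a Kempe switch makes them extend
    rcases eq_or_ne x z with rfl | hxz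
    · rw [add_comm w] at hc'
      exact absurd (cycleExtends_four h12) hc'
    · rw [← fin_three_eq_third h12 hxz h23, add_comm w,
        ← fin_three_eq_third h23.symm hxz.symm h12.symm] at e
      obtain ⟨c₀, hc₀, hs⟩ := hN2 c hc
      have hs' : ∀ i, c₀.1 (N.spoke (-i)) = ![z, x, z, x] i := fun i =>
        (hs i).trans (congrFun e i)
      obtain ⟨j, hj, -, hm⟩ := NearCubicGraph.exists_kempeSwitch_spoke hc₀ hxz (i := 0)
        (Or.inr (by rw [← neg_zero, hs']; rfl))
      obtain ⟨c₂, hc₂, hs₂⟩ := hN1 _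
        (NearCubicGraph.isThreeEdgeColoring_kempeSwitch (a := x) (b := z) (s := N.spoke 0) hc₀)
      refine absurd ?_ (hno c₂ hc₂)
      simp only [hs₂, hm, hs']
      exact cycleExtends_four_switch hxz hj
  · refine ⟨N, hNP, ?_, ?_⟩
    · refine NearCubicGraph.extensionCount_mem_ray fun c₀ hc₀ h => ?_
      obtain ⟨c', hc', hs⟩ := hN1 c₀ hc₀
      refine hno c' hc' ?_
      simp only [hs]
      exact h.neg
    · obtain ⟨c₀, hc₀, hs⟩ := hN2 c hc
      refine NearCubicGraph.extensionCount_ne_zero hc₀ ?_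
      have h4 := (oddColors_five (ψ := fun i => c (M.σ (y i)))
        (r := fun i => c (y i)) hψ0 hψ1 hψ).neg
      simp only [← hs, neg_neg] at h4
      exact h4

end CombMap.IsMinimalCounterexample

/-! ### The expansion of the distinguished vertex to a pentagon -/

/-- The spoke between two edges of a colored pentagon has the third color, so that by the parity
lemma for the pentagon every color occurs an odd number of times on the spokes. -/
theorem CycleExtends.oddColors {f : Fin 5 → Fin 3} (h : CycleExtends f) : OddColors f := by
  obtain ⟨r, hr⟩ := h
  have key : ∀ x₀ x₁ x₂ x₃ x₄ : Fin 3, x₀ ≠ x₁ → x₁ ≠ x₂ → x₂ ≠ x₃ → x₃ ≠ x₄ → x₄ ≠ x₀ →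
      OddColors ![-(x₄ + x₀), -(x₀ + x₁), -(x₁ + x₂), -(x₂ + x₃), -(x₃ + x₄)] := by
    unfold OddColors
    decide
  have hf : ∀ i, f (i + 1) = -(r i + r (i + 1)) := fun i =>
    fin_three_eq_third (hr i).2.2 (hr i).2.1 (hr (i + 1)).1
  have e : f = ![-(r 4 + r 0), -(r 0 + r 1), -(r 1 + r 2), -(r 2 + r 3), -(r 3 + r 4)] := by
    funext i
    fin_cases i
    exacts [hf 4, hf 0, hf 1, hf 2, hf 3]
  rw [e]
  exact key _ _ _ _ _ (hr 0).2.2 (hr 1).2.2 (hr 2).2.2 (hr 3).2.2 (hr 4).2.2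

/-- A function on a pentagon that is constant along all edges but one is constant. -/
theorem eq_apply_zero_of_add_one {A : Type*} {u : Fin 5 → A} {j : Fin 5}
    (h : ∀ i, i ≠ j → u (i + 1) = u i) (i : Fin 5) : u i = u 0 := by
  have h1 : ∀ i, u i = u (j + 1) := by
    have n : ∀ j : Fin 5, j + 1 ≠ j ∧ j + 1 + 1 ≠ j ∧ j + 1 + 1 + 1 ≠ j ∧
      j + 1 + 1 + 1 + 1 ≠ j := by decide
    have hi : ∀ i j : Fin 5, i = j + 1 ∨ i = j + 1 + 1 ∨ i = j + 1 + 1 + 1 ∨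
      i = j + 1 + 1 + 1 + 1 ∨ i = j + 1 + 1 + 1 + 1 + 1 := by decide
    obtain ⟨n1, n2, n3, n4⟩ := n j
    have h1 := h _ n1
    have h2 := (h _ n2).trans h1
    have h3 := (h _ n3).trans h2
    have h4 := (h _ n4).trans h3
    intro i
    rcases hi i j with rfl | rfl | rfl | rfl | rfl
    exacts [rfl, h1, h2, h3, h4]
  rw [h1, h1 0]

namespace NearCubicGraph

theorem eq_spoke_or_ne {d : ℕ} (N : NearCubicGraph d) (h : N.G.H) :
    (∃ i, h = N.spoke i) ∨ N.G.vert h ≠ N.v := by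
  by_cases hh : N.G.vert h = N.v
  · exact Or.inl (exists_spoke hh)
  · exact Or.inr hh

/-- The parity lemma: a cut of a 3-edge-colored near-cubic graph does not consist of a single edge,
since on the side without `v` the three colors occur in the cut with the same parity. -/
theorem cut_eq {d : ℕ} [NeZero d] {N : NearCubicGraph d} {c : N.G.EdgeColoring}
    (hc : N.IsThreeEdgeColoring c) (R : N.G.Rotation) {x : N.G.H} {g : N.G.H → ZMod 2}
    (hg : ∀ h, g (R.next h) = g h) (hα : ∀ h, h ≠ x → h ≠ N.G.opp x → g (N.G.opp h) = g h) :
    g (N.G.opp x) = g x := by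
  classical
  have := Fintype.ofFinite N.G.H
  let g' : N.G.H → ZMod 2 := fun h => g h + g (N.spoke 0)
  have hv : ∀ h, N.G.vert h = N.v → g' h = 0 := fun h hh => by
    change g h + _ = 0
    rw [HalfEdgeGraph.Rotation.toMap_eq_of_vert hg h (N.spoke 0) (by rw [hh, vert_spoke]),
      zmod_two_add_self]
  have hg' : ∀ h, g' (R.next h) = g' h := fun h => by
    change g _ + _ = g _ + _
    rw [hg]
  let S : Fin 3 → ZMod 2 := fun k => ∑ h, g' h * if c.1 h = k then 1 else 0
  -- the sum over the half-edges of color `k`, rewritten by turning once and twice around each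
  -- vertex, is the sum over all half-edges, because at each vertex one of the three has color `k`
  have hS1 : ∀ k, S k = ∑ h, g' h * if c.1 (R.next h) = k then 1 else 0 := fun k =>
    (Equiv.sum_comp R.next fun h => g' h * if c.1 h = k then 1 else 0).symm.trans
      (Finset.sum_congr rfl fun h _ => by rw [hg'])
  have hS2 : ∀ k, S k = ∑ h, g' h * if c.1 (R.next (R.next h)) = k then 1 else 0 := fun k =>
    (hS1 k).trans
      ((Equiv.sum_comp R.next fun h => g' h * if c.1 (R.next h) = k then 1 else 0).symm.trans
        (Finset.sum_congr rfl fun h _ => by rw [hg']))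
  have hS : ∀ k, S k = ∑ h, g' h := by
    intro k
    have h3 : S k = S k + S k + S k := by rw [zmod_two_add_self, zero_add]
    rw [h3]
    nth_rw 2 [hS1]
    nth_rw 2 [hS2]
    rw [← Finset.sum_add_distrib, ← Finset.sum_add_distrib]
    refine Finset.sum_congr rfl fun h _ => ?_
    by_cases hh : N.G.vert h = N.v
    · rw [hv h hh]
      ring
    · obtain ⟨n1, n3⟩ := R.next_cubic (N.cubic _ hh)
      have v1 := HalfEdgeGraph.vert_next R h
      have v2 := (HalfEdgeGraph.vert_next R (R.next h)).trans v1
      have c1 := hc _ hh h (R.next h) rfl v1 n1.symm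
      have c2 := hc _ hh (R.next h) (R.next (R.next h)) v1 v2 fun e => n1 (R.next.injective e.symm)
      have c3 := hc _ hh h (R.next (R.next h)) rfl v2 fun e => by
        rw [← e] at n3
        exact n1 n3
      have key : ∀ a b c k : Fin 3, a ≠ b → b ≠ c → a ≠ c → (if a = k then (1 : ZMod 2) else 0) +
        (if b = k then 1 else 0) + (if c = k then 1 else 0) = 1 := by decide
      rw [← mul_add, ← mul_add, key _ _ _ _ c1 c2 c3, mul_one]
  have hT : ∀ k, S k = (g' x + g' (N.G.opp x)) * if c.1 x = k then 1 else 0 := by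
    intro k
    have h1 := sum_eq_sum_of_involutive N.G.opp_invol N.G.opp_ne {x, N.G.opp x} (fun y hy => by
      rw [Finset.mem_insert, Finset.mem_singleton] at hy ⊢
      rcases hy with hy | hy
      · exact Or.inr (by rw [← hy, N.G.opp_invol])
      · exact Or.inl (N.G.opp_invol.injective hy))
      (fun h => g' h * if c.1 h = k then 1 else 0) (fun y hy => by
        rw [Finset.mem_insert, Finset.mem_singleton, not_or] at hy
        change (g _ + _) * _ = (g _ + _) * _
        rw [hα y hy.1 hy.2, c.2])
    rw [Finset.sum_pair (N.G.opp_ne x).symm, c.2, ← add_mul] at h1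
    exact h1
  -- compare the color of the exceptional edge with another one
  have h1 := hT (c.1 x)
  have h2 := hT (c.1 x + 1)
  rw [hS, if_pos rfl, mul_one] at h1
  rw [hS, if_neg (by generalize c.1 x = a; revert a; decide), mul_zero, h1] at h2
  exact (add_right_cancel (zmod_two_eq_of_add h2)).symm

section Expand

variable (N : NearCubicGraph 5) (R : N.G.Rotation)

open Classical in
/-- The rotation of the graph in which the vertex `v` is expanded to a pentagon. The half-edges
`(i, false)` and `(i, true)` lead from the vertex `i` of the pentagon to the vertices `i + 1` and
`i - 1`. -/
noncomputable def expandTurn : N.G.H ⊕ Fin 5 × Bool → N.G.H ⊕ Fin 5 × Bool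
  | Sum.inl h => if hh : N.G.vert h = N.v then Sum.inr (N.ν ⟨h, hh⟩, false) else Sum.inl (R.next h)
  | Sum.inr (i, false) => Sum.inr (i, true)
  | Sum.inr (i, true) => Sum.inl (N.spoke i)

variable {N}

theorem expandTurn_spoke (i : Fin 5) :
    N.expandTurn R (Sum.inl (N.spoke i)) = Sum.inr (i, false) := by
  rw [expandTurn, dif_pos (vert_spoke i)]
  exact congrArg (fun j => Sum.inr (j, false)) (N.ν.apply_symm_apply i)

theorem expandTurn_of_ne {h : N.G.H} (hh : N.G.vert h ≠ N.v) :
    N.expandTurn R (Sum.inl h) = Sum.inl (R.next h) := dif_neg hh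

theorem expandTurn_cubic (x : N.G.H ⊕ Fin 5 × Bool) : N.expandTurn R x ≠ x ∧
    N.expandTurn R (N.expandTurn R (N.expandTurn R x)) = x := by
  have h1 : ∀ i, N.expandTurn R (Sum.inr (i, false)) = Sum.inr (i, true) := fun _ => rfl
  have h2 : ∀ i, N.expandTurn R (Sum.inr (i, true)) = Sum.inl (N.spoke i) := fun _ => rfl
  rcases x with h | ⟨i, _ | _⟩
  · rcases N.eq_spoke_or_ne h with ⟨i, rfl⟩ | hh
    · rw [expandTurn_spoke, h1, h2]
      exact ⟨Sum.inr_ne_inl, rfl⟩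
    · obtain ⟨n1, n3⟩ := R.next_cubic (N.cubic _ hh)
      have v1 := HalfEdgeGraph.vert_next R h
      have v2 := (HalfEdgeGraph.vert_next R (R.next h)).trans v1
      rw [expandTurn_of_ne R hh, expandTurn_of_ne R (by rwa [v1]), expandTurn_of_ne R (by rwa [v2]),
        n3]
      exact ⟨fun e => n1 (Sum.inl.inj e), rfl⟩
  · rw [h1, h2, expandTurn_spoke]
    exact ⟨by simp, rfl⟩
  · rw [h2, expandTurn_spoke, h1]
    exact ⟨Sum.inl_ne_inr, rfl⟩

variable (N)

/-- The cubic map in which the vertex `v` of a plane near-cubic graph is expanded to a pentagon. -/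
noncomputable def expand : CombMap where
  H := N.G.H ⊕ Fin 5 × Bool
  σ := ⟨N.expandTurn R, fun x => N.expandTurn R (N.expandTurn R x),
    fun x => (expandTurn_cubic R x).2, fun x => (expandTurn_cubic R x).2⟩
  α := Sum.map N.G.opp fun p => (if p.2 then p.1 - 1 else p.1 + 1, !p.2)
  invol := by
    rintro (h | ⟨i, _ | _⟩)
    · exact congrArg Sum.inl (N.G.opp_invol h)
    · exact congrArg (fun j => Sum.inr (j, false)) (add_sub_cancel_right i 1)
    · exact congrArg (fun j => Sum.inr (j, true)) (sub_add_cancel i 1)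
  ne := by
    rintro (h | ⟨i, _ | _⟩)
    · exact fun e => N.G.opp_ne h (Sum.inl.inj e)
    · simp
    · simp

variable {N R}

theorem expand_cubic : (N.expand R).Cubic := expandTurn_cubic R

/-- If a near-cubic graph has a coloring, the expanded graph is 2-edge-connected: a cut contains an
edge off any given edge `e`, because the pentagon minus an edge is connected and the parity lemma
excludes a cut of a single edge in the near-cubic graph. -/
theorem expand_cut_eq (hR : ∀ i, R.next (N.spoke i) = N.spoke (i + 1)) {c : N.G.EdgeColoring}
    (hc : N.IsThreeEdgeColoring c) (e : (N.expand R).H) (g : (N.expand R).H → ZMod 2)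
    (hσ : ∀ x, g ((N.expand R).σ x) = g x)
    (hα : ∀ x, x ∉ ({e, (N.expand R).α e} : Set (N.expand R).H) → g ((N.expand R).α x) = g x)
    (a b : (N.expand R).H) : g a = g b := by
  have f0 : ∀ i, g (Sum.inr (i, false)) = g (Sum.inl (N.spoke i)) := fun i => by
    rw [← hσ (Sum.inl _)]
    exact congrArg g (expandTurn_spoke R i).symm
  have f1 : ∀ i, g (Sum.inr (i, true)) = g (Sum.inl (N.spoke i)) := fun i =>
    (hσ (Sum.inr (i, true))).symm
  obtain ⟨j, x, hj, hx⟩ : ∃ (j : Fin 5) (x : N.G.H),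
      (∀ i, i ≠ j → Sum.inr (i, false) ∉ ({e, (N.expand R).α e} : Set (N.expand R).H)) ∧
      ∀ h, h ≠ x → h ≠ N.G.opp x → Sum.inl h ∉ ({e, (N.expand R).α e} : Set (N.expand R).H) := by
    rcases e with x | ⟨j, _ | _⟩
    · refine ⟨0, x, fun i _ h => ?_, fun h h1 h2 h3 => ?_⟩
      · rcases h with h | h <;> exact Sum.inr_ne_inl h
      · rcases h3 with h3 | h3
        exacts [h1 (Sum.inl.inj h3), h2 (Sum.inl.inj h3)]
    · refine ⟨j, N.spoke 0, fun i hi h => ?_, fun h _ _ h3 => ?_⟩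
      · rcases h with h | h
        · exact hi (congrArg Prod.fst (Sum.inr.inj h))
        · exact Bool.false_ne_true (congrArg Prod.snd (Sum.inr.inj h))
      · rcases h3 with h | h <;> exact Sum.inl_ne_inr h
    · refine ⟨j - 1, N.spoke 0, fun i hi h => ?_, fun h _ _ h3 => ?_⟩
      · rcases h with h | h
        · exact Bool.false_ne_true (congrArg Prod.snd (Sum.inr.inj h))
        · exact hi (congrArg Prod.fst (Sum.inr.inj h))
      · rcases h3 with h | h <;> exact Sum.inl_ne_inr h
  have hu : ∀ i, g (Sum.inl (N.spoke i)) = g (Sum.inl (N.spoke 0)) :=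
    eq_apply_zero_of_add_one (u := fun i => g (Sum.inl (N.spoke i))) fun i hi => by
      rw [← f0 i, ← f1]
      exact hα _ (hj i hi)
  have hn : ∀ h, g (Sum.inl (R.next h)) = g (Sum.inl h) := by
    intro h
    rcases N.eq_spoke_or_ne h with ⟨i, rfl⟩ | hh
    · rw [hR, hu, hu i]
    · rw [← hσ (Sum.inl h)]
      exact congrArg g (expandTurn_of_ne R hh).symm
  have hα' : ∀ h, h ≠ x → h ≠ N.G.opp x → g (Sum.inl (N.G.opp h)) = g (Sum.inl h) :=
    fun h h1 h2 => hα _ (hx h h1 h2)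
  have hx' := cut_eq hc R (g := fun h => g (Sum.inl h)) hn hα'
  have hα'' : ∀ h, g (Sum.inl (N.G.opp h)) = g (Sum.inl h) := by
    intro h
    by_cases h1 : h = x
    · rw [h1]
      exact hx'
    · by_cases h2 : h = N.G.opp x
      · rw [h2, N.G.opp_invol]
        exact hx'.symm
      · exact hα' h h1 h2
  have hl : ∀ h, g (Sum.inl h) = g (Sum.inl (N.spoke 0)) := fun h =>
    HalfEdgeGraph.Rotation.toMap_conn (R := R) N.connected (fun h => g (Sum.inl h)) hn hα'' _ _
  have key : ∀ a, g a = g (Sum.inl (N.spoke 0)) := by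
    rintro (h | ⟨i, _ | _⟩)
    · exact hl h
    · exact (f0 i).trans (hl _)
    · exact (f1 i).trans (hl _)
  rw [key a, key b]

theorem expand_conn (hR : ∀ i, R.next (N.spoke i) = N.spoke (i + 1)) {c : N.G.EdgeColoring}
    (hc : N.IsThreeEdgeColoring c) : (N.expand R).Conn := fun g h1 h2 =>
  expand_cut_eq hR hc (Sum.inl (N.spoke 0)) g h1 fun x _ => h2 x

theorem expand_plane (hR : ∀ i, R.next (N.spoke i) = N.spoke (i + 1)) {c : N.G.EdgeColoring}
    (hc : N.IsThreeEdgeColoring c) (hP : R.IsPlane) : (N.expand R).Plane := by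
  classical
  have hne : Nonempty (N.expand R).H := ⟨Sum.inl (N.spoke 0)⟩
  have : Finite R.Face := inferInstanceAs (Finite (Quotient _))
  let lV : (N.expand R).H → {u // u ≠ N.v} ⊕ Fin 5
    | Sum.inl h => if hh : N.G.vert h = N.v then Sum.inr (N.ν ⟨h, hh⟩) else Sum.inl ⟨_, hh⟩
    | Sum.inr p => Sum.inr p.1
  have lV1 : ∀ i, lV (Sum.inl (N.spoke i)) = Sum.inr i := fun i =>
    (dif_pos (vert_spoke i)).trans (congrArg Sum.inr (N.ν.apply_symm_apply i))
  have lV2 : ∀ h (hh : N.G.vert h ≠ N.v), lV (Sum.inl h) = Sum.inl ⟨_, hh⟩ := fun h hh => dif_neg hh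
  let face : N.G.H → R.Face := orbitMk R.facePerm
  have hface : ∀ h, face (R.next (N.G.opp h)) = face h := orbitMk_apply R.facePerm
  -- the new face is that inside the pentagon
  let lF : (N.expand R).H → Option R.Face
    | Sum.inl h => some (face h)
    | Sum.inr (i, false) => some (face (N.spoke (i + 1)))
    | Sum.inr (_, true) => none
  have e1 : ∀ i, (N.expand R).σ (Sum.inl (N.spoke i)) = Sum.inr (i, false) := expandTurn_spoke R
  have e2 : ∀ h, N.G.vert h ≠ N.v → (N.expand R).σ (Sum.inl h) = Sum.inl (R.next h) :=
    fun h => expandTurn_of_ne R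
  refine (expand_conn hR hc).plane_of_labels lV ?_ ?_ lF ?_ ?_ ?_
  · rintro (h | ⟨i, _ | _⟩)
    · rcases N.eq_spoke_or_ne h with ⟨i, rfl⟩ | hh
      · rw [e1, lV1]
      · have v1 := HalfEdgeGraph.vert_next R h
        rw [e2 h hh, lV2 h hh, lV2 _ (by rwa [v1])]
        exact congrArg Sum.inl (Subtype.ext v1)
    · rfl
    · exact lV1 i
  · rintro (⟨u, hu⟩ | i)
    · have h3 := N.cubic u hu
      obtain ⟨⟨h, rfl⟩⟩ : Nonempty {x // N.G.vert x = u} := by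
        refine not_isEmpty_iff.1 fun h => ?_
        rw [HalfEdgeGraph.degree, Nat.card_of_isEmpty] at h3
        exact absurd h3 (by norm_num)
      exact ⟨Sum.inl h, lV2 h hu⟩
    · exact ⟨Sum.inr (i, false), rfl⟩
  · intro x
    rw [CombMap.φ_apply]
    rcases x with h | ⟨i, _ | _⟩
    · change lF ((N.expand R).σ (Sum.inl (N.G.opp h))) = some (face h)
      rw [← hface h]
      rcases N.eq_spoke_or_ne (N.G.opp h) with ⟨i, hi⟩ | hh
      · rw [hi, e1, hR]
      · rw [e2 _ hh]
    · rfl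
    · rfl
  · rintro (_ | F)
    · exact ⟨Sum.inr (0, true), rfl⟩
    · obtain ⟨h, rfl⟩ := orbitMk_surjective R.facePerm F
      exact ⟨Sum.inl h, rfl⟩
  · have h1 : Nat.card (N.expand R).H = Nat.card N.G.H + 10 := by
      change Nat.card (N.G.H ⊕ Fin 5 × Bool) = _
      rw [Nat.card_sum]
      simp
    have h2 : Nat.card {u // u ≠ N.v} + 1 = Nat.card N.G.V := card_ne N.v
    rw [h1, Nat.card_sum, Finite.card_option, Nat.card_fin]
    unfold HalfEdgeGraph.Rotation.IsPlane at hP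
    omega

/-- A coloring of the expanded graph restricts to a coloring of the near-cubic graph that extends
to the pentagon. -/
theorem exists_cycleExtends (h : (N.expand R).toGraph.ThreeEdgeColorable) :
    ∃ c, N.IsThreeEdgeColoring c ∧ CycleExtends fun i => c.1 (N.spoke i) := by
  obtain ⟨⟨c, hα⟩, hc⟩ := h
  have hσ : ∀ x, c ((N.expand R).σ x) ≠ c x := fun x =>
    hc _ _ _ (orbitMk_apply _ _) rfl (expand_cubic x).1
  refine ⟨⟨fun h => c (Sum.inl h), fun h => hα (Sum.inl h)⟩, ?_, fun i => c (Sum.inr (i, false)),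
    fun i => ?_⟩
  · have hn : ∀ h, N.G.vert h ≠ N.v → c (Sum.inl (R.next h)) ≠ c (Sum.inl h) := fun h hh => by
      have := hσ (Sum.inl h)
      rwa [show (N.expand R).σ (Sum.inl h) = Sum.inl (R.next h) from expandTurn_of_ne R hh] at this
    rintro u hu x y rfl hy hxy
    obtain ⟨-, n3⟩ := R.next_cubic (N.cubic _ hu)
    rcases eq_of_sameCycle_three n3 ((R.sameCycle_iff x y).2 hy.symm) with rfl | rfl | rfl
    · exact absurd rfl hxy
    · exact (hn x hu).symm
    · have := hn (R.next (R.next x)) (by rwa [hy])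
      rwa [n3] at this
  · have e1 : ∀ i, c (Sum.inr (i, false)) ≠ c (Sum.inl (N.spoke i)) := fun i => by
      have := hσ (Sum.inl (N.spoke i))
      rwa [show (N.expand R).σ (Sum.inl (N.spoke i)) = _ from expandTurn_spoke R i] at this
    have e2 : c (Sum.inr (i + 1, true)) = c (Sum.inr (i, false)) := hα (Sum.inr (i, false))
    exact ⟨e1 i, e2.symm.trans_ne (hσ (Sum.inr (i + 1, true))).symm,
      e2.symm.trans_ne (hσ (Sum.inr (i + 1, false)))⟩

end Expand

/-- The four color theorem in Tait's form implies the criterion: the expanded graph of a colorable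
near-cubic graph has a coloring, while the Petersen fragment has none that extends to the
pentagon. -/
theorem extensionCount_eq_zero (h4 : ∀ G : HalfEdgeGraph, G.IsPlanar → G.IsCubic →
    G.TwoEdgeConnected → G.ThreeEdgeColorable) {N : NearCubicGraph 5} (hN : N.IsPlane)
    (hray : N.extensionCount ∈ petersenFragment.ray) : N.extensionCount = 0 := by
  obtain ⟨R, hP, hR⟩ := hN
  have hR' : ∀ i, R.next (N.spoke i) = N.spoke (i + 1) := fun i => by
    rw [← finRotate_apply]
    exact hR i
  by_contra h0
  obtain ⟨ψ, hψ⟩ := Function.ne_iff.1 h0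
  rw [extensionCount_eq, Pi.zero_apply, Nat.cast_ne_zero] at hψ
  obtain ⟨⟨c, hc, -⟩⟩ := (Nat.card_ne_zero.1 hψ).1
  have hne : Nonempty (N.expand R).H := ⟨Sum.inl (N.spoke 0)⟩
  have hcol := h4 (N.expand R).toGraph
    ⟨_, (expand_plane hR' hc hP).rotation_isPlane⟩
    (fun u => by
      obtain ⟨y, rfl⟩ := orbitMk_surjective _ u
      exact card_orbit_three (expand_cubic y).1 (expand_cubic y).2)
    ⟨(expand_conn hR' hc).toGraph_connected, fun x => CombMap.reachableWithout_of_cuts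
      (fun y hy => by
        rcases hy with rfl | rfl
        · exact Or.inr rfl
        · exact Or.inl ((N.expand R).α_α x))
      (expand_cut_eq hR' hc x)⟩
  obtain ⟨c', hc', hext⟩ := exists_cycleExtends hcol
  obtain ⟨t, -, ht⟩ := hray
  have h1 : (N.colorCount (fun i => c'.1 (N.spoke i)) : ℝ) =
      t * petersenFragment.colorCount fun i => c'.1 (N.spoke i) :=
    (N.extensionCount_eq ⟨_, (oddColors_iff _).1 hext.oddColors⟩).symm.trans
      ((congrFun ht _).trans (congrArg (t * ·) (petersenFragment.extensionCount_eq _)))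
  rw [PetersenFragment.colorCount_eq_zero hext, Nat.cast_zero, mul_zero, Nat.cast_eq_zero] at h1
  have : Finite N.G.EdgeColoring := inferInstanceAs (Finite {c : N.G.H → Fin 3 // _})
  exact (Nat.card_pos_iff.2 ⟨⟨⟨c', hc', fun _ => rfl⟩⟩, inferInstance⟩).ne' h1

end NearCubicGraph

theorem mainTheorem3 :
    (∀ G : HalfEdgeGraph, G.IsPlanar → G.IsCubic → G.TwoEdgeConnected → G.ThreeEdgeColorable) ↔
      (∀ N : NearCubicGraph 5, N.IsPlane →
        N.extensionCount ∈ petersenFragment.ray → N.extensionCount = 0) := by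
  refine ⟨fun h N hN hray => NearCubicGraph.extensionCount_eq_zero h hN hray,
    fun h G hP hC hG => ?_⟩
  by_contra hcol
  obtain ⟨M₀, hM₀⟩ := HalfEdgeGraph.exists_isCounterexample hP hC hG hcol
  obtain ⟨M, hM⟩ := hM₀.exists_minimal
  obtain ⟨N, hN, hray, hne⟩ := hM.exists_nearCubicGraph
  exact hne (h N hN hray)
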